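/- **Setting.** Let $Y(0),Y(1),D\in\{0,1\}$ and let $X$ take values in a subset $\mathcal X$ of $\mathbb R^p$, with $X\sim F_0$; put $Y=DY(1)+(1-D)Y(0)$, $O=(Y,D,X)\sim P_0$, $\pi_0(x)=P(D=1\mid X=x)$, $m_0(d,x)=P(Y=1\mid D=d,X=x)$. Let $\Psi(t)=1/(1+e^{-t})$ and suppose $m_0=\Psi(\eta_0^m)$ for a real-valued function $\eta_0^m$ (so $0<m_0<1$). Write $\bar m(x)=m(1,x)-m(0,x)$, $m_\eta=\Psi(\eta^m)$, $\gamma_0(d,x)=\frac{d}{\pi_0(x)}-\frac{1-d}{1-\pi_0(x)}$, $\chi_0=\mathbb E_0[Y(1)-Y(0)]$, $\widetilde\chi_0(o)=\bar m_0(x)+\gamma_0(d,x)(y-m_0(d,x))-\chi_0$ and $\mathsf v_0=\mathbb E_0[\widetilde\chi_0(O)^2]$. One observes i.i.d. $\mathbf O^{(n)}=(O_1,\dots,O_n)$ from $P_0$; $\mathbb P_n[h]=\frac1n\sum_{i}h(O_i)$, $\mathbb G_n=\sqrt n(\mathbb P_n-P_0)$. Pilot estimators $\widehat\pi$ (with values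 in $(0,1)$) and $\widehat m$ are computed from auxiliary data independent of $\mathbf O^{(n)}$, and $\widehat\gamma(d,x)=\frac{d}{\widehat\pi(x)}-\frac{1-d}{1-\widehat\pi(x)}$. Let $\widehat\chi$ be any estimator with $\widehat\chi=\chi_0+\mathbb P_n[\widetilde\chi_0]+o_{P_0}(n^{-1/2})$. **Prior and posterior.** The prior is $\eta^m(d,x)=W^m(d,x)+\lambda\widehat\gamma(d,x)$, where $W^m(d,\cdot)$, $d\in\{0,1\}$, is a continuous stochastic process (its law may depend on $n$), independent of $\lambda\sim N(0,\sigma_n^2)$. The posterior $\Pi(\cdot\mid\mathbf O^{(n)})$ of $(W^m,\lambda)$, hence of $\eta^m$, is given by Bayes' formula with likelihood $\prod_i m_\eta(D_i,X_i)^{Y_i}(1-m_\eta(D_i,X_i))^{1-Y_i}$. The covariate distribution has the Bayesian bootstrap posterior, independent of that of $\eta^m$: under the posterior $\chi_\eta=\sum_{i=1}^nM_{ni}\bar m_\eta(X_i)$ with $M_{ni}=e_i/\sum_je_j$ and $e_1,\dots,e_n$ i.i.d. $\mathrm{Exp}(1)$. **Assumptions.** 1. (Unconfoundedness and overlap) $(Y(0),Y(1))$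 and $D$ are conditionally independent given $X$, and there is $\bar\pi>0$ with $\bar\pi<\pi_0(x)<1-\bar\pi$ for $F_0$-almost all $x$. 2. (Rates) There are measurable sets $\mathcal H_n^m$ of measurable functions $\eta^m$ (possibly depending on the auxiliary data) with $\Pi(\eta^m\in\mathcal H^m_n\mid\mathbf O^{(n)})\to_{P_0}1$, and deterministic $r_n,\varepsilon_n\to0$ with $\sqrt n\,\varepsilon_nr_n\to0$, such that with probability tending to one $\|\widehat\pi-\pi_0\|_{L^2(F_0)}\le r_n$ and, for $d\in\{0,1\}$, $\|\widehat m(d,\cdot)-m_0(d,\cdot)\|_{L^2(F_0)}\le\varepsilon_n$ and $\sup_{\eta^m\in\mathcal H_n^m}\|m_\eta(d,\cdot)-m_0(d,\cdot)\|_{L^2(F_0)}\le\varepsilon_n$. Moreover $\|\widehat\gamma\|_\infty=O_{P_0}(1)$. 3. (Complexity) $\sup_{\eta^m\in\mathcal H_n^m}|(\mathbb P_n-P_0)\bar m_\eta|=o_{P_0}(1)$ and $\sup_{\eta^m\in\mathcal H_n^m}|\mathbb G_n[(\widehat\gamma-\gamma_0)(m_\eta-m_0)]|=o_{P_0}(1)$.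 4. (Prior stability) $\sigma_n>0$, $n\sigma_n^2\to\infty$; there is a deterministic sequence $u_n\to0$ with $\Pi(|\lambda|\le u_n\sigma_n^2\sqrt n\mid\mathbf O^{(n)})\to_{P_0}1$; and for every $t\in\mathbb R$, $\Pi\big(W^m+(\lambda+tn^{-1/2})\widehat\gamma\in\mathcal H_n^m\mid\mathbf O^{(n)}\big)\to_{P_0}1$. **Theorem.** Let $$\widehat b_\eta=\mathbb P_n\big[\bar m_\eta-\bar{\widehat m}+\widehat\gamma\,(\widehat m-m_\eta)\big]=\frac1n\sum_{i=1}^n\big(\boldsymbol\chi[m_\eta]-\boldsymbol\chi[\widehat m]\big)(O_i),\qquad \boldsymbol\chi[m](o)=\bar m(x)+\widehat\gamma(d,x)(y-m(d,x)).$$ Under Assumptions 1–4, the posterior law of the recentered quantity satisfies $$d_{BL}\Big(\mathcal L_\Pi\big(\sqrt n(\chi_\eta-\widehat\chi-\widehat b_\eta)\mid\mathbf O^{(n)}\big),\,N(0,\mathsf v_0)\Big)\longrightarrow_{P_0}0,$$ where $d_{BL}(P,Q)=\sup_f|\int f\,dP-\int f\,dQ|$ over all $f:\mathbb R\to\mathbb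 R$ with $\sup|f|+\sup_{s\ne s'}|f(s)-f(s')|/|s-s'|\le1$. -/

import Mathlib

open MeasureTheory ProbabilityTheory Filter Topology

noncomputable section

namespace RobustATE

/-- The number `1` for `true` and `0` for `false`; binary variables are `Bool`-valued. -/
def bit (b : Bool) : ℝ := if b then 1 else 0

/-- An observation `o = (y, d, x)`: binary outcome, binary treatment, covariates. -/
abbrev Obs (S : Type*) := Bool × Bool × S

/-- The observed variables `(Y, D, X)` with `Y = D Y(1) + (1 - D) Y(0)`. -/
def observed {Ω S : Type*} (Y1 Y0 D : Ω → Bool) (X : Ω → S) (ω : Ω) : Obs S :=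
  (if D ω then Y1 ω else Y0 ω, D ω, X ω)

/-- The conditional mean `m_η(d, x) = Ψ(η^m(d, x))`, with `Ψ(t) = 1 / (1 + exp (-t))`. -/
def condMean {S : Type*} (η : Bool → S → ℝ) (d : Bool) (x : S) : ℝ := Real.sigmoid (η d x)

/-- `m(1, x) - m(0, x)`. -/
def contrast {S : Type*} (m : Bool → S → ℝ) (x : S) : ℝ := m true x - m false x

/-- The Riesz representor `γ(d, x) = d / π(x) - (1 - d) / (1 - π(x))` of a propensity score. -/
def riesz {S : Type*} (π : S → ℝ) (d : Bool) (x : S) : ℝ :=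
  bit d / π x - (1 - bit d) / (1 - π x)

/-- The uncentred correction `χ[m](o) = m(1, x) - m(0, x) + γ(d, x) (y - m(d, x))`, where `γ` is
the Riesz representor of `π`. -/
def chiCorr {S : Type*} (π : S → ℝ) (m : Bool → S → ℝ) (o : Obs S) : ℝ :=
  contrast m o.2.2 + riesz π o.2.1 o.2.2 * (bit o.1 - m o.2.1 o.2.2)

/-- The efficient influence function at `(π, m)` with value `χ` of the average treatment effect. -/
def eif {S : Type*} (π : S → ℝ) (m : Bool → S → ℝ) (χ : ℝ) (o : Obs S) : ℝ :=
  chiCorr π m o - χ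

/-- The empirical mean `ℙ_n[h]`. -/
def empMean {S : Type*} {n : ℕ} (o : Fin n → S) (h : S → ℝ) : ℝ := (∑ i, h (o i)) / n

/-- The empirical process `𝔾_n[h] = √n (ℙ_n - P)[h]`. -/
def empProcess {S : Type*} [MeasurableSpace S] (P : Measure S) {n : ℕ} (o : Fin n → S)
    (h : S → ℝ) : ℝ :=
  √(n : ℝ) * (empMean o h - ∫ z, h z ∂P)

/-- The feasible recentering term
`ℙ_n[χ[m] - χ[m̂]] = ℙ_n[m(1,x) - m(0,x) - (m̂(1,x) - m̂(0,x)) + γ̂(d,x) (m̂(d,x) - m(d,x))]`. -/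
def recentering {S : Type*} (πhat : S → ℝ) (mhat m : Bool → S → ℝ) {n : ℕ}
    (o : Fin n → Obs S) : ℝ :=
  empMean o fun z => chiCorr πhat m z - chiCorr πhat mhat z

/-- The function `η^m = w + l γ`. -/
def adjusted {S : Type*} (γ : Bool → S → ℝ) (w : Bool → S → ℝ) (l : ℝ) : Bool → S → ℝ :=
  fun d x => w d x + l * γ d x

/-- The likelihood `∏ m(d_i, x_i) ^ y_i (1 - m(d_i, x_i)) ^ (1 - y_i)` of the outcomes. -/
def likelihood {S : Type*} (m : Bool → S → ℝ) {n : ℕ} (o : Fin n → Obs S) : ℝ :=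
  ∏ i, if (o i).1 then m (o i).2.1 (o i).2.2 else 1 - m (o i).2.1 (o i).2.2

/-- The prior law of `(W, λ)`: the process `W` is defined on the probability space `(Θ, PW)`, and
`λ ∼ N(0, σ²)` is independent of it. -/
def wlPrior {Θ : Type*} [MeasurableSpace Θ] (PW : Measure Θ) (σ : ℝ) : Measure (Θ × ℝ) :=
  PW.prod (gaussianReal 0 (σ ^ 2).toNNReal)

/-- The posterior law of `(W, λ)` given the observations `o` (Bayes formula), when the conditional
mean is `Ψ(W + λ γ)`. -/
def wlPosterior {Θ S : Type*} [MeasurableSpace Θ] (PW : Measure Θ) (σ : ℝ)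
    (W : Θ → Bool → S → ℝ) (γ : Bool → S → ℝ) {n : ℕ} (o : Fin n → Obs S) : Measure (Θ × ℝ) :=
  (∫⁻ z, ENNReal.ofReal (likelihood (condMean (adjusted γ (W z.1) z.2)) o) ∂(wlPrior PW σ))⁻¹ •
    (wlPrior PW σ).withDensity
      fun z => ENNReal.ofReal (likelihood (condMean (adjusted γ (W z.1) z.2)) o)

/-- The law of the Bayesian bootstrap weights `e_i / ∑ j, e_j`, with `e_i` i.i.d. `Exp(1)`. -/
def bootWeights (n : ℕ) : Measure (Fin n → ℝ) :=
  (Measure.pi fun _ : Fin n => expMeasure 1).map fun e i => e i / ∑ j, e j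

/-- The posterior law, given the observations `o`, of `√n (χ_η - χ̂ - b̂_η)`. Here
`χ_η = ∑ i, M_i (m_η(1, x_i) - m_η(0, x_i))` is the integral of `m_η(1, ·) - m_η(0, ·)` with respect
to a draw of the covariate distribution from its Bayesian bootstrap posterior, which is independent
of the posterior of `η^m`. -/
def recenteredPosterior {Θ S : Type*} [MeasurableSpace Θ] (PW : Measure Θ) (σ : ℝ)
    (W : Θ → Bool → S → ℝ) (πhat : S → ℝ) (mhat : Bool → S → ℝ) (χhat : ℝ) {n : ℕ}
    (o : Fin n → Obs S) : Measure ℝ :=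
  ((wlPosterior PW σ W (riesz πhat) o).prod (bootWeights n)).map fun q =>
    √(n : ℝ) *
      ((∑ i, q.2 i * contrast (condMean (adjusted (riesz πhat) (W q.1.1) q.1.2)) (o i).2.2)
        - χhat
        - recentering πhat mhat (condMean (adjusted (riesz πhat) (W q.1.1) q.1.2)) o)

/-- The class `BL(1)`: supremum norm plus Lipschitz constant at most one. -/
def IsBL1 {E : Type*} [PseudoMetricSpace E] (f : E → ℝ) : Prop :=
  ∃ a b : ℝ, 0 ≤ a ∧ 0 ≤ b ∧ a + b ≤ 1 ∧ (∀ x, |f x| ≤ a) ∧ ∀ x y, |f x - f y| ≤ b * dist x y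

/-- The bounded Lipschitz distance of two probability measures. -/
def blDist {E : Type*} [PseudoMetricSpace E] [MeasurableSpace E] (P Q : Measure E) : ℝ :=
  sSup {r | ∃ f : E → ℝ, IsBL1 f ∧ r = |∫ x, f x ∂P - ∫ x, f x ∂Q|}

/-- The probabilities `P_n(B_n)` tend to zero. (A measure of a set that is not measurable is its
outer measure.) -/
def Vanishing {T : ℕ → Type*} [∀ n, MeasurableSpace (T n)] (P : ∀ n, Measure (T n))
    (B : ∀ n, Set (T n)) : Prop :=
  Tendsto (fun n => P n (B n)) atTop (𝓝 0)

/-- `f_n → c` in `P_n`-probability. -/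
def TendstoInProb {T : ℕ → Type*} [∀ n, MeasurableSpace (T n)] (P : ∀ n, Measure (T n))
    (f : ∀ n, T n → ℝ) (c : ℝ) : Prop :=
  ∀ δ : ℝ, 0 < δ → Vanishing P fun n => {s | δ ≤ |f n s - c|}

/-- `sup_{η ∈ H_n} |f_n(η)| → 0` in (outer) `P_n`-probability, where `H_n` may be random. -/
def UnifNegligible {T : ℕ → Type*} [∀ n, MeasurableSpace (T n)] (P : ∀ n, Measure (T n))
    {K : Type*} (H : ∀ n, T n → Set K) (f : ∀ n, T n → K → ℝ) : Prop :=
  ∀ δ : ℝ, 0 < δ → Vanishing P fun n => {s | ∃ η ∈ H n s, δ ≤ |f n s η|}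

/-- `f_n = O(1)` in probability, where `bdd n s M` says that the size of `f_n` at `s` is at most
`M`. -/
def BoundedInProb {T : ℕ → Type*} [∀ n, MeasurableSpace (T n)] (P : ∀ n, Measure (T n))
    (bdd : ∀ n, T n → ℝ → Prop) : Prop :=
  ∀ τ : ℝ, 0 < τ → ∃ M : ℝ, ∀ᶠ n in atTop, P n {s | ¬ bdd n s M} ≤ ENNReal.ofReal τ

/-- The joint law of the auxiliary sample (law `Q n`) and of `n` i.i.d. observations from `P₀`,
independent of it. -/
def sampling {A : ℕ → Type*} [∀ n, MeasurableSpace (A n)] (Q : ∀ n, Measure (A n))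
    {S : Type*} [MeasurableSpace S] (P₀ : Measure S) (n : ℕ) : Measure (A n × (Fin n → S)) :=
  (Q n).prod (Measure.pi fun _ : Fin n => P₀)

end RobustATE

end

open RobustATE

/-!
The score `√n ℙ_n[γ̂ (y - m_η)]` of the one-dimensional submodel `λ ↦ W + λ γ̂` appears in the
recentred functional itself: since `b̂_η` is a difference of empirical means, the quantity
`√n (χ_η - χ̂ - b̂_η)` equals minus the score, plus the bootstrap fluctuation
`√n (∑ Mᵢ m̄_η(xᵢ) - ℙ_n[m̄_η])`, plus `√n (ℙ_n[χ[m̂]] - χ̂)`, which does not depend on the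
parameter (`sqrt_mul_recentered_eq`). The three terms are treated separately.

* The posterior Laplace transform of the score is a change of variables. By a second-order expansion
  of the Bernoulli log-likelihood, the product of `exp (-t · score)` and the likelihood at `λ` is
  `exp (t² V / 2)` times the likelihood at `λ - t / √n`, where `V` is close to the empirical
  information `ℙ_n[γ̂² m₀ (1 - m₀)]` (`abs_score_add_logLik_sub_le`). The translation
  `λ ↦ λ + t / √n` changes the Gaussian prior by a factor close to one when `|λ| = o(σ² √n)` and
  `n σ² → ∞`. So the Laplace transform tends to `exp (t² V / 2)`
  (`lintegral_exp_score_le`, `le_lintegral_exp_score`).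
* The bootstrap fluctuation is, up to the factor `1 / ē → 1`, a linear statistic in independent
  centred exponential variables. Its moment generating function is explicit and converges to the one
  of a Gaussian law whose variance is that of the contrast `m̄₀` (`tendsto_lintegral_exp_bootDev`).
  Replacing `m̄_η` by `m̄₀` is a second-moment bound. As the weights are independent of `η`, the
  two limits combine (`tendsto_blDist_bootstrap`).
* `√n (ℙ_n[χ[m̂]] - χ̂)` tends to zero: the bias of `χ[m̂]` is a product of the two pilot errors
  (double robustness, `GoodPilot.abs_integral_chiCorr_sub_le`), its fluctuation is of smaller
  order by Chebyshev's inequality, and `χ̂` is efficient.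

The first two points need that `m_η` is close to `m₀` at the sample points, on average over the
posterior, whereas the hypothesis is closeness in `L²(F₀)`. A bound by leaving one observation out
gives the transfer: given the other observations, a posterior mean of a function of the `i`-th one
is a one-observation posterior mean, and the likelihood ratio of one observation is close to one in
`L¹` uniformly over the set where the posterior concentrates
(`lintegral_iid_posterior_mean_le`, `tendstoInProb_posterior_discrepancy`).

Convergence in probability of the bounded Lipschitz distance follows from convergence along all
deterministic sequences of samples for which the relevant statistics converge
(`tendstoInProb_of_selection`); along such a sequence, convergence of moment generating functions
gives weak convergence, which the Lévy–Prokhorov metric turns into convergence of the distance.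
The limiting variance, information plus variance of the contrast, is the second moment of the
efficient influence function (`ObsModel.integral_eif_sq`).
-/

noncomputable section

namespace RobustATE

/-! ### Weak convergence and the bounded Lipschitz distance -/

/-- Passing from `μ` to `ν` replaces each superlevel set of `f` by its `δ`-thickening, which costs a
Lévy–Prokhorov error `δ` per level; as `f` is `1`-Lipschitz, the thickening lies in the superlevel
set of `f + δ`. -/
lemma integral_le_of_levyProkhorovEDist_lt {μ ν : Measure ℝ} [IsProbabilityMeasure μ]
    [IsProbabilityMeasure ν] {δ : ℝ} (hδ : 0 < δ)
    (h : levyProkhorovEDist μ ν < ENNReal.ofReal δ) {f : ℝ → ℝ} (hf : IsBL1 f) :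
    ∫ x, f x ∂μ ≤ ∫ x, f x ∂ν + 3 * δ := by
  obtain ⟨a, b, ha, hb, hab, hfa, hfb⟩ := hf
  have hlip : ∀ x y, |f x - f y| ≤ |x - y| := fun x y => by
    have := hfb x y
    rw [Real.dist_eq] at this
    nlinarith [abs_nonneg (x - y)]
  have hcont : Continuous f := by
    refine (LipschitzWith.of_dist_le_mul (K := 1) fun x y => ?_).continuous
    simpa [Real.dist_eq] using hlip x y
  -- the nonnegative function `f + a` and its enlargement by `δ`
  let g : BoundedContinuousFunction ℝ ℝ :=
    BoundedContinuousFunction.ofNormedAddCommGroup (fun x => f x + a) (by fun_prop) (2 * a)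
      fun x => by
        rw [Real.norm_eq_abs, abs_le]; have := abs_le.1 (hfa x); constructor <;> linarith
  let g' : BoundedContinuousFunction ℝ ℝ :=
    BoundedContinuousFunction.ofNormedAddCommGroup (fun x => f x + a + δ) (by fun_prop)
      (2 * a + δ) fun x => by
        rw [Real.norm_eq_abs, abs_le]; have := abs_le.1 (hfa x); constructor <;> linarith
  have hg0 : ∀ x, 0 ≤ g x := fun x => by
    have := (abs_le.1 (hfa x)).1
    change 0 ≤ f x + a
    linarith
  have hgn : ‖g‖ ≤ 2 * a :=
    BoundedContinuousFunction.norm_ofNormedAddCommGroup_le _ (by linarith) _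
  have hgg : ‖g‖ ≤ ‖g'‖ := by
    refine (BoundedContinuousFunction.norm_le (norm_nonneg _)).2 fun x => ?_
    rw [Real.norm_eq_abs, abs_of_nonneg (hg0 x)]
    calc g x ≤ g' x := by change f x + a ≤ f x + a + δ; linarith
      _ ≤ ‖g' x‖ := Real.le_norm_self _
      _ ≤ ‖g'‖ := g'.norm_coe_le_norm x
  have h1 := BoundedContinuousFunction.integral_le_of_levyProkhorovEDist_lt μ ν hδ h g
    (Eventually.of_forall hg0)
  have h2 := BoundedContinuousFunction.integral_eq_integral_meas_le g' ν
    (Eventually.of_forall fun x => by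
      change 0 ≤ f x + a + δ
      have : 0 ≤ f x + a := hg0 x
      linarith)
  have hint : ∀ s : Set ℝ, volume s ≠ ⊤ → IntegrableOn (fun t => ν.real {x | t ≤ g' x}) s := by
    intro s hs
    refine Measure.integrableOn_of_bounded (M := 1) hs ?_ ?_
    · refine (Measurable.ennreal_toReal (Antitone.measurable ?_)).aestronglyMeasurable
      exact fun _ _ hst => measure_mono fun _ hx => hst.trans hx
    · exact Eventually.of_forall fun t => by
        rw [Real.norm_eq_abs, abs_of_nonneg measureReal_nonneg]; exact measureReal_le_one
  have hpt : ∀ t, ν.real (Metric.thickening δ {x | t ≤ g x}) ≤ ν.real {x | t ≤ g' x} := by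
    intro t
    refine measureReal_mono (fun x hx => ?_)
    obtain ⟨y, hy, hxy⟩ := Metric.mem_thickening_iff.1 hx
    have h3 := abs_le.1 (hlip x y)
    rw [Real.dist_eq] at hxy
    have hy' : t ≤ f y + a := hy
    change t ≤ f x + a + δ
    linarith
  have h3 : (∫ t in Set.Ioc 0 ‖g‖, ν.real (Metric.thickening δ {x | t ≤ g x}))
      ≤ ∫ t in Set.Ioc 0 ‖g'‖, ν.real {x | t ≤ g' x} := by
    calc _ ≤ ∫ t in Set.Ioc 0 ‖g‖, ν.real {x | t ≤ g' x} := by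
          refine integral_mono_of_nonneg (Eventually.of_forall fun _ => measureReal_nonneg)
            (hint _ measure_Ioc_lt_top.ne) (Eventually.of_forall hpt)
      _ ≤ _ := by
          refine setIntegral_mono_set (hint _ measure_Ioc_lt_top.ne)
            (Eventually.of_forall fun _ => measureReal_nonneg) ?_
          exact (Set.Ioc_subset_Ioc_right hgg).eventuallyLE
  have hfi : ∀ ρ : Measure ℝ, IsProbabilityMeasure ρ → Integrable f ρ := fun ρ _ =>
    Integrable.of_bound hcont.aestronglyMeasurable a (Eventually.of_forall hfa)
  have e1 : ∫ x, g x ∂μ = ∫ x, f x ∂μ + a := by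
    change ∫ x, (f x + a) ∂μ = _
    rw [integral_add (hfi μ inferInstance) (integrable_const _)]; simp
  have e2 : ∫ x, g' x ∂ν = ∫ x, f x ∂ν + a + δ := by
    change ∫ x, (f x + a + δ) ∂ν = _
    simp_rw [add_assoc]
    rw [integral_add (hfi ν inferInstance) (integrable_const _)]; simp
  have : δ * ‖g‖ ≤ δ * 2 := by gcongr; linarith
  linarith

lemma blDist_nonneg {E : Type*} [PseudoMetricSpace E] [MeasurableSpace E] (P Q : Measure E) :
    0 ≤ blDist P Q := by
  refine Real.sSup_nonneg ?_
  rintro r ⟨f, -, rfl⟩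
  exact abs_nonneg _

/-- Weak convergence on the line implies convergence in the bounded Lipschitz distance; the link
is the Lévy–Prokhorov metric. -/
lemma tendsto_blDist_of_tendsto {μ : ℕ → ProbabilityMeasure ℝ} {ν : ProbabilityMeasure ℝ}
    (h : Tendsto μ atTop (𝓝 ν)) :
    Tendsto (fun k => blDist (μ k : Measure ℝ) (ν : Measure ℝ)) atTop (𝓝 0) := by
  have hLP := ((LevyProkhorov.continuous_ofMeasure_probabilityMeasure (Ω := ℝ)).tendsto ν).comp h
  rw [Metric.tendsto_atTop] at hLP ⊢
  intro ε hε
  obtain ⟨N, hN⟩ := hLP (ε / 4) (by positivity)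
  refine ⟨N, fun k hk => ?_⟩
  have hk := hN k hk
  rw [Real.dist_eq, sub_zero, abs_of_nonneg (blDist_nonneg _ _)]
  have h1 : levyProkhorovEDist (μ k : Measure ℝ) ν < ENNReal.ofReal (ε / 4) := by
    rw [← ENNReal.toReal_lt_toReal (levyProkhorovEDist_ne_top _ _) ENNReal.ofReal_ne_top,
      ENNReal.toReal_ofReal (by positivity)]
    simpa [LevyProkhorov.dist_probabilityMeasure_def, levyProkhorovDist] using hk
  have h2 := h1
  rw [levyProkhorovEDist_comm] at h2
  refine lt_of_le_of_lt (Real.sSup_le (a := 3 * (ε / 4)) ?_ (by positivity)) (by linarith)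
  rintro r ⟨f, hf, rfl⟩
  have h3 := integral_le_of_levyProkhorovEDist_lt (by positivity) h1 hf
  have h4 := integral_le_of_levyProkhorovEDist_lt (by positivity) h2 hf
  rw [abs_le]; constructor <;> linarith

/-! ### Convergence of moment generating functions -/

/-- A centred Gaussian law is determined by its moment generating function, since the latter is
finite everywhere and extends to the imaginary axis. -/
lemma measureReal_eq_gaussian_of_lintegral_exp {ν : Measure ℝ} [IsProbabilityMeasure ν] {v : ℝ}
    (hv : 0 ≤ v)
    (h : ∀ t : ℝ, ∫⁻ x, ENNReal.ofReal (Real.exp (t * x)) ∂ν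
      = ENNReal.ofReal (Real.exp (v * t ^ 2 / 2))) :
    ν = gaussianReal 0 v.toNNReal := by
  have hint : ∀ t, Integrable (fun x => Real.exp (t * x)) ν := fun t => by
    refine ⟨by fun_prop, ?_⟩
    rw [hasFiniteIntegral_iff_ofReal (Eventually.of_forall fun x => (Real.exp_pos _).le), h]
    exact ENNReal.ofReal_lt_top
  have hmgf : mgf id ν = mgf id (gaussianReal 0 v.toNNReal) := by
    ext t
    rw [mgf_id_gaussianReal, mgf]
    simp only [id]
    rw [integral_eq_lintegral_of_nonneg_ae (Eventually.of_forall fun x => (Real.exp_pos _).le)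
      (by fun_prop), h, ENNReal.toReal_ofReal (Real.exp_pos _).le, Real.coe_toNNReal _ hv]
    ring_nf
  have hset : integrableExpSet id ν = Set.univ := by
    ext t; simpa [integrableExpSet] using hint t
  have hE := eqOn_complexMGF_of_mgf hmgf
  refine Measure.ext_of_charFun ?_
  ext t
  rw [← complexMGF_id_mul_I, ← complexMGF_id_mul_I]
  refine hE ?_
  simp [hset]

/-- The truncation error of an exponential is controlled by the exponential with twice the exponent.
-/
lemma exp_sub_min_le (N x : ℝ) (hN : 0 < N) :
    Real.exp x - min (Real.exp x) N ≤ Real.exp (2 * x) / N := by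
  have hx := Real.exp_pos x
  rw [show 2 * x = x + x by ring, Real.exp_add, le_div_iff₀ hN]
  rcases le_total (Real.exp x) N with h | h
  · rw [min_eq_left h]; nlinarith
  · rw [min_eq_right h]; nlinarith

/-- Convergence of the moment generating functions to the one of a centred Gaussian law implies
weak convergence. -/
lemma tendsto_gaussian_of_lintegral_exp {μ : ℕ → ProbabilityMeasure ℝ} {v : ℝ} (hv : 0 ≤ v)
    (h : ∀ t : ℝ, Tendsto (fun k => ∫⁻ x, ENNReal.ofReal (Real.exp (t * x)) ∂(μ k : Measure ℝ))
      atTop (𝓝 (ENNReal.ofReal (Real.exp (v * t ^ 2 / 2))))) :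
    Tendsto μ atTop (𝓝 (⟨gaussianReal 0 v.toNNReal, inferInstance⟩ : ProbabilityMeasure ℝ)) := by
  set C : ℝ → ENNReal := fun t => ENNReal.ofReal (Real.exp (v * t ^ 2 / 2)) + 1 with hC
  have hbd : ∀ t : ℝ, ∀ᶠ k in atTop,
      ∫⁻ x, ENNReal.ofReal (Real.exp (t * x)) ∂(μ k : Measure ℝ) ≤ C t := fun t =>
    ((h t).eventually_lt_const (ENNReal.lt_add_right ENNReal.ofReal_ne_top one_ne_zero)).mono
      fun _ hk => hk.le
  have hCtop : ∀ t, C t ≠ ⊤ := fun t => by simp [hC]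
  -- tightness: Markov's inequality for the exponentials `exp x` and `exp (-x)`
  have htight : IsTightMeasureSet (Set.range fun k => (μ k : Measure ℝ)) := by
    refine isTightMeasureSet_range_of_tendsto_limsup_measure_norm_gt ?_
    have hlim : Tendsto (fun r : ℝ => ENNReal.ofReal (Real.exp (-r)) * (C 1 + C (-1))) atTop
        (𝓝 0) := by
      have h0 : Tendsto (fun r : ℝ => ENNReal.ofReal (Real.exp (-r))) atTop (𝓝 0) := by
        simpa using ENNReal.tendsto_ofReal (Real.tendsto_exp_neg_atTop_nhds_zero)
      have := ENNReal.Tendsto.mul_const (b := C 1 + C (-1)) h0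
        (Or.inr (ENNReal.add_ne_top.2 ⟨hCtop _, hCtop _⟩))
      simpa using this
    refine tendsto_of_tendsto_of_tendsto_of_le_of_le tendsto_const_nhds hlim
      (fun _ => zero_le) fun r => ?_
    refine limsup_le_of_le (by isBoundedDefault) ?_
    filter_upwards [hbd 1, hbd (-1)] with k h1 h2
    calc (μ k : Measure ℝ) {x | r < ‖x‖}
        = ∫⁻ x, Set.indicator {x | r < ‖x‖} 1 x ∂(μ k : Measure ℝ) := by
          rw [lintegral_indicator_one]
          exact (isOpen_lt continuous_const continuous_norm).measurableSet
      _ ≤ ∫⁻ x, ENNReal.ofReal (Real.exp (-r)) * (ENNReal.ofReal (Real.exp (1 * x))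
            + ENNReal.ofReal (Real.exp (-1 * x))) ∂(μ k : Measure ℝ) := by
          refine lintegral_mono fun x => ?_
          by_cases hx : r < ‖x‖
          · rw [Set.indicator_of_mem (by exact hx), ← ENNReal.ofReal_add (Real.exp_pos _).le
              (Real.exp_pos _).le, ← ENNReal.ofReal_mul (Real.exp_pos _).le, Pi.one_apply,
              ENNReal.one_le_ofReal, mul_add, ← Real.exp_add, ← Real.exp_add]
            rcases le_total 0 x with h0 | h0
            · rw [Real.norm_eq_abs, abs_of_nonneg h0] at hx
              have := Real.one_le_exp (show 0 ≤ -r + 1 * x by linarith)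
              have := Real.exp_pos (-r + -1 * x)
              linarith
            · rw [Real.norm_eq_abs, abs_of_nonpos h0] at hx
              have := Real.one_le_exp (show 0 ≤ -r + -1 * x by linarith)
              have := Real.exp_pos (-r + 1 * x)
              linarith
          · rw [Set.indicator_of_notMem (by exact hx)]; exact zero_le
      _ ≤ _ := by
          rw [lintegral_const_mul _ (by fun_prop), lintegral_add_left (by fun_prop)]
          gcongr
  -- by compactness each ultrafilter has a limit law, which is shown to have the Gaussian moment
  -- generating function
  refine (Filter.tendsto_iff_ultrafilter _ _ _).2 fun U hU => ?_
  have hcomp : IsCompact (closure (Set.range μ)) := by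
    refine isCompact_closure_of_isTightMeasureSet ?_
    convert! htight using 1
    ext ρ; simp
  obtain ⟨ν, -, hν : Tendsto _ _ _⟩ := hcomp.ultrafilter_le_nhds (U.map μ)
    (.trans (by simp) (monotone_principal subset_closure))
  suffices hs : (ν : Measure ℝ) = gaussianReal 0 v.toNNReal by
    have : ν = (⟨gaussianReal 0 v.toNNReal, inferInstance⟩ : ProbabilityMeasure ℝ) :=
      Subtype.ext hs
    rw [← this]; exact hν
  refine measureReal_eq_gaussian_of_lintegral_exp hv fun t => ?_
  -- `exp (t x)` is unbounded, so weak convergence is applied to `min (exp (t x)) N`; the error is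
  -- at most `exp (2 t x) / N`, whose mean is bounded along the sequence
  let g : ℝ → BoundedContinuousFunction ℝ ℝ := fun N =>
    BoundedContinuousFunction.ofNormedAddCommGroup (fun x => min (Real.exp (t * x)) (|N|))
      (by fun_prop) |N| fun x => by
        rw [Real.norm_eq_abs, abs_of_nonneg (le_min (Real.exp_pos _).le (abs_nonneg _))]
        exact min_le_right _ _
  have hgnn : ∀ N x, 0 ≤ g N x := fun N x => le_min (Real.exp_pos _).le (abs_nonneg _)
  have hgint : ∀ N (ρ : ProbabilityMeasure ℝ), ∫⁻ x, ENNReal.ofReal (g N x) ∂(ρ : Measure ℝ)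
      = ENNReal.ofReal (∫ x, g N x ∂(ρ : Measure ℝ)) := fun N ρ =>
    (ofReal_integral_eq_lintegral_ofReal ((g N).integrable _)
      (Eventually.of_forall (hgnn N))).symm
  have hconv : ∀ N, Tendsto (fun k => ∫⁻ x, ENNReal.ofReal (g N x) ∂(μ k : Measure ℝ)) U
      (𝓝 (∫⁻ x, ENNReal.ofReal (g N x) ∂(ν : Measure ℝ))) := fun N => by
    simp_rw [hgint]
    exact ENNReal.tendsto_ofReal
      ((ProbabilityMeasure.tendsto_iff_forall_integral_tendsto.1 hν) (g N))
  have hup : ∀ N, ∫⁻ x, ENNReal.ofReal (g N x) ∂(ν : Measure ℝ)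
      ≤ ENNReal.ofReal (Real.exp (v * t ^ 2 / 2)) := fun N => by
    refine le_of_tendsto_of_tendsto' (hconv N) ((h t).mono_left hU) fun k => ?_
    exact lintegral_mono fun x => ENNReal.ofReal_le_ofReal (min_le_left _ _)
  have hlow : ∀ N : ℝ, 0 < N → ENNReal.ofReal (Real.exp (v * t ^ 2 / 2))
      ≤ ∫⁻ x, ENNReal.ofReal (g N x) ∂(ν : Measure ℝ) + C (2 * t) * ENNReal.ofReal (1 / N) := by
    intro N hN
    refine le_of_tendsto_of_tendsto ((h t).mono_left hU) ((hconv N).add_const _)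
      (hU ?_)
    filter_upwards [hbd (2 * t)] with k hk
    calc ∫⁻ x, ENNReal.ofReal (Real.exp (t * x)) ∂(μ k : Measure ℝ)
        ≤ ∫⁻ x, (ENNReal.ofReal (g N x) + ENNReal.ofReal (Real.exp (2 * t * x))
            * ENNReal.ofReal (1 / N)) ∂(μ k : Measure ℝ) := by
          refine lintegral_mono fun x => ?_
          rw [← ENNReal.ofReal_mul (Real.exp_pos _).le, ← ENNReal.ofReal_add (hgnn _ _)
            (by positivity)]
          refine ENNReal.ofReal_le_ofReal ?_
          have := exp_sub_min_le N (t * x) hN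
          have e : g N x = min (Real.exp (t * x)) N := by
            change min (Real.exp (t * x)) |N| = _
            rw [abs_of_pos hN]
          rw [e, mul_one_div, show 2 * t * x = 2 * (t * x) by ring]
          linarith
      _ ≤ _ := by
          rw [lintegral_add_left (by exact (g N).continuous.measurable.ennreal_ofReal),
            lintegral_mul_const _ (by fun_prop)]
          gcongr
  -- monotone convergence as `N → ∞`
  have hmono : Tendsto (fun N : ℕ => ∫⁻ x, ENNReal.ofReal (g N x) ∂(ν : Measure ℝ)) atTop
      (𝓝 (∫⁻ x, ENNReal.ofReal (Real.exp (t * x)) ∂(ν : Measure ℝ))) := by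
    refine lintegral_tendsto_of_tendsto_of_monotone
      (fun N => ((g N).continuous.measurable.ennreal_ofReal).aemeasurable) ?_ ?_
    · refine Eventually.of_forall fun x N M hNM => ENNReal.ofReal_le_ofReal ?_
      refine min_le_min le_rfl ?_
      simpa using hNM
    · refine Eventually.of_forall fun x => ENNReal.tendsto_ofReal ?_
      refine tendsto_const_nhds.congr' ?_
      obtain ⟨N₀, hN₀⟩ := exists_nat_ge (Real.exp (t * x))
      filter_upwards [eventually_ge_atTop N₀] with N hN
      have : Real.exp (t * x) ≤ |(N : ℝ)| := by
        rw [Nat.abs_cast]; exact hN₀.trans (by exact_mod_cast hN)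
      exact (min_eq_left this).symm
  refine le_antisymm (le_of_tendsto' hmono fun N => hup N) ?_
  have hz : Tendsto (fun N : ℕ => C (2 * t) * ENNReal.ofReal (1 / (N : ℝ))) atTop (𝓝 0) := by
    have h0 : Tendsto (fun N : ℕ => ENNReal.ofReal (1 / (N : ℝ))) atTop (𝓝 0) := by
      simpa using ENNReal.tendsto_ofReal (tendsto_one_div_atTop_nhds_zero_nat (𝕜 := ℝ))
    simpa using ENNReal.Tendsto.const_mul (a := C (2 * t)) h0 (Or.inr (hCtop _))
  have := hmono.add hz
  rw [add_zero] at this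
  refine ge_of_tendsto this ?_
  filter_upwards [eventually_gt_atTop 0] with N hN
  exact hlow N (by exact_mod_cast hN)

/-! ### Expansion of the Bernoulli log-likelihood -/

lemma abs_le_of_abs_deriv_le {g g' : ℝ → ℝ} (hg : ∀ s, HasDerivAt g (g' s) s) (h0 : g 0 = 0)
    {k : ℕ} (hb : ∀ s, |g' s| ≤ |s| ^ k) (u : ℝ) : |g u| ≤ |u| ^ (k + 1) := by
  have := (convex_uIcc (0 : ℝ) u).norm_image_sub_le_of_norm_hasDerivWithin_le
    (f := g) (f' := g') (C := |u| ^ k) (x := 0) (y := u)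
    (fun s _ => (hg s).hasDerivWithinAt) (fun s hs => ?_) Set.left_mem_uIcc Set.right_mem_uIcc
  · simpa [h0, pow_succ] using this
  · refine (hb s).trans ?_
    have : |s| ≤ |u| := by
      have := Set.abs_sub_left_of_mem_uIcc hs
      simpa using this
    gcongr

/-- The log-likelihood of one binary outcome in the logit parametrisation. -/
def logLik (y : Bool) (x : ℝ) : ℝ :=
  Real.log (if y then Real.sigmoid x else 1 - Real.sigmoid x)

lemma hasDerivAt_logLik (y : Bool) (x : ℝ) :
    HasDerivAt (logLik y) (bit y - Real.sigmoid x) x := by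
  have h1 := Real.sigmoid_pos x
  have h2 := Real.sigmoid_lt_one x
  have hs := Real.hasDerivAt_sigmoid x
  cases y
  · have h := (hs.const_sub 1).log (by linarith : 1 - Real.sigmoid x ≠ 0)
    have e : bit false - Real.sigmoid x
        = -(Real.sigmoid x * (1 - Real.sigmoid x)) / (1 - Real.sigmoid x) := by
      have : 1 - Real.sigmoid x ≠ 0 := by linarith
      simp only [bit]; field_simp; simp
    rw [e, show logLik false = fun s => Real.log (1 - Real.sigmoid s) by ext; simp [logLik]]
    exact h
  · have h := hs.log h1.ne'
    have e : bit true - Real.sigmoid x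
        = (Real.sigmoid x * (1 - Real.sigmoid x)) / (Real.sigmoid x) := by
      simp only [bit]; field_simp; simp
    rw [e, show logLik true = fun s => Real.log (Real.sigmoid s) by ext; simp [logLik]]
    exact h

lemma abs_sigmoid_sub_le (x y : ℝ) : |Real.sigmoid x - Real.sigmoid y| ≤ |x - y| := by
  have := abs_le_of_abs_deriv_le (g := fun s => Real.sigmoid (y + s) - Real.sigmoid y)
    (g' := fun s => Real.sigmoid (y + s) * (1 - Real.sigmoid (y + s))) (k := 0)
    (fun s => ?_) (by simp) (fun s => ?_) (x - y)
  · simpa using this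
  · have := (Real.hasDerivAt_sigmoid (y + s)).comp_const_add y s
    exact this.sub_const _
  · have h1 := Real.sigmoid_pos (y + s)
    have h2 := Real.sigmoid_lt_one (y + s)
    rw [pow_zero, abs_of_nonneg (by nlinarith)]
    nlinarith

lemma abs_mul_one_sub_sub_le {p q : ℝ} (hp : 0 ≤ p ∧ p ≤ 1) (hq : 0 ≤ q ∧ q ≤ 1) :
    |p * (1 - p) - q * (1 - q)| ≤ |p - q| := by
  rw [show p * (1 - p) - q * (1 - q) = (p - q) * (1 - p - q) by ring, abs_mul]
  have : |1 - p - q| ≤ 1 := by rw [abs_le]; constructor <;> linarith [hp.1, hp.2, hq.1, hq.2]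
  nlinarith [abs_nonneg (p - q)]

/-- Second-order Taylor expansion of the log-likelihood, with a cubic remainder. -/
lemma abs_logLik_add_sub_le (y : Bool) (x u : ℝ) :
    |logLik y (x + u) - logLik y x - (bit y - Real.sigmoid x) * u
      + Real.sigmoid x * (1 - Real.sigmoid x) * u ^ 2 / 2| ≤ |u| ^ 3 := by
  set p := Real.sigmoid x with hp
  have hs : ∀ s, 0 ≤ Real.sigmoid s ∧ Real.sigmoid s ≤ 1 := fun s =>
    ⟨Real.sigmoid_nonneg s, Real.sigmoid_le_one s⟩
  refine abs_le_of_abs_deriv_le (k := 2)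
    (g := fun u => logLik y (x + u) - logLik y x - (bit y - p) * u + p * (1 - p) * u ^ 2 / 2)
    (g' := fun u => -(Real.sigmoid (x + u) - p - p * (1 - p) * u))
    (fun s => ?_) (by simp) (fun s => ?_) u
  · have h1 := ((hasDerivAt_logLik y (x + s)).comp_const_add x s).sub_const (logLik y x)
    have h2 := (hasDerivAt_id s).const_mul (bit y - p)
    have h3 := ((hasDerivAt_pow 2 s).const_mul (p * (1 - p))).div_const 2
    convert! (h1.sub h2).add h3 using 1
    simp; ring
  · rw [abs_neg]
    refine abs_le_of_abs_deriv_le (k := 1)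
      (g := fun s => Real.sigmoid (x + s) - p - p * (1 - p) * s)
      (g' := fun s => Real.sigmoid (x + s) * (1 - Real.sigmoid (x + s)) - p * (1 - p))
      (fun s => ?_) (by simp [hp]) (fun s => ?_) s
    · have h1 := ((Real.hasDerivAt_sigmoid (x + s)).comp_const_add x s).sub_const p
      have h2 := (hasDerivAt_id s).const_mul (p * (1 - p))
      convert! h1.sub h2 using 1
      simp
    · rw [pow_one]
      refine (abs_mul_one_sub_sub_le (hs _) (hs _)).trans ?_
      simpa using abs_sigmoid_sub_le (x + s) x

/-! ### The exponential law -/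

lemma lintegral_exp_expMeasure {t : ℝ} (ht : t < 1) :
    ∫⁻ x, ENNReal.ofReal (Real.exp (t * x)) ∂(expMeasure 1) = ENNReal.ofReal (1 / (1 - t)) := by
  have h1 : 0 < 1 - t := by linarith
  have hE : expMeasure 1 = volume.withDensity (exponentialPDF 1) := rfl
  have hm : ∀ r, Measurable (exponentialPDF r) := fun r =>
    (measurable_exponentialPDFReal r).ennreal_ofReal
  rw [hE, lintegral_withDensity_eq_lintegral_mul _ (hm 1) (by fun_prop)]
  calc _ = ∫⁻ x, ENNReal.ofReal (1 / (1 - t)) * exponentialPDF (1 - t) x := by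
        refine lintegral_congr fun x => ?_
        rw [Pi.mul_apply, exponentialPDF_eq, exponentialPDF_eq]
        split_ifs with hx
        · rw [← ENNReal.ofReal_mul (by positivity), ← ENNReal.ofReal_mul (by positivity), one_mul,
            ← Real.exp_add, ← mul_assoc, one_div_mul_cancel h1.ne', one_mul]
          ring_nf
        · simp
    _ = _ := by
        rw [lintegral_const_mul _ (hm _), lintegral_exponentialPDF_eq_one h1, mul_one]

lemma integral_pow_expMeasure (k : ℕ) :
    Integrable (fun x => x ^ k) (expMeasure 1) ∧ ∫ x, x ^ k ∂(expMeasure 1) = k.factorial := by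
  have hE : expMeasure 1 = volume.withDensity
      (fun x => ENNReal.ofReal (exponentialPDFReal 1 x)) := rfl
  have hm : Measurable fun x => ENNReal.ofReal (exponentialPDFReal 1 x) :=
    (measurable_exponentialPDFReal 1).ennreal_ofReal
  have hpt : (fun x => (ENNReal.ofReal (exponentialPDFReal 1 x)).toReal • x ^ k)
      = Set.indicator (Set.Ici 0) fun x : ℝ => Real.exp (-x) * x ^ ((k + 1 : ℝ) - 1) := by
    ext x
    rw [ENNReal.toReal_ofReal (exponentialPDFReal_nonneg one_pos x), Set.indicator_apply,
      exponentialPDFReal, gammaPDFReal]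
    simp only [Set.mem_Ici, smul_eq_mul]
    split_ifs <;> simp
  have hint : IntegrableOn (fun x : ℝ => Real.exp (-x) * x ^ ((k + 1 : ℝ) - 1)) (Set.Ici 0) := by
    rw [integrableOn_Ici_iff_integrableOn_Ioi]
    exact Real.GammaIntegral_convergent (by positivity)
  constructor
  · rw [hE, integrable_withDensity_iff_integrable_smul' hm
      (Eventually.of_forall fun _ => ENNReal.ofReal_lt_top), hpt]
    exact hint.integrable_indicator measurableSet_Ici
  · rw [hE, integral_withDensity_eq_integral_toReal_smul hm
      (Eventually.of_forall fun _ => ENNReal.ofReal_lt_top), hpt,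
      integral_indicator measurableSet_Ici, integral_Ici_eq_integral_Ioi,
      ← Real.Gamma_eq_integral (by positivity), Real.Gamma_nat_eq_factorial]

instance : IsProbabilityMeasure (expMeasure 1) := isProbabilityMeasure_expMeasure one_pos

lemma memLp_id_expMeasure : MemLp (fun x : ℝ => x) 2 (expMeasure 1) := by
  rw [memLp_two_iff_integrable_sq (by fun_prop)]
  exact (integral_pow_expMeasure 2).1

lemma integral_id_expMeasure : ∫ x, x ∂(expMeasure 1) = 1 := by
  simpa using (integral_pow_expMeasure 1).2

lemma variance_id_expMeasure : Var[fun x : ℝ => x; expMeasure 1] = 1 := by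
  rw [variance_eq_sub memLp_id_expMeasure, integral_id_expMeasure]
  have := (integral_pow_expMeasure 2).2
  simp only [Pi.pow_apply, this]
  norm_num [Nat.factorial]

/-! ### Sums of independent variables -/

/-- The law of `n` independent standard exponential variables. -/
def expSample (n : ℕ) : Measure (Fin n → ℝ) := Measure.pi fun _ : Fin n => expMeasure 1

instance (n : ℕ) : IsProbabilityMeasure (expSample n) := by unfold expSample; infer_instance

/-- Weighted sums of centred i.i.d. variables: the second moment is finite and equals
`Var(h) ∑ cᵢ²`. -/
lemma integral_sq_weighted_sum {E : Type*} [MeasurableSpace E] (ρ : Measure E)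
    [IsProbabilityMeasure ρ] {h : E → ℝ} (hh : MemLp h 2 ρ) {n : ℕ} (c : Fin n → ℝ) :
    Integrable (fun o : Fin n → E => (∑ i, (h (o i) - ∫ x, h x ∂ρ) * c i) ^ 2)
        (Measure.pi fun _ : Fin n => ρ) ∧
      ∫ o, (∑ i, (h (o i) - ∫ x, h x ∂ρ) * c i) ^ 2 ∂(Measure.pi fun _ : Fin n => ρ)
        = Var[h; ρ] * ∑ i, c i ^ 2 := by
  set m := ∫ x, h x ∂ρ with hm
  let Y : Fin n → E → ℝ := fun i x => (h x - m) * c i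
  have hY : ∀ i, MemLp (Y i) 2 ρ := fun i => (hh.sub (memLp_const m)).mul_const (c i)
  have hYo : ∀ i, MemLp (fun o : Fin n → E => Y i (o i)) 2 (Measure.pi fun _ : Fin n => ρ) :=
    fun i => (hY i).comp_measurePreserving (measurePreserving_eval _ i)
  have hS : MemLp (∑ i, fun o : Fin n → E => Y i (o i)) 2 (Measure.pi fun _ : Fin n => ρ) :=
    memLp_finsetSum' _ fun i _ => hYo i
  have e : (∑ i, fun o : Fin n → E => Y i (o i)) = fun o => ∑ i, (h (o i) - m) * c i := by
    ext o; simp [Y]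
  have hYz : ∀ i, ∫ x, Y i x ∂ρ = 0 := fun i => by
    simp only [Y]
    rw [integral_mul_const, integral_sub (hh.integrable one_le_two) (integrable_const _)]
    simp [hm]
  have hv := variance_sum_pi (μ := fun _ : Fin n => ρ) hY
  rw [variance_of_integral_eq_zero hS.aemeasurable] at hv
  · rw [e] at hv hS
    refine ⟨by simpa using (memLp_two_iff_integrable_sq hS.1).1 hS, ?_⟩
    have : ∀ i, Var[Y i; ρ] = Var[h; ρ] * c i ^ 2 := fun i => by
      simp only [Y]
      rw [variance_mul_const, variance_sub_const hh.1, mul_comm]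
    rw [Finset.mul_sum, ← Finset.sum_congr rfl fun i _ => this i, ← hv]
  · rw [show (∑ i, fun o : Fin n → E => Y i (o i)) = fun o => ∑ i, Y i (o i) by ext; simp,
      integral_finsetSum _ fun i _ => (hYo i).integrable one_le_two]
    refine Finset.sum_eq_zero fun i _ => ?_
    have hp := measurePreserving_eval (fun _ : Fin n => ρ) i
    have := integral_map hp.measurable.aemeasurable (f := Y i) (by rw [hp.map_eq]; exact (hY i).1)
    rw [hp.map_eq, hYz i] at this
    exact this.symm

/-- Chebyshev's inequality in the form of a second-moment bound. -/
lemma measure_abs_ge_le {E : Type*} [MeasurableSpace E] (ρ : Measure E) {f : E → ℝ} {K τ : ℝ}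
    (hτ : 0 < τ) (hf : Integrable (fun x => f x ^ 2) ρ) (hK : ∫ x, f x ^ 2 ∂ρ ≤ K) :
    ρ {x | τ ≤ |f x|} ≤ ENNReal.ofReal (K / τ ^ 2) := by
  have h1 := mul_meas_ge_le_lintegral₀ (μ := ρ) (f := fun x => ENNReal.ofReal (f x ^ 2))
    hf.1.aemeasurable.ennreal_ofReal (ENNReal.ofReal (τ ^ 2))
  have h2 : {x | τ ≤ |f x|} ⊆ {x | ENNReal.ofReal (τ ^ 2) ≤ ENNReal.ofReal (f x ^ 2)} := by
    intro x hx
    refine ENNReal.ofReal_le_ofReal ?_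
    rw [← sq_abs (f x)]
    exact pow_le_pow_left₀ hτ.le hx 2
  have h3 : ∫⁻ x, ENNReal.ofReal (f x ^ 2) ∂ρ ≤ ENNReal.ofReal K := by
    rw [← ofReal_integral_eq_lintegral_ofReal hf (Eventually.of_forall fun x => sq_nonneg _)]
    exact ENNReal.ofReal_le_ofReal hK
  rw [ENNReal.ofReal_div_of_pos (by positivity), ENNReal.le_div_iff_mul_le
    (Or.inl (by simpa using hτ.ne')) (Or.inl ENNReal.ofReal_ne_top), mul_comm]
  refine (mul_le_mul_right (measure_mono h2) _).trans (h1.trans h3)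

/-! ### The Bayesian bootstrap -/

/-- The arithmetic mean of finitely many numbers. -/
def avg {n : ℕ} (c : Fin n → ℝ) : ℝ := (∑ i, c i) / n

/-- The numerator `n^{-1/2} ∑ (eᵢ - 1) (cᵢ - c̄)` of the bootstrap deviation
`√n (∑ eᵢ cᵢ / ∑ eⱼ - c̄)`. -/
def bootDev {n : ℕ} (c : Fin n → ℝ) (e : Fin n → ℝ) : ℝ :=
  ∑ i, (e i - 1) * ((√(n : ℝ))⁻¹ * (c i - avg c))

lemma sum_sub_avg {n : ℕ} (hn : 0 < n) (c : Fin n → ℝ) : ∑ i, (c i - avg c) = 0 := by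
  have : (n : ℝ) ≠ 0 := by positivity
  simp [avg, Finset.sum_sub_distrib]
  field_simp
  ring

lemma avg_sub {n : ℕ} (c f : Fin n → ℝ) : avg (fun i => c i - f i) = avg c - avg f := by
  simp [avg, Finset.sum_sub_distrib, sub_div]

lemma bootDev_sub {n : ℕ} (c f e : Fin n → ℝ) :
    bootDev (fun i => c i - f i) e = bootDev c e - bootDev f e := by
  simp only [bootDev, avg_sub, ← Finset.sum_sub_distrib]
  exact Finset.sum_congr rfl fun i _ => by ring

/-- The bootstrap deviation as a ratio: a linear statistic in the exponential variables over their
mean. -/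
lemma sqrt_mul_boot_eq {n : ℕ} (hn : 0 < n) (c e : Fin n → ℝ) (he : avg e ≠ 0) :
    √(n : ℝ) * (∑ i, (e i / ∑ j, e j) * c i - avg c) = bootDev c e / avg e := by
  have hn' : (0 : ℝ) < n := by exact_mod_cast hn
  have hs : ∑ j, e j = n * avg e := by rw [avg]; field_simp
  have h1 : bootDev c e = (√(n : ℝ))⁻¹ * (∑ i, e i * c i - (n * avg e) * avg c) := by
    have e1 : ∀ i, (e i - 1) * ((√(n : ℝ))⁻¹ * (c i - avg c))
        = (√(n : ℝ))⁻¹ * (e i * c i) - (√(n : ℝ))⁻¹ * avg c * e i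
          - (√(n : ℝ))⁻¹ * (c i - avg c) := fun i => by ring
    rw [bootDev, Finset.sum_congr rfl fun i _ => e1 i, Finset.sum_sub_distrib,
      Finset.sum_sub_distrib, ← Finset.mul_sum, ← Finset.mul_sum, ← Finset.mul_sum,
      sum_sub_avg hn, hs]
    ring
  have h2 : ∑ i, (e i / ∑ j, e j) * c i = (∑ i, e i * c i) / (n * avg e) := by
    rw [hs, Finset.sum_div]
    exact Finset.sum_congr rfl fun i _ => by ring
  rw [h1, h2]
  have hq : √(n : ℝ) ≠ 0 := (Real.sqrt_pos.2 hn').ne'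
  field_simp
  rw [Real.sq_sqrt hn'.le]

lemma sum_sq_sub_avg {n : ℕ} (hn : 0 < n) (c : Fin n → ℝ) :
    ∑ i, ((√(n : ℝ))⁻¹ * (c i - avg c)) ^ 2 = avg (fun i => c i ^ 2) - avg c ^ 2 := by
  have hn' : (0 : ℝ) < n := by exact_mod_cast hn
  have hs : ∑ j, c j = n * avg c := by rw [avg]; field_simp
  have e1 : ∀ i, ((√(n : ℝ))⁻¹ * (c i - avg c)) ^ 2
      = (n : ℝ)⁻¹ * c i ^ 2 - (n : ℝ)⁻¹ * (2 * avg c) * c i + (n : ℝ)⁻¹ * avg c ^ 2 := fun i => by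
    rw [mul_pow, inv_pow, Real.sq_sqrt hn'.le]; ring
  rw [Finset.sum_congr rfl fun i _ => e1 i, Finset.sum_add_distrib, Finset.sum_sub_distrib,
    ← Finset.mul_sum, ← Finset.mul_sum, hs]
  simp [avg]
  field_simp
  ring

lemma integral_bootDev_sq {n : ℕ} (hn : 0 < n) (c : Fin n → ℝ) :
    Integrable (fun e => bootDev c e ^ 2) (expSample n) ∧
      ∫ e, bootDev c e ^ 2 ∂(expSample n) ≤ avg fun i => c i ^ 2 := by
  have h := integral_sq_weighted_sum (expMeasure 1) memLp_id_expMeasure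
    (fun i => (√(n : ℝ))⁻¹ * (c i - avg c))
  rw [integral_id_expMeasure, variance_id_expMeasure, one_mul, sum_sq_sub_avg hn] at h
  refine ⟨h.1, h.2.le.trans ?_⟩
  linarith [sq_nonneg (avg c)]

lemma integral_avg_sub_one_sq {n : ℕ} (hn : 0 < n) :
    Integrable (fun e : Fin n → ℝ => (avg e - 1) ^ 2) (expSample n) ∧
      ∫ e : Fin n → ℝ, (avg e - 1) ^ 2 ∂(expSample n) ≤ 1 / (n : ℝ) := by
  have hn' : (0 : ℝ) < n := by exact_mod_cast hn
  have h := integral_sq_weighted_sum (expMeasure 1) memLp_id_expMeasure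
    (fun _ : Fin n => (n : ℝ)⁻¹)
  rw [integral_id_expMeasure, variance_id_expMeasure, one_mul] at h
  have e : (fun o : Fin n → ℝ => (∑ i, (o i - 1) * (n : ℝ)⁻¹) ^ 2)
      = fun e => (avg e - 1) ^ 2 := by
    ext o
    rw [← Finset.sum_mul, Finset.sum_sub_distrib, avg]
    simp
    field_simp
  rw [e] at h
  refine ⟨h.1, h.2.le.trans ?_⟩
  simp
  field_simp
  exact le_rfl

@[fun_prop]
lemma measurable_avg {n : ℕ} : Measurable (avg : (Fin n → ℝ) → ℝ) := by
  unfold avg; fun_prop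

@[fun_prop]
lemma measurable_bootDev {n : ℕ} (c : Fin n → ℝ) : Measurable (bootDev c) := by
  unfold bootDev; fun_prop

/-- The moment generating function of a linear combination of centred exponentials. -/
lemma lintegral_exp_bootDev {n : ℕ} (c : Fin n → ℝ) (t : ℝ)
    (hc : ∀ i, t * ((√(n : ℝ))⁻¹ * (c i - avg c)) < 1) :
    ∫⁻ e, ENNReal.ofReal (Real.exp (t * bootDev c e)) ∂(expSample n)
      = ENNReal.ofReal (Real.exp (∑ i, (-(t * ((√(n : ℝ))⁻¹ * (c i - avg c)))
          - Real.log (1 - t * ((√(n : ℝ))⁻¹ * (c i - avg c)))))) := by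
  set a : Fin n → ℝ := fun i => t * ((√(n : ℝ))⁻¹ * (c i - avg c)) with ha
  have hind : iIndepFun (fun i (e : Fin n → ℝ) => ENNReal.ofReal (Real.exp ((e i - 1) * a i)))
      (expSample n) :=
    iIndepFun_pi (X := fun i x => ENNReal.ofReal (Real.exp ((x - 1) * a i)))
      fun i => by fun_prop
  have h1 : ∀ e : Fin n → ℝ, ENNReal.ofReal (Real.exp (t * bootDev c e))
      = ∏ i, ENNReal.ofReal (Real.exp ((e i - 1) * a i)) := fun e => by
    rw [← ENNReal.ofReal_prod_of_nonneg fun i _ => (Real.exp_pos _).le, ← Real.exp_sum, bootDev,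
      Finset.mul_sum]
    congr 2
    exact Finset.sum_congr rfl fun i _ => by simp only [ha]; ring
  simp_rw [h1]
  rw [lintegral_prod_eq_prod_lintegral_of_indepFun _ _ hind fun i => by fun_prop, Real.exp_sum,
    ENNReal.ofReal_prod_of_nonneg fun i _ => (Real.exp_pos _).le]
  refine Finset.prod_congr rfl fun i _ => ?_
  have hmp := measurePreserving_eval (fun _ : Fin n => expMeasure 1) i
  have h2 : ∫⁻ e : Fin n → ℝ, ENNReal.ofReal (Real.exp ((e i - 1) * a i)) ∂(expSample n)
      = ∫⁻ x, ENNReal.ofReal (Real.exp ((x - 1) * a i)) ∂(expMeasure 1) :=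
    hmp.lintegral_comp (f := fun x => ENNReal.ofReal (Real.exp ((x - 1) * a i))) (by fun_prop)
  have h3 : ∀ x : ℝ, ENNReal.ofReal (Real.exp ((x - 1) * a i))
      = ENNReal.ofReal (Real.exp (-a i)) * ENNReal.ofReal (Real.exp (a i * x)) := fun x => by
    rw [← ENNReal.ofReal_mul (Real.exp_pos _).le, ← Real.exp_add]; ring_nf
  simp_rw [h2, h3]
  have hpos : 0 < 1 - a i := by have := hc i; simp only [ha]; linarith
  rw [lintegral_const_mul _ (by fun_prop), lintegral_exp_expMeasure (hc i),
    ← ENNReal.ofReal_mul (Real.exp_pos _).le, Real.exp_sub, Real.exp_log hpos]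
  simp [ha, div_eq_mul_inv]

/-- Second-order expansion of `-x - log (1 - x)`, the cumulant generating function of a centred
standard exponential variable. -/
lemma abs_neg_sub_log_sub_le {x : ℝ} (hx : |x| ≤ 1 / 2) :
    |-x - Real.log (1 - x) - x ^ 2 / 2| ≤ 2 * |x| ^ 3 := by
  have h := Real.abs_log_sub_add_sum_range_le (x := x) (by linarith) 2
  rw [Finset.sum_range_succ, Finset.sum_range_one] at h
  norm_num at h
  rw [← abs_neg]
  have e : -(-x - Real.log (1 - x) - x ^ 2 / 2) = x + x ^ 2 / 2 + Real.log (1 - x) := by ring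
  rw [e]
  refine h.trans ?_
  rw [div_le_iff₀ (by linarith)]
  have : 0 ≤ |x| ^ 3 := by positivity
  nlinarith

/-- The central limit theorem for the Bayesian bootstrap, in terms of moment generating
functions. -/
lemma tendsto_lintegral_exp_bootDev {n : ℕ → ℕ} (hn : Tendsto n atTop atTop)
    {f : ∀ k, Fin (n k) → ℝ} (hf : ∀ k i, |f k i| ≤ 1) {v : ℝ}
    (hv : Tendsto (fun k => avg (fun i => f k i ^ 2) - avg (f k) ^ 2) atTop (𝓝 v)) (t : ℝ) :
    Tendsto (fun k => ∫⁻ e, ENNReal.ofReal (Real.exp (t * bootDev (f k) e)) ∂(expSample (n k)))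
      atTop (𝓝 (ENNReal.ofReal (Real.exp (v * t ^ 2 / 2)))) := by
  have hsq : Tendsto (fun k => (√(n k : ℝ))⁻¹) atTop (𝓝 0) :=
    (Real.tendsto_sqrt_atTop.comp (tendsto_natCast_atTop_atTop.comp hn)).inv_tendsto_atTop
  have hsmall : ∀ᶠ k in atTop, |t| * ((√(n k : ℝ))⁻¹ * 2) ≤ 1 / 2 := by
    have h0 : Tendsto (fun k => |t| * ((√(n k : ℝ))⁻¹ * 2)) atTop (𝓝 0) := by
      simpa using (hsq.mul_const 2).const_mul |t|
    exact (h0.eventually_lt_const (by norm_num)).mono fun _ h => h.le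
  have hav : ∀ᶠ k in atTop, |avg (f k)| ≤ 1 := by
    filter_upwards [hn.eventually_gt_atTop 0] with k hk
    have hk' : (0 : ℝ) < n k := by exact_mod_cast hk
    rw [avg, abs_div, Nat.abs_cast, div_le_one hk']
    refine (Finset.abs_sum_le_sum_abs _ _).trans ?_
    simpa using Finset.sum_le_sum fun i (_ : i ∈ Finset.univ) => hf k i
  -- each of the `n` summands has a remainder of order `n^{-3/2}`
  have hrem : ∀ᶠ k in atTop, |∑ i, (-(t * ((√(n k : ℝ))⁻¹ * (f k i - avg (f k))))
          - Real.log (1 - t * ((√(n k : ℝ))⁻¹ * (f k i - avg (f k)))))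
        - (avg (fun i => f k i ^ 2) - avg (f k) ^ 2) * t ^ 2 / 2|
      ≤ 16 * |t| ^ 3 * (√(n k : ℝ))⁻¹ := by
    filter_upwards [hsmall, hav, hn.eventually_gt_atTop 0] with k h1 h2 hk
    have hk' : (0 : ℝ) < n k := by exact_mod_cast hk
    have hb : ∀ i, |t * ((√(n k : ℝ))⁻¹ * (f k i - avg (f k)))| ≤ |t| * ((√(n k : ℝ))⁻¹ * 2) := by
      intro i
      rw [abs_mul, abs_mul, abs_of_nonneg (inv_nonneg.2 (Real.sqrt_nonneg _))]
      gcongr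
      exact (abs_sub _ _).trans (by linarith [hf k i])
    rw [← sum_sq_sub_avg hk, mul_div_assoc, Finset.sum_mul, ← Finset.sum_sub_distrib]
    refine (Finset.abs_sum_le_sum_abs _ _).trans ?_
    calc _ ≤ ∑ _i : Fin (n k), 2 * (|t| * ((√(n k : ℝ))⁻¹ * 2)) ^ 3 := by
          refine Finset.sum_le_sum fun i _ => ?_
          have := abs_neg_sub_log_sub_le ((hb i).trans h1)
          have h3 := pow_le_pow_left₀ (abs_nonneg _) (hb i) 3
          refine le_trans (le_of_eq ?_) (this.trans (by linarith))
          congr 1; ring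
      _ = 16 * |t| ^ 3 * (n k * ((√(n k : ℝ))⁻¹) ^ 3) := by simp; ring
      _ = 16 * |t| ^ 3 * (√(n k : ℝ))⁻¹ := by
          congr 1
          have hq : √(n k : ℝ) ≠ 0 := (Real.sqrt_pos.2 hk').ne'
          field_simp
          rw [Real.sq_sqrt hk'.le]
  have hlim : Tendsto (fun k => ∑ i, (-(t * ((√(n k : ℝ))⁻¹ * (f k i - avg (f k))))
          - Real.log (1 - t * ((√(n k : ℝ))⁻¹ * (f k i - avg (f k)))))) atTop
      (𝓝 (v * t ^ 2 / 2)) := by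
    have h0 : Tendsto (fun k => 16 * |t| ^ 3 * (√(n k : ℝ))⁻¹) atTop (𝓝 0) := by
      simpa using hsq.const_mul (16 * |t| ^ 3)
    have h1 := (tendsto_zero_iff_abs_tendsto_zero _).2
      (squeeze_zero' (Eventually.of_forall fun k => abs_nonneg _) hrem h0)
    have h2 := h1.add ((hv.mul_const (t ^ 2)).div_const 2)
    rw [zero_add] at h2
    refine h2.congr fun k => by ring
  refine (ENNReal.tendsto_ofReal ((Real.continuous_exp.tendsto _).comp hlim)).congr' ?_
  filter_upwards [hsmall, hav] with k h1 h2
  rw [lintegral_exp_bootDev]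
  · rfl
  · intro i
    refine lt_of_le_of_lt (le_abs_self _) ?_
    rw [abs_mul, abs_mul, abs_of_nonneg (inv_nonneg.2 (Real.sqrt_nonneg _))]
    have h3 : |f k i - avg (f k)| ≤ 2 := (abs_sub _ _).trans (by linarith [hf k i])
    have : |t| * ((√(n k : ℝ))⁻¹ * |f k i - avg (f k)|) ≤ |t| * ((√(n k : ℝ))⁻¹ * 2) := by gcongr
    linarith

/-! ### Gaussian limit of a draw with a bootstrap component -/

/-- The law of a real random variable, as a bundled probability measure. -/
def law {Z : Type*} [MeasurableSpace Z] (m : Measure Z) [IsProbabilityMeasure m] {X : Z → ℝ}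
    (hX : Measurable X) : ProbabilityMeasure ℝ :=
  ⟨m.map X, Measure.isProbabilityMeasure_map hX.aemeasurable⟩

lemma coe_law {Z : Type*} [MeasurableSpace Z] (m : Measure Z) [IsProbabilityMeasure m] {X : Z → ℝ}
    (hX : Measurable X) : (law m hX : Measure ℝ) = m.map X := rfl

/-- Slutsky's lemma for variables defined on varying probability spaces. -/
lemma tendsto_map_of_tendsto_measure_abs_sub {Z : ℕ → Type*} [∀ k, MeasurableSpace (Z k)]
    {m : ∀ k, Measure (Z k)} [∀ k, IsProbabilityMeasure (m k)] {X Y : ∀ k, Z k → ℝ}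
    (hX : ∀ k, Measurable (X k)) (hY : ∀ k, Measurable (Y k))
    (hXY : ∀ τ : ℝ, 0 < τ → Tendsto (fun k => m k {z | τ ≤ |X k z - Y k z|}) atTop (𝓝 0))
    {ν : ProbabilityMeasure ℝ}
    (h : Tendsto (fun k => law (m k) (hY k)) atTop (𝓝 ν)) :
    Tendsto (fun k => law (m k) (hX k)) atTop (𝓝 ν) := by
  rw [ProbabilityMeasure.tendsto_iff_tendsto_charFun] at h ⊢
  simp only [coe_law] at h ⊢
  intro s
  have hsub : Tendsto (fun k => charFun ((m k).map (X k)) s - charFun ((m k).map (Y k)) s) atTop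
      (𝓝 0) := by
    rw [Metric.tendsto_atTop]
    intro ε hε
    set τ : ℝ := ε / (4 * (|s| + 1)) with hτ
    have hs1 : 0 < |s| + 1 := by positivity
    have hτ0 : 0 < τ := by positivity
    have hev := (hXY τ hτ0).eventually_lt_const
      (show (0 : ENNReal) < ENNReal.ofReal (ε / 8) by simpa using hε)
    obtain ⟨N, hN⟩ := eventually_atTop.1 hev
    refine ⟨N, fun k hk => ?_⟩
    have hk := hN k hk
    rw [dist_zero_right]
    have hchar : ∀ W : Z k → ℝ, Measurable W → charFun ((m k).map W) s
        = ∫ z, Complex.exp (s * W z * Complex.I) ∂(m k) := fun W hW => by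
      rw [charFun_apply_real, integral_map hW.aemeasurable (by fun_prop)]
    have hint : ∀ W : Z k → ℝ, Measurable W →
        Integrable (fun z => Complex.exp (s * W z * Complex.I)) (m k) := fun W hW => by
      refine Integrable.of_bound (C := 1) (by fun_prop) (Eventually.of_forall fun z => ?_)
      rw [← Complex.ofReal_mul, Complex.norm_exp_ofReal_mul_I]
    rw [hchar _ (hX k), hchar _ (hY k), ← integral_sub (hint _ (hX k)) (hint _ (hY k))]
    set A := {z | τ ≤ |X k z - Y k z|} with hA
    have hAm : MeasurableSet A := measurableSet_le measurable_const
      (((hX k).sub (hY k)).abs)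
    have hpt : ∀ z, ‖Complex.exp (s * X k z * Complex.I) - Complex.exp (s * Y k z * Complex.I)‖
        ≤ |s| * τ + A.indicator (fun _ => (2 : ℝ)) z := by
      intro z
      by_cases hz : z ∈ A
      · rw [Set.indicator_of_mem hz]
        refine (norm_sub_le _ _).trans ?_
        rw [← Complex.ofReal_mul, ← Complex.ofReal_mul, Complex.norm_exp_ofReal_mul_I,
          Complex.norm_exp_ofReal_mul_I]
        have : 0 ≤ |s| * τ := by positivity
        linarith
      · rw [Set.indicator_of_notMem hz, add_zero]
        have hz' : |X k z - Y k z| < τ := not_le.1 hz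
        have e : Complex.exp (s * X k z * Complex.I) - Complex.exp (s * Y k z * Complex.I)
            = Complex.exp (((s * Y k z : ℝ) : ℂ) * Complex.I)
              * (Complex.exp (Complex.I * ((s * (X k z - Y k z) : ℝ) : ℂ)) - 1) := by
          rw [mul_sub, ← Complex.exp_add, mul_one]
          push_cast
          ring_nf
        rw [e, norm_mul, Complex.norm_exp_ofReal_mul_I, one_mul]
        refine (Real.norm_exp_I_mul_ofReal_sub_one_le).trans ?_
        rw [Real.norm_eq_abs, abs_mul]
        gcongr
    calc _ ≤ ∫ z, ‖Complex.exp (s * X k z * Complex.I) - Complex.exp (s * Y k z * Complex.I)‖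
            ∂(m k) := norm_integral_le_integral_norm _
      _ ≤ ∫ z, (|s| * τ + A.indicator (fun _ => (2 : ℝ)) z) ∂(m k) := by
          refine integral_mono ((hint _ (hX k)).sub (hint _ (hY k))).norm ?_ hpt
          exact (integrable_const _).add ((integrable_const _).indicator hAm)
      _ = |s| * τ + 2 * (m k).real A := by
          rw [integral_add (integrable_const _) ((integrable_const _).indicator hAm),
            integral_indicator hAm]
          simp [mul_comm]
      _ < ε := by
          have h1 : (m k).real A < ε / 8 := by
            rw [Measure.real, ← ENNReal.toReal_ofReal (show 0 ≤ ε / 8 by positivity)]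
            exact (ENNReal.toReal_lt_toReal (measure_ne_top _ _) ENNReal.ofReal_ne_top).2 hk
          have h2 : |s| * τ ≤ ε / 4 := by
            rw [hτ, mul_div_assoc', div_le_div_iff₀ (by positivity) (by positivity)]
            nlinarith [abs_nonneg s]
          linarith
  have := hsub.add (h s)
  rw [zero_add] at this
  refine this.congr fun k => ?_
  simp

lemma bootWeights_eq (n : ℕ) : bootWeights n = (expSample n).map fun e i => e i / ∑ j, e j := rfl

/-- The bootstrap fluctuation of `c`, divided by the mean weight, is close to the one of `f`. -/
lemma measure_boot_error_le {n : ℕ} (hn : 0 < n) {c f : Fin n → ℝ} (hc : ∀ i, |c i| ≤ 1)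
    (hf : ∀ i, |f i| ≤ 1) {κ τ K : ℝ} (hκ : avg (fun i => |c i - f i|) ≤ κ) (hτ : 0 < τ)
    (hK : 0 < K) :
    (expSample n) {e | avg e = 0 ∨ τ ≤ |bootDev c e / avg e - bootDev f e|}
      ≤ ENNReal.ofReal (1 / (n : ℝ) / (1 / 2) ^ 2) + ENNReal.ofReal (2 * κ / (τ / 4) ^ 2)
        + ENNReal.ofReal (1 / K ^ 2) + ENNReal.ofReal (1 / (n : ℝ) / (τ / (4 * K)) ^ 2) := by
  have hn' : (0 : ℝ) < n := by exact_mod_cast hn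
  have h1 := measure_abs_ge_le (expSample n) (τ := 1 / 2) (by norm_num)
    (integral_avg_sub_one_sq hn).1 (integral_avg_sub_one_sq hn).2
  have h4 := measure_abs_ge_le (expSample n) (τ := τ / (4 * K)) (by positivity)
    (integral_avg_sub_one_sq hn).1 (integral_avg_sub_one_sq hn).2
  have hd : avg (fun i => (c i - f i) ^ 2) ≤ 2 * κ := by
    refine le_trans ?_ (mul_le_mul_of_nonneg_left hκ zero_le_two)
    simp only [avg, mul_div_assoc', Finset.mul_sum]
    gcongr with i
    rw [← sq_abs, sq]
    gcongr
    exact (abs_sub _ _).trans (by linarith [hc i, hf i])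
  have hf2 : avg (fun i => f i ^ 2) ≤ 1 := by
    rw [avg, div_le_one hn']
    refine (Finset.sum_le_sum fun i (_ : i ∈ Finset.univ) => (?_ : f i ^ 2 ≤ 1)).trans (by simp)
    rw [← sq_abs]
    exact pow_le_one₀ (abs_nonneg _) (hf i)
  have h2 := measure_abs_ge_le (expSample n) (τ := τ / 4) (by positivity)
    (integral_bootDev_sq hn fun i => c i - f i).1
    ((integral_bootDev_sq hn fun i => c i - f i).2.trans hd)
  have h3 := measure_abs_ge_le (expSample n) hK (integral_bootDev_sq hn f).1
    ((integral_bootDev_sq hn f).2.trans hf2)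
  refine (measure_mono (fun e he => ?_)).trans ((measure_union_le _ _).trans (add_le_add
    ((measure_union_le _ _).trans (add_le_add ((measure_union_le _ _).trans
      (add_le_add h1 h2)) h3)) h4))
  by_contra hcon
  simp only [Set.mem_union, Set.mem_ofPred_eq, not_or, not_le] at hcon
  obtain ⟨⟨⟨g1, g2⟩, g3⟩, g4⟩ := hcon
  rw [bootDev_sub] at g2
  have ha : 1 / 2 < avg e := by have := (abs_lt.1 g1).1; linarith
  rcases he with h0 | h0
  · rw [h0] at ha; norm_num at ha
  · have e1 : bootDev c e / avg e - bootDev f e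
        = ((bootDev c e - bootDev f e) - bootDev f e * (avg e - 1)) / avg e := by
      field_simp; ring
    rw [e1, abs_div, abs_of_pos (by linarith : 0 < avg e), le_div_iff₀ (by linarith)] at h0
    have e2 := abs_sub (bootDev c e - bootDev f e) (bootDev f e * (avg e - 1))
    rw [abs_mul] at e2
    have e3 : |bootDev f e| * |avg e - 1| ≤ K * (τ / (4 * K)) := by gcongr
    have e4 : K * (τ / (4 * K)) = τ / 4 := by field_simp
    nlinarith

lemma tendsto_boot_error {n : ℕ → ℕ} (hn : Tendsto n atTop atTop) {κ : ℕ → ℝ}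
    (hκ : Tendsto κ atTop (𝓝 0)) {τ : ℝ} (hτ : 0 < τ) :
    Tendsto (fun k => ENNReal.ofReal (1 / (n k : ℝ) / (1 / 2) ^ 2)
        + ENNReal.ofReal (2 * κ k / (τ / 4) ^ 2) + ENNReal.ofReal (1 / √√(n k : ℝ) ^ 2)
        + ENNReal.ofReal (1 / (n k : ℝ) / (τ / (4 * √√(n k : ℝ))) ^ 2)) atTop (𝓝 0) := by
  have hinf : Tendsto (fun k => (n k : ℝ)) atTop atTop := tendsto_natCast_atTop_atTop.comp hn
  have hsq : Tendsto (fun k => (√(n k : ℝ))⁻¹) atTop (𝓝 0) :=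
    (Real.tendsto_sqrt_atTop.comp hinf).inv_tendsto_atTop
  have h1 : Tendsto (fun k => ENNReal.ofReal (1 / (n k : ℝ) / (1 / 2) ^ 2)) atTop (𝓝 0) := by
    have := ENNReal.tendsto_ofReal ((hinf.inv_tendsto_atTop).div_const ((1 / 2 : ℝ) ^ 2))
    simpa [one_div] using this
  have h2 : Tendsto (fun k => ENNReal.ofReal (2 * κ k / (τ / 4) ^ 2)) atTop (𝓝 0) := by
    have := ENNReal.tendsto_ofReal ((hκ.const_mul 2).div_const ((τ / 4) ^ 2))
    simpa using this
  have h3 : Tendsto (fun k => ENNReal.ofReal (1 / √√(n k : ℝ) ^ 2)) atTop (𝓝 0) := by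
    have := ENNReal.tendsto_ofReal hsq
    rw [ENNReal.ofReal_zero] at this
    refine this.congr fun k => ?_
    rw [Real.sq_sqrt (Real.sqrt_nonneg _), one_div]
  have h4 : Tendsto (fun k => ENNReal.ofReal (1 / (n k : ℝ) / (τ / (4 * √√(n k : ℝ))) ^ 2)) atTop
      (𝓝 0) := by
    have := ENNReal.tendsto_ofReal (hsq.const_mul (16 / τ ^ 2))
    rw [mul_zero, ENNReal.ofReal_zero] at this
    refine this.congr' ?_
    filter_upwards [hn.eventually_gt_atTop 0] with k hk
    have hk' : (0 : ℝ) < n k := by exact_mod_cast hk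
    congr 1
    rw [div_pow, mul_pow, Real.sq_sqrt (Real.sqrt_nonneg _)]
    have hq : √(n k : ℝ) ≠ 0 := (Real.sqrt_pos.2 hk').ne'
    have hq2 : (n k : ℝ) = √(n k : ℝ) * √(n k : ℝ) := (Real.mul_self_sqrt hk'.le).symm
    have hq3 : 1 / (n k : ℝ) = (√(n k : ℝ))⁻¹ * (√(n k : ℝ))⁻¹ := by
      rw [← mul_inv, ← hq2, one_div]
    rw [hq3]
    field_simp
    norm_num
  simpa using ((h1.add h2).add h3).add h4

/-- A draw `S + ρ + √n (∑ Mᵢ cᵢ - c̄)` with bootstrap weights `M` independent of `(S, c)` has a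
Gaussian limit when the moment generating functions of `S` (on sets of mass tending to one)
converge to a Gaussian one, `ρ → 0`, and `c` is close in empirical mean to a deterministic `f` whose
empirical variance converges. -/
theorem tendsto_blDist_bootstrap {n : ℕ → ℕ} (hn : Tendsto n atTop atTop) {Z : ℕ → Type*}
    [∀ k, MeasurableSpace (Z k)] (μ : ∀ k, Measure (Z k)) [∀ k, IsProbabilityMeasure (μ k)]
    {S : ∀ k, Z k → ℝ} (hS : ∀ k, Measurable (S k))
    {c : ∀ k, Z k → Fin (n k) → ℝ} (hc : ∀ k i, Measurable fun z => c k z i)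
    (hc1 : ∀ k z i, |c k z i| ≤ 1)
    {f : ∀ k, Fin (n k) → ℝ} (hf : ∀ k i, |f k i| ≤ 1) {v₂ : ℝ}
    (hv₂ : Tendsto (fun k => avg (fun i => f k i ^ 2) - avg (f k) ^ 2) atTop (𝓝 v₂))
    {ρ : ℕ → ℝ} (hρ : Tendsto ρ atTop (𝓝 0))
    {G : ∀ k, Set (Z k)} (hG : ∀ k, MeasurableSet (G k))
    (hG1 : Tendsto (fun k => μ k (G k)ᶜ) atTop (𝓝 0))
    {κ : ℕ → ℝ} (hκ : Tendsto κ atTop (𝓝 0))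
    (hGκ : ∀ k, ∀ z ∈ G k, avg (fun i => |c k z i - f k i|) ≤ κ k)
    {v₁ : ℝ} (hv₁ : 0 ≤ v₁)
    (hlap : ∀ t : ℝ, Tendsto (fun k => ∫⁻ z in G k, ENNReal.ofReal (Real.exp (t * S k z)) ∂(μ k))
      atTop (𝓝 (ENNReal.ofReal (Real.exp (v₁ * t ^ 2 / 2))))) :
    Tendsto (fun k => blDist (((μ k).prod (bootWeights (n k))).map fun q =>
        S k q.1 + ρ k + √(n k : ℝ) * (∑ i, q.2 i * c k q.1 i - avg (c k q.1)))
      (gaussianReal 0 (v₁ + v₂).toNNReal)) atTop (𝓝 0) := by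
  classical
  have hv₂0 : 0 ≤ v₂ := by
    refine ge_of_tendsto hv₂ ?_
    filter_upwards [hn.eventually_gt_atTop 0] with k hk
    rw [← sum_sq_sub_avg hk]
    exact Finset.sum_nonneg fun i _ => sq_nonneg _
  let m : ∀ k, Measure (Z k × (Fin (n k) → ℝ)) := fun k => (μ k).prod (expSample (n k))
  have : ∀ k, IsProbabilityMeasure (m k) := fun k => by simp only [m]; infer_instance
  -- the moment generating function of `S` is only controlled on `G`
  let S' : ∀ k, Z k → ℝ := fun k => (G k).indicator (S k)
  have hS' : ∀ k, Measurable (S' k) := fun k => (hS k).indicator (hG k)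
  let w : ∀ k, (Fin (n k) → ℝ) → Fin (n k) → ℝ := fun k e i => e i / ∑ j, e j
  have hw : ∀ k, Measurable (w k) := fun k => by
    refine measurable_pi_lambda _ fun i => ?_
    exact (measurable_pi_apply i).div (Finset.measurable_sum _ fun j _ => measurable_pi_apply j)
  let Φ : ∀ k, Z k × (Fin (n k) → ℝ) → ℝ := fun k q =>
    S k q.1 + ρ k + √(n k : ℝ) * (∑ i, q.2 i * c k q.1 i - avg (c k q.1))
  have hΦ : ∀ k, Measurable (Φ k) := fun k => by
    have : Measurable fun q : Z k × (Fin (n k) → ℝ) => c k q.1 :=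
      measurable_pi_lambda _ fun i => (hc k i).comp measurable_fst
    have h2 : ∀ i, Measurable fun q : Z k × (Fin (n k) → ℝ) => c k q.1 i := fun i =>
      (hc k i).comp measurable_fst
    have h3 := (hS k)
    simp only [Φ]
    refine ((h3.comp measurable_fst).add_const _).add (Measurable.const_mul ?_ _)
    refine (Finset.measurable_sum _ fun i _ => ?_).sub (measurable_avg.comp this)
    exact ((measurable_pi_apply i).comp measurable_snd).mul (h2 i)
  let X : ∀ k, Z k × (Fin (n k) → ℝ) → ℝ := fun k q => Φ k (q.1, w k q.2)
  have hX : ∀ k, Measurable (X k) := fun k =>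
    (hΦ k).comp (measurable_fst.prodMk ((hw k).comp measurable_snd))
  let Y : ∀ k, Z k × (Fin (n k) → ℝ) → ℝ := fun k q => S' k q.1 + bootDev (f k) q.2
  have hY : ∀ k, Measurable (Y k) := fun k =>
    ((hS' k).comp measurable_fst).add ((measurable_bootDev _).comp measurable_snd)
  have hmap : ∀ k, ((μ k).prod (bootWeights (n k))).map (Φ k) = (m k).map (X k) := fun k => by
    have : (μ k).prod (bootWeights (n k)) = (m k).map (Prod.map id (w k)) := by
      rw [bootWeights_eq, ← Measure.map_prod_map _ _ measurable_id (hw k), Measure.map_id]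
    rw [this, Measure.map_map (hΦ k) (measurable_id.prodMap (hw k))]
    rfl
  -- `Y` replaces `c` by `f` and the mean weight by one, so that its two summands are independent
  have hYlim : Tendsto (fun k => law (m k) (hY k)) atTop
      (𝓝 (⟨gaussianReal 0 (v₁ + v₂).toNNReal, inferInstance⟩ : ProbabilityMeasure ℝ)) := by
    refine tendsto_gaussian_of_lintegral_exp (add_nonneg hv₁ hv₂0) fun t => ?_
    have hSlim : Tendsto (fun k => ∫⁻ z, ENNReal.ofReal (Real.exp (t * S' k z)) ∂(μ k)) atTop
        (𝓝 (ENNReal.ofReal (Real.exp (v₁ * t ^ 2 / 2)))) := by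
      have := (hlap t).add hG1
      rw [add_zero] at this
      refine this.congr fun k => ?_
      rw [← lintegral_add_compl (fun z => ENNReal.ofReal (Real.exp (t * S' k z))) (hG k)]
      symm
      congr 1
      · refine setLIntegral_congr_fun (hG k) fun z hz => ?_
        simp only [S', Set.indicator_of_mem hz]
      · rw [setLIntegral_congr_fun (hG k).compl (g := fun _ => 1), setLIntegral_one]
        intro z hz
        simp only [S', Set.indicator_of_notMem hz]
        simp
    have hBlim := tendsto_lintegral_exp_bootDev hn hf hv₂ t
    have hmul := ENNReal.Tendsto.mul hSlim (Or.inr ENNReal.ofReal_ne_top) hBlim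
      (Or.inr ENNReal.ofReal_ne_top)
    rw [← ENNReal.ofReal_mul (Real.exp_pos _).le, ← Real.exp_add, ← add_div, ← add_mul] at hmul
    refine hmul.congr fun k => ?_
    have h1 := hS' k
    rw [coe_law, lintegral_map (by fun_prop) (hY k), ← lintegral_prod_mul
      (by fun_prop) (by fun_prop)]
    refine lintegral_congr fun q => ?_
    rw [← ENNReal.ofReal_mul (Real.exp_pos _).le, ← Real.exp_add, ← mul_add]
  -- `X - Y` tends to zero in probability, by `measure_boot_error_le` for each value of `z` in `G`
  have hXlim : Tendsto (fun k => law (m k) (hX k)) atTop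
      (𝓝 (⟨gaussianReal 0 (v₁ + v₂).toNNReal, inferInstance⟩ : ProbabilityMeasure ℝ)) := by
    refine tendsto_map_of_tendsto_measure_abs_sub hX hY (fun τ hτ => ?_) hYlim
    have hτ2 : 0 < τ / 2 := by positivity
    have hlim := hG1.add (tendsto_boot_error hn hκ hτ2)
    rw [add_zero] at hlim
    refine tendsto_of_tendsto_of_tendsto_of_le_of_le' tendsto_const_nhds hlim
      (Eventually.of_forall fun _ => zero_le) ?_
    have hρ' : ∀ᶠ k in atTop, |ρ k| < τ / 2 := by
      have := hρ.abs
      rw [abs_zero] at this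
      exact this.eventually_lt_const hτ2
    filter_upwards [hρ', hn.eventually_gt_atTop 0] with k hk hnk
    have hk' : (0 : ℝ) < n k := by exact_mod_cast hnk
    set E := ENNReal.ofReal (1 / (n k : ℝ) / (1 / 2) ^ 2)
        + ENNReal.ofReal (2 * κ k / (τ / 2 / 4) ^ 2) + ENNReal.ofReal (1 / √√(n k : ℝ) ^ 2)
        + ENNReal.ofReal (1 / (n k : ℝ) / (τ / 2 / (4 * √√(n k : ℝ))) ^ 2) with hE
    have hAm : MeasurableSet {q : Z k × (Fin (n k) → ℝ) | τ ≤ |X k q - Y k q|} :=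
      measurableSet_le measurable_const ((hX k).sub (hY k)).abs
    rw [show m k = (μ k).prod (expSample (n k)) from rfl, Measure.prod_apply hAm]
    calc _ ≤ ∫⁻ z, ((G k)ᶜ.indicator (fun _ => 1) z + E) ∂(μ k) := by
          refine lintegral_mono fun z => ?_
          by_cases hz : z ∈ G k
          · refine le_trans ?_ le_add_self
            refine le_trans (measure_mono fun e he => ?_) (measure_boot_error_le hnk (hc1 k z)
              (hf k) (hGκ k z hz) hτ2 (Real.sqrt_pos.2 (Real.sqrt_pos.2 hk')))
            by_cases h0 : avg e = 0
            · exact Or.inl h0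
            · right
              have he' : τ ≤ |X k (z, e) - Y k (z, e)| := he
              have e1 : X k (z, e) - Y k (z, e)
                  = ρ k + (bootDev (c k z) e / avg e - bootDev (f k) e) := by
                simp only [X, Y, Φ, S', w, Set.indicator_of_mem hz]
                rw [sqrt_mul_boot_eq hnk _ _ h0]
                ring
              rw [e1] at he'
              have := abs_add_le (ρ k) (bootDev (c k z) e / avg e - bootDev (f k) e)
              change τ / 2 ≤ _
              linarith
          · rw [Set.indicator_of_mem (by exact hz)]
            exact prob_le_one.trans le_self_add
      _ = μ k (G k)ᶜ + E := by
          rw [lintegral_add_right _ measurable_const, lintegral_indicator (hG k).compl]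
          simp
  have := tendsto_blDist_of_tendsto hXlim
  refine this.congr fun k => ?_
  rw [coe_law, ← hmap k]
  rfl

/-! ### The posterior law and its Laplace transform -/

section Model

variable {Θ S : Type*} {W : Θ → Bool → S → ℝ} {γ : Bool → S → ℝ} {n : ℕ} {o : Fin n → Obs S}

lemma condMean_mem (η : Bool → S → ℝ) (d : Bool) (x : S) :
    0 < condMean η d x ∧ condMean η d x < 1 :=
  ⟨Real.sigmoid_pos _, Real.sigmoid_lt_one _⟩

lemma likelihood_eq_exp (η : Bool → S → ℝ) (o : Fin n → Obs S) :
    likelihood (condMean η) o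
      = Real.exp (∑ i, logLik (o i).1 (η (o i).2.1 (o i).2.2)) := by
  rw [Real.exp_sum]
  refine Finset.prod_congr rfl fun i _ => ?_
  rw [logLik, Real.exp_log]
  · rfl
  · split_ifs
    · exact Real.sigmoid_pos _
    · linarith [Real.sigmoid_lt_one (η (o i).2.1 (o i).2.2)]

lemma likelihood_le_one (η : Bool → S → ℝ) (o : Fin n → Obs S) :
    likelihood (condMean η) o ≤ 1 := by
  refine Finset.prod_le_one (fun i _ => ?_) fun i _ => ?_ <;>
  · have := condMean_mem η (o i).2.1 (o i).2.2
    split_ifs <;> linarith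

/-- The discrepancy `|m(1, x) - m'(1, x)| + |m(0, x) - m'(0, x)|`. -/
def discrepancy (m m' : Bool → S → ℝ) (x : S) : ℝ :=
  |m true x - m' true x| + |m false x - m' false x|

lemma abs_sub_le_discrepancy (m m' : Bool → S → ℝ) (d : Bool) (x : S) :
    |m d x - m' d x| ≤ discrepancy m m' x := by
  unfold discrepancy
  cases d
  · linarith [abs_nonneg (m true x - m' true x)]
  · linarith [abs_nonneg (m false x - m' false x)]

lemma discrepancy_nonneg (m m' : Bool → S → ℝ) (x : S) : 0 ≤ discrepancy m m' x :=
  (abs_nonneg _).trans (abs_sub_le_discrepancy m m' true x)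

lemma abs_contrast_sub_le (m m' : Bool → S → ℝ) (x : S) :
    |contrast m x - contrast m' x| ≤ discrepancy m m' x := by
  unfold contrast discrepancy
  rw [show m true x - m false x - (m' true x - m' false x)
    = (m true x - m' true x) - (m false x - m' false x) by ring]
  exact abs_sub _ _

lemma discrepancy_condMean_le_two (η η' : Bool → S → ℝ) (x : S) :
    discrepancy (condMean η) (condMean η') x ≤ 2 := by
  have h : ∀ d, |condMean η d x - condMean η' d x| ≤ 1 := fun d => by
    have h1 := condMean_mem η d x
    have h2 := condMean_mem η' d x
    rw [abs_le]; constructor <;> linarith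
  unfold discrepancy
  linarith [h true, h false]

variable (W γ o) in
/-- The parameters `(W, λ)` with `|λ| ≤ b` whose conditional mean is within `κ` of `m₀` in empirical
mean over the covariates. -/
def neighbourhood (m₀ : Bool → S → ℝ) (b κ : ℝ) : Set (Θ × ℝ) :=
  {z | |z.2| ≤ b ∧
    avg (fun i => discrepancy (condMean (adjusted γ (W z.1) z.2)) m₀ (o i).2.2) ≤ κ}

variable (γ o) in
/-- The normalised score `√n ℙ_n[γ (y - m_η)]` of the one-dimensional model `η + l γ`. -/
def score (η : Bool → S → ℝ) : ℝ :=
  ∑ i, (bit (o i).1 - condMean η (o i).2.1 (o i).2.2) * ((√(n : ℝ))⁻¹ * γ (o i).2.1 (o i).2.2)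

variable (γ o) in
/-- The empirical information `ℙ_n[γ² m₀ (1 - m₀)]` for the coefficient of `γ`. -/
def information (m₀ : Bool → S → ℝ) : ℝ :=
  avg fun i => γ (o i).2.1 (o i).2.2 ^ 2 * (m₀ (o i).2.1 (o i).2.2 * (1 - m₀ (o i).2.1 (o i).2.2))

lemma avg_le_avg {c f : Fin n → ℝ} (h : ∀ i, c i ≤ f i) : avg c ≤ avg f := by
  unfold avg
  gcongr with i
  exact h i

/-- Translating `λ` by `h` moves the conditional mean by at most `M |h|`. -/
lemma neighbourhood_sub_subset {M h b κ : ℝ} (hγ : ∀ i d, |γ d (o i).2.2| ≤ M)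
    (m₀ : Bool → S → ℝ) (hn : 0 < n) :
    neighbourhood W γ o m₀ (b - |h|) (κ - 2 * M * |h|)
      ⊆ {z | (z.1, z.2 + h) ∈ neighbourhood W γ o m₀ b κ} := by
  rintro ⟨θ, l⟩ ⟨h1, h2⟩
  simp only at h1 h2
  refine ⟨?_, ?_⟩
  · simp only
    linarith [abs_add_le l h]
  · simp only
    have hpt : ∀ i, discrepancy (condMean (adjusted γ (W θ) (l + h))) m₀ (o i).2.2
        ≤ discrepancy (condMean (adjusted γ (W θ) l)) m₀ (o i).2.2 + 2 * M * |h| := by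
      intro i
      have hd : ∀ d, |condMean (adjusted γ (W θ) (l + h)) d (o i).2.2 - m₀ d (o i).2.2|
          ≤ |condMean (adjusted γ (W θ) l) d (o i).2.2 - m₀ d (o i).2.2| + M * |h| := by
        intro d
        refine (abs_sub_le _ (condMean (adjusted γ (W θ) l) d (o i).2.2) _).trans ?_
        have h3 := abs_sigmoid_sub_le (adjusted γ (W θ) (l + h) d (o i).2.2)
          (adjusted γ (W θ) l d (o i).2.2)
        have e : adjusted γ (W θ) (l + h) d (o i).2.2 - adjusted γ (W θ) l d (o i).2.2
            = γ d (o i).2.2 * h := by simp only [adjusted]; ring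
        rw [e, abs_mul] at h3
        have h4 := mul_le_mul_of_nonneg_right (hγ i d) (abs_nonneg h)
        have h5 : |condMean (adjusted γ (W θ) (l + h)) d (o i).2.2
            - condMean (adjusted γ (W θ) l) d (o i).2.2| ≤ |γ d (o i).2.2| * |h| := h3
        linarith
      unfold discrepancy
      linarith [hd true, hd false]
    have h3 := avg_le_avg hpt
    have hn' : (n : ℝ) ≠ 0 := by positivity
    have e : avg (fun i => discrepancy (condMean (adjusted γ (W θ) l)) m₀ (o i).2.2
        + 2 * M * |h|)
        = avg (fun i => discrepancy (condMean (adjusted γ (W θ) l)) m₀ (o i).2.2)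
          + 2 * M * |h| := by
      simp only [avg, Finset.sum_add_distrib, add_div]
      simp
      field_simp
    linarith

/-- The score and a translation of `λ` by `-t / √n` tilt the log-likelihood in the same way, up to
the curvature `t² V / 2` and small terms. -/
lemma abs_score_add_logLik_sub_le {M κ b : ℝ} (hγ : ∀ i d, |γ d (o i).2.2| ≤ M)
    {m₀ : Bool → S → ℝ} (hm₀ : ∀ d x, 0 ≤ m₀ d x ∧ m₀ d x ≤ 1) (hn : 0 < n) (t : ℝ)
    {z : Θ × ℝ} (hz : z ∈ neighbourhood W γ o m₀ b κ) :
    |t * (-score γ o (adjusted γ (W z.1) z.2))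
        + ∑ i, logLik (o i).1 (adjusted γ (W z.1) z.2 (o i).2.1 (o i).2.2)
        - ∑ i, logLik (o i).1 (adjusted γ (W z.1) (z.2 - t / √(n : ℝ)) (o i).2.1 (o i).2.2)
        - avg (fun i => γ (o i).2.1 (o i).2.2 ^ 2 * (m₀ (o i).2.1 (o i).2.2
            * (1 - m₀ (o i).2.1 (o i).2.2))) * t ^ 2 / 2|
      ≤ M ^ 2 * κ * t ^ 2 / 2 + |t| ^ 3 * M ^ 3 * (√(n : ℝ))⁻¹ := by
  have hn' : (0 : ℝ) < n := by exact_mod_cast hn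
  set q := √(n : ℝ) with hq
  have hq0 : 0 < q := Real.sqrt_pos.2 hn'
  have hqq : (n : ℝ) = q * q := (Real.mul_self_sqrt hn'.le).symm
  set g : Fin n → ℝ := fun i => γ (o i).2.1 (o i).2.2 with hg
  set x : Fin n → ℝ := fun i => adjusted γ (W z.1) z.2 (o i).2.1 (o i).2.2 with hx
  set p : Fin n → ℝ := fun i => m₀ (o i).2.1 (o i).2.2 with hp
  have hx' : ∀ i, adjusted γ (W z.1) (z.2 - t / q) (o i).2.1 (o i).2.2
      = x i + -(t / q * g i) := fun i => by simp only [hx, hg, adjusted]; ring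
  have hgM : ∀ i, |g i| ≤ M := fun i => hγ i _
  -- the cubic remainder of the log-likelihood at the `i`-th observation
  let R : Fin n → ℝ := fun i => logLik (o i).1 (x i + -(t / q * g i)) - logLik (o i).1 (x i)
    - (bit (o i).1 - Real.sigmoid (x i)) * -(t / q * g i)
      + Real.sigmoid (x i) * (1 - Real.sigmoid (x i)) * (-(t / q * g i)) ^ 2 / 2
  have hR : ∀ i, |R i| ≤ (|t| / q) ^ 3 * M ^ 3 := fun i => by
    refine (abs_logLik_add_sub_le _ _ _).trans ?_
    rw [abs_neg, abs_mul, abs_div, abs_of_pos hq0, mul_pow]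
    gcongr
    exact hgM i
  have hRs : |∑ i, R i| ≤ |t| ^ 3 * M ^ 3 * q⁻¹ := by
    refine (Finset.abs_sum_le_sum_abs _ _).trans
      ((Finset.sum_le_sum fun i _ => hR i).trans (le_of_eq ?_))
    simp only [Finset.sum_const, Finset.card_univ, Fintype.card_fin, nsmul_eq_mul, hqq]
    field_simp
  -- the curvature at `η` is replaced by the one at `m₀`, at the cost of the discrepancy
  let C : Fin n → ℝ := fun i => g i ^ 2 * (Real.sigmoid (x i) * (1 - Real.sigmoid (x i))
    - p i * (1 - p i))
  have hC : |avg C| ≤ M ^ 2 * κ := by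
    have h1 : |avg C| ≤ avg fun i => M ^ 2
        * discrepancy (condMean (adjusted γ (W z.1) z.2)) m₀ (o i).2.2 := by
      simp only [avg, abs_div, abs_of_pos hn']
      gcongr
      refine (Finset.abs_sum_le_sum_abs _ _).trans (Finset.sum_le_sum fun i _ => ?_)
      rw [abs_mul, abs_of_nonneg (sq_nonneg (g i)), ← sq_abs (g i)]
      gcongr
      · exact hgM i
      · refine (abs_mul_one_sub_sub_le ⟨Real.sigmoid_nonneg _, Real.sigmoid_le_one _⟩
          (hm₀ _ _)).trans ?_
        exact abs_sub_le_discrepancy (condMean (adjusted γ (W z.1) z.2)) m₀ (o i).2.1 (o i).2.2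
    refine h1.trans ?_
    have h2 : avg (fun i => M ^ 2 * discrepancy (condMean (adjusted γ (W z.1) z.2)) m₀ (o i).2.2)
        = M ^ 2 * avg (fun i => discrepancy (condMean (adjusted γ (W z.1) z.2)) m₀ (o i).2.2) := by
      simp only [avg, ← Finset.mul_sum, mul_div_assoc]
    rw [h2]
    exact mul_le_mul_of_nonneg_left hz.2 (sq_nonneg M)
  have key : t * (-score γ o (adjusted γ (W z.1) z.2))
        + ∑ i, logLik (o i).1 (x i)
        - ∑ i, logLik (o i).1 (adjusted γ (W z.1) (z.2 - t / q) (o i).2.1 (o i).2.2)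
        - avg (fun i => g i ^ 2 * (p i * (1 - p i))) * t ^ 2 / 2
      = avg C * t ^ 2 / 2 - ∑ i, R i := by
    have e1 : avg C * t ^ 2 / 2 + avg (fun i => g i ^ 2 * (p i * (1 - p i))) * t ^ 2 / 2
        = ∑ i, Real.sigmoid (x i) * (1 - Real.sigmoid (x i)) * (-(t / q * g i)) ^ 2 / 2 := by
      rw [← add_div, ← add_mul, avg, avg, ← add_div, ← Finset.sum_add_distrib, hqq,
        Finset.sum_div, Finset.sum_mul, Finset.sum_div]
      refine Finset.sum_congr rfl fun i _ => ?_
      simp only [C]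
      field_simp
      ring
    have e2 : t * (-score γ o (adjusted γ (W z.1) z.2))
        = ∑ i, (bit (o i).1 - Real.sigmoid (x i)) * -(t / q * g i) := by
      rw [score, ← Finset.sum_neg_distrib, Finset.mul_sum]
      refine Finset.sum_congr rfl fun i _ => ?_
      simp only [hx, hg, condMean, ← hq]
      field_simp
    simp only [hx']
    have e3 : ∑ i, R i = ∑ i, logLik (o i).1 (x i + -(t / q * g i)) - ∑ i, logLik (o i).1 (x i)
        - ∑ i, (bit (o i).1 - Real.sigmoid (x i)) * -(t / q * g i)
        + ∑ i, Real.sigmoid (x i) * (1 - Real.sigmoid (x i)) * (-(t / q * g i)) ^ 2 / 2 := by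
      simp only [R, Finset.sum_add_distrib, Finset.sum_sub_distrib]
    rw [e3, ← e2, ← e1]
    ring
  rw [key]
  refine (abs_sub _ _).trans (add_le_add ?_ hRs)
  rw [abs_div, abs_mul, abs_of_nonneg (sq_nonneg t), abs_of_pos (zero_lt_two' ℝ)]
  gcongr

/-- The exponent that bounds the error in `lintegral_exp_score_le` and
`le_lintegral_exp_score`. -/
def laplaceError (n : ℕ) (M κ b σ t : ℝ) : ℝ :=
  M ^ 2 * κ * t ^ 2 / 2 + |t| ^ 3 * M ^ 3 * (√(n : ℝ))⁻¹
    + (2 * b * (|t| / √(n : ℝ)) + (|t| / √(n : ℝ)) ^ 2) / (2 * σ ^ 2)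

/-- The Cameron–Martin factor of a translation by `h` is uniformly close to one where the translated
point is at most `b` in absolute value and `b |h|` is small compared with `σ²`. -/
lemma abs_tilt_le {b σ h l : ℝ} (hσ : 0 < σ) (hl : |l + h| ≤ b) :
    |-(2 * l * h + h ^ 2) / (2 * σ ^ 2)| ≤ (2 * b * |h| + |h| ^ 2) / (2 * σ ^ 2) := by
  rw [abs_div, abs_of_pos (by positivity : 0 < 2 * σ ^ 2)]
  gcongr
  rw [show -(2 * l * h + h ^ 2) = h ^ 2 - 2 * (l + h) * h by ring, sq_abs]
  refine (abs_sub _ _).trans ?_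
  rw [abs_mul, abs_mul, abs_of_nonneg (sq_nonneg h), abs_of_pos (zero_lt_two' ℝ)]
  have := mul_le_mul_of_nonneg_right hl (abs_nonneg h)
  linarith

end Model

section Posterior

variable {Θ S : Type*} [MeasurableSpace Θ] {PW : Measure Θ} {σ : ℝ}
  {W : Θ → Bool → S → ℝ} {γ : Bool → S → ℝ} {n : ℕ} {o : Fin n → Obs S}

lemma measurable_condMean_adjusted (hWm : ∀ d x, Measurable fun θ => W θ d x) (d : Bool) (x : S) :
    Measurable fun z : Θ × ℝ => condMean (adjusted γ (W z.1) z.2) d x := by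
  have := hWm d x
  have hs : Measurable Real.sigmoid := continuous_sigmoid.measurable
  unfold condMean adjusted
  fun_prop

lemma measurable_likelihood (hWm : ∀ d x, Measurable fun θ => W θ d x) (o : Fin n → Obs S) :
    Measurable fun z : Θ × ℝ => likelihood (condMean (adjusted γ (W z.1) z.2)) o := by
  unfold likelihood
  refine Finset.measurable_prod _ fun i _ => ?_
  have := measurable_condMean_adjusted (γ := γ) hWm (o i).2.1 (o i).2.2
  split_ifs <;> fun_prop

lemma measurable_discrepancy (hWm : ∀ d x, Measurable fun θ => W θ d x) (m₀ : Bool → S → ℝ)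
    (x : S) :
    Measurable fun z : Θ × ℝ => discrepancy (condMean (adjusted γ (W z.1) z.2)) m₀ x := by
  have h1 := measurable_condMean_adjusted (γ := γ) hWm true x
  have h2 := measurable_condMean_adjusted (γ := γ) hWm false x
  unfold discrepancy
  exact (h1.sub_const _).abs.add (h2.sub_const _).abs

lemma measurable_avg_discrepancy (hWm : ∀ d x, Measurable fun θ => W θ d x) (m₀ : Bool → S → ℝ) :
    Measurable fun z : Θ × ℝ =>
      avg (fun i => discrepancy (condMean (adjusted γ (W z.1) z.2)) m₀ (o i).2.2) :=
  measurable_avg.comp (measurable_pi_lambda _ fun _ => measurable_discrepancy hWm _ _)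

lemma measurableSet_neighbourhood (hWm : ∀ d x, Measurable fun θ => W θ d x)
    (m₀ : Bool → S → ℝ) (b κ : ℝ) : MeasurableSet (neighbourhood W γ o m₀ b κ) :=
  (measurableSet_le measurable_snd.abs measurable_const).inter
    (measurableSet_le (measurable_avg_discrepancy hWm m₀) measurable_const)

lemma measurable_score (hWm : ∀ d x, Measurable fun θ => W θ d x) :
    Measurable fun z : Θ × ℝ => score γ o (adjusted γ (W z.1) z.2) := by
  unfold score
  refine Finset.measurable_sum _ fun i _ => Measurable.mul_const ?_ _
  exact (measurable_condMean_adjusted hWm _ _).const_sub _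

variable (PW σ W γ o) in
/-- The marginal likelihood, the normalising constant of the posterior. -/
def evidence : ENNReal :=
  ∫⁻ z, ENNReal.ofReal (likelihood (condMean (adjusted γ (W z.1) z.2)) o) ∂(wlPrior PW σ)

lemma lintegral_wlPosterior (hWm : ∀ d x, Measurable fun θ => W θ d x) {f : Θ × ℝ → ENNReal}
    (hf : Measurable f) :
    ∫⁻ z, f z ∂(wlPosterior PW σ W γ o) = (evidence PW σ W γ o)⁻¹ *
      ∫⁻ z, ENNReal.ofReal (likelihood (condMean (adjusted γ (W z.1) z.2)) o) * f z
        ∂(wlPrior PW σ) := by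
  rw [wlPosterior, lintegral_smul_measure, lintegral_withDensity_eq_lintegral_mul _
    (measurable_likelihood hWm o).ennreal_ofReal hf]
  rfl

/-- Translation of a centred Gaussian variable (Cameron–Martin). -/
lemma lintegral_gaussian_sub (hσ : 0 < σ) (h : ℝ) {F : ℝ → ENNReal} (hF : Measurable F) :
    ∫⁻ l, F (l - h) ∂(gaussianReal 0 (σ ^ 2).toNNReal)
      = ∫⁻ l, F l * ENNReal.ofReal (Real.exp (-(2 * l * h + h ^ 2) / (2 * σ ^ 2)))
        ∂(gaussianReal 0 (σ ^ 2).toNNReal) := by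
  have hv : (σ ^ 2).toNNReal ≠ 0 := by
    rw [Ne, Real.toNNReal_eq_zero, not_le]; positivity
  have hm := measurable_gaussianPDF 0 (σ ^ 2).toNNReal
  rw [gaussianReal_of_var_ne_zero _ hv, lintegral_withDensity_eq_lintegral_mul _ hm (by fun_prop),
    lintegral_withDensity_eq_lintegral_mul _ hm (by fun_prop)]
  simp only [Pi.mul_apply]
  rw [← lintegral_add_right_eq_self _ h]
  refine lintegral_congr fun l => ?_
  rw [add_sub_cancel_right, mul_comm (F l), ← mul_assoc]
  congr 1
  rw [gaussianPDF, gaussianPDF, ← ENNReal.ofReal_mul (gaussianPDFReal_nonneg _ _ _)]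
  congr 1
  rw [gaussianPDFReal, gaussianPDFReal, mul_assoc _ _ (Real.exp _), ← Real.exp_add,
    Real.coe_toNNReal _ (sq_nonneg σ)]
  congr 2
  field_simp
  ring

lemma lintegral_wlPrior_sub (hσ : 0 < σ) (h : ℝ) {F : Θ × ℝ → ENNReal} (hF : Measurable F) :
    ∫⁻ z, F (z.1, z.2 - h) ∂(wlPrior PW σ)
      = ∫⁻ z, F z * ENNReal.ofReal (Real.exp (-(2 * z.2 * h + h ^ 2) / (2 * σ ^ 2)))
        ∂(wlPrior PW σ) := by
  rw [wlPrior, lintegral_prod _ (by fun_prop), lintegral_prod _ (by fun_prop)]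
  exact lintegral_congr fun θ => lintegral_gaussian_sub hσ h (F := fun l => F (θ, l)) (by fun_prop)

lemma lintegral_exp_score_eq (hWm : ∀ d x, Measurable fun θ => W θ d x) {G : Set (Θ × ℝ)}
    (hG : MeasurableSet G) (t : ℝ) :
    ∫⁻ z in G, ENNReal.ofReal (Real.exp (t * (-score γ o (adjusted γ (W z.1) z.2))))
        ∂(wlPosterior PW σ W γ o)
      = (evidence PW σ W γ o)⁻¹ * ∫⁻ z, G.indicator (fun z => ENNReal.ofReal (Real.exp
          (t * (-score γ o (adjusted γ (W z.1) z.2))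
            + ∑ i, logLik (o i).1 (adjusted γ (W z.1) z.2 (o i).2.1 (o i).2.2)))) z
          ∂(wlPrior PW σ) := by
  have hs := measurable_score (γ := γ) (o := o) hWm
  rw [← lintegral_indicator hG, lintegral_wlPosterior hWm (by
    refine Measurable.indicator ?_ hG; fun_prop)]
  congr 1
  refine lintegral_congr fun z => ?_
  by_cases hz : z ∈ G
  · rw [Set.indicator_of_mem hz, Set.indicator_of_mem hz, likelihood_eq_exp,
      ← ENNReal.ofReal_mul (Real.exp_pos _).le, ← Real.exp_add, add_comm]
  · rw [Set.indicator_of_notMem hz, Set.indicator_of_notMem hz, mul_zero]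

lemma wlPosterior_apply_eq (hWm : ∀ d x, Measurable fun θ => W θ d x) {G : Set (Θ × ℝ)}
    (hG : MeasurableSet G) :
    wlPosterior PW σ W γ o G = (evidence PW σ W γ o)⁻¹ * ∫⁻ z, G.indicator (fun z =>
      ENNReal.ofReal (likelihood (condMean (adjusted γ (W z.1) z.2)) o)) z ∂(wlPrior PW σ) := by
  rw [← lintegral_indicator_one hG, lintegral_wlPosterior hWm (measurable_one.indicator hG)]
  congr 1
  refine lintegral_congr fun z => ?_
  by_cases hz : z ∈ G
  · rw [Set.indicator_of_mem hz, Set.indicator_of_mem hz, Pi.one_apply, mul_one]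
  · rw [Set.indicator_of_notMem hz, Set.indicator_of_notMem hz, mul_zero]

/-- The posterior Laplace transform of the score in exchanged form: the integral against the prior
after the substitution `λ ↦ λ + t / √n`. -/
lemma lintegral_shifted_likelihood (hσ : 0 < σ) (hWm : ∀ d x, Measurable fun θ => W θ d x)
    {G : Set (Θ × ℝ)} (hG : MeasurableSet G) (h : ℝ) :
    ∫⁻ z, G.indicator (fun z => ENNReal.ofReal
        (likelihood (condMean (adjusted γ (W z.1) (z.2 - h))) o)) z ∂(wlPrior PW σ)
      = ∫⁻ z, {z : Θ × ℝ | (z.1, z.2 + h) ∈ G}.indicator (fun z => ENNReal.ofReal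
          (likelihood (condMean (adjusted γ (W z.1) z.2)) o)
          * ENNReal.ofReal (Real.exp (-(2 * z.2 * h + h ^ 2) / (2 * σ ^ 2)))) z
          ∂(wlPrior PW σ) := by
  have hG' : MeasurableSet {z : Θ × ℝ | (z.1, z.2 + h) ∈ G} :=
    (measurable_fst.prodMk (measurable_snd.add_const h)) hG
  have := lintegral_wlPrior_sub (PW := PW) hσ h
    (F := {z : Θ × ℝ | (z.1, z.2 + h) ∈ G}.indicator fun z => ENNReal.ofReal
      (likelihood (condMean (adjusted γ (W z.1) z.2)) o))
    ((measurable_likelihood hWm o).ennreal_ofReal.indicator hG')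
  simp only [Set.indicator_mul_left]
  rw [← this]
  refine lintegral_congr fun z => ?_
  by_cases hz : z ∈ G
  · rw [Set.indicator_of_mem hz, Set.indicator_of_mem (by simpa using hz)]
  · rw [Set.indicator_of_notMem hz, Set.indicator_of_notMem (by simpa using hz)]

/-- Lower bound for the posterior Laplace transform of the score. By `abs_score_add_logLik_sub_le`
it is, up to the Gaussian factor, the likelihood at `λ - t / √n`; translating `λ` back turns its
prior integral into the posterior mass of the translated neighbourhood. -/
lemma le_lintegral_exp_score (hσ : 0 < σ) (hWm : ∀ d x, Measurable fun θ => W θ d x) {M κ b : ℝ}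
    (hγ : ∀ i d, |γ d (o i).2.2| ≤ M)
    {m₀ : Bool → S → ℝ} (hm₀ : ∀ d x, 0 ≤ m₀ d x ∧ m₀ d x ≤ 1) (hn : 0 < n) (t : ℝ) :
    ENNReal.ofReal (Real.exp (information γ o m₀ * t ^ 2 / 2 - laplaceError n M κ b σ t))
        * wlPosterior PW σ W γ o (neighbourhood W γ o m₀ (b - |t| / √(n : ℝ))
            (κ - 2 * M * (|t| / √(n : ℝ))))
      ≤ ∫⁻ z in neighbourhood W γ o m₀ b κ,
        ENNReal.ofReal (Real.exp (t * (-score γ o (adjusted γ (W z.1) z.2))))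
        ∂(wlPosterior PW σ W γ o) := by
  set G := neighbourhood W γ o m₀ b κ with hGdef
  have hG : MeasurableSet G := measurableSet_neighbourhood hWm m₀ b κ
  set V := information γ o m₀ * t ^ 2 / 2 with hV
  set e₁ := M ^ 2 * κ * t ^ 2 / 2 + |t| ^ 3 * M ^ 3 * (√(n : ℝ))⁻¹ with he₁
  set h := t / √(n : ℝ) with hh
  have hhabs : |h| = |t| / √(n : ℝ) := by rw [hh, abs_div, abs_of_nonneg (Real.sqrt_nonneg _)]
  set e₂ := (2 * b * |h| + |h| ^ 2) / (2 * σ ^ 2) with he₂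
  have hsplit : V - laplaceError n M κ b σ t = (V - e₁) + -e₂ := by
    rw [laplaceError, ← hhabs, ← he₂, ← he₁]; ring
  have hsub := neighbourhood_sub_subset (W := W) (h := h) (b := b) (κ := κ) hγ m₀ hn
  rw [hhabs] at hsub
  have hG' : MeasurableSet {z : Θ × ℝ | (z.1, z.2 + h) ∈ G} :=
    (measurable_fst.prodMk (measurable_snd.add_const h)) hG
  rw [lintegral_exp_score_eq hWm hG, hsplit, Real.exp_add, ENNReal.ofReal_mul (Real.exp_pos _).le]
  calc _ ≤ ENNReal.ofReal (Real.exp (V - e₁)) * ENNReal.ofReal (Real.exp (-e₂)) *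
          wlPosterior PW σ W γ o {z : Θ × ℝ | (z.1, z.2 + h) ∈ G} := by gcongr
    _ = (evidence PW σ W γ o)⁻¹ * (ENNReal.ofReal (Real.exp (V - e₁)) *
          (ENNReal.ofReal (Real.exp (-e₂)) * ∫⁻ z, {z : Θ × ℝ | (z.1, z.2 + h) ∈ G}.indicator
            (fun z => ENNReal.ofReal
          (likelihood (condMean (adjusted γ (W z.1) z.2)) o)) z ∂(wlPrior PW σ))) := by
        rw [wlPosterior_apply_eq hWm hG']; ring
    _ ≤ (evidence PW σ W γ o)⁻¹ * (ENNReal.ofReal (Real.exp (V - e₁)) *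
        ∫⁻ z, G.indicator (fun z => ENNReal.ofReal
        (likelihood (condMean (adjusted γ (W z.1) (z.2 - h))) o)) z ∂(wlPrior PW σ)) := by
        rw [lintegral_shifted_likelihood hσ hWm hG]
        gcongr
        rw [← lintegral_const_mul']
        swap; · exact ENNReal.ofReal_ne_top
        refine lintegral_mono fun z => ?_
        by_cases hz : z ∈ {z : Θ × ℝ | (z.1, z.2 + h) ∈ G}
        · rw [Set.indicator_of_mem hz, Set.indicator_of_mem hz, mul_comm]
          gcongr
          have hz' : |z.2 + h| ≤ b := hz.1
          exact (abs_le.1 (abs_tilt_le hσ hz')).1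
        · rw [Set.indicator_of_notMem hz]; simp
    _ ≤ _ := by
        gcongr
        rw [← lintegral_const_mul']
        swap; · exact ENNReal.ofReal_ne_top
        refine lintegral_mono fun z => ?_
        by_cases hz : z ∈ G
        · rw [Set.indicator_of_mem hz, Set.indicator_of_mem hz, likelihood_eq_exp,
            ← ENNReal.ofReal_mul (Real.exp_pos _).le, ← Real.exp_add]
          refine ENNReal.ofReal_le_ofReal (Real.exp_le_exp.2 ?_)
          have := (abs_le.1 (abs_score_add_logLik_sub_le hγ hm₀ hn t hz)).1
          simp only [hV, he₁, information, hh]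
          linarith
        · rw [Set.indicator_of_notMem hz, Set.indicator_of_notMem hz, mul_zero]

variable [IsProbabilityMeasure PW]

instance : IsProbabilityMeasure (wlPrior PW σ) := by unfold wlPrior; infer_instance

lemma evidence_ne_zero (hWm : ∀ d x, Measurable fun θ => W θ d x) : evidence PW σ W γ o ≠ 0 := by
  rw [evidence, ← pos_iff_ne_zero, lintegral_pos_iff_support
    (measurable_likelihood hWm o).ennreal_ofReal]
  have : (Function.support fun z : Θ × ℝ =>
      ENNReal.ofReal (likelihood (condMean (adjusted γ (W z.1) z.2)) o)) = Set.univ := by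
    ext z
    simp [likelihood_eq_exp, Real.exp_pos]
  rw [this]
  simp

lemma evidence_ne_top : evidence PW σ W γ o ≠ ⊤ := by
  refine ne_top_of_le_ne_top ENNReal.one_ne_top ?_
  calc _ ≤ ∫⁻ _, 1 ∂(wlPrior PW σ) := lintegral_mono fun z => by
        simpa using likelihood_le_one _ o
    _ = 1 := by simp

lemma isProbabilityMeasure_wlPosterior (hWm : ∀ d x, Measurable fun θ => W θ d x) :
    IsProbabilityMeasure (wlPosterior PW σ W γ o) := by
  constructor
  have := lintegral_wlPosterior (PW := PW) (σ := σ) (γ := γ) (o := o) hWm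
    (f := fun _ => 1) measurable_const
  simp only [lintegral_const, one_mul, mul_one] at this
  rw [this]
  exact ENNReal.inv_mul_cancel (evidence_ne_zero hWm) evidence_ne_top

/-- Upper bound for the posterior Laplace transform of the score, by the same translation as in
`le_lintegral_exp_score`; the posterior mass of the translated neighbourhood is at most one. -/
lemma lintegral_exp_score_le (hσ : 0 < σ) (hWm : ∀ d x, Measurable fun θ => W θ d x) {M κ b : ℝ}
    (hγ : ∀ i d, |γ d (o i).2.2| ≤ M)
    {m₀ : Bool → S → ℝ} (hm₀ : ∀ d x, 0 ≤ m₀ d x ∧ m₀ d x ≤ 1) (hn : 0 < n) (t : ℝ) :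
    ∫⁻ z in neighbourhood W γ o m₀ b κ,
        ENNReal.ofReal (Real.exp (t * (-score γ o (adjusted γ (W z.1) z.2))))
        ∂(wlPosterior PW σ W γ o)
      ≤ ENNReal.ofReal (Real.exp (information γ o m₀ * t ^ 2 / 2
          + laplaceError n M κ b σ t)) := by
  set G := neighbourhood W γ o m₀ b κ with hGdef
  have hG : MeasurableSet G := measurableSet_neighbourhood hWm m₀ b κ
  set V := information γ o m₀ * t ^ 2 / 2 with hV
  set e₁ := M ^ 2 * κ * t ^ 2 / 2 + |t| ^ 3 * M ^ 3 * (√(n : ℝ))⁻¹ with he₁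
  set h := t / √(n : ℝ) with hh
  have hhabs : |h| = |t| / √(n : ℝ) := by rw [hh, abs_div, abs_of_nonneg (Real.sqrt_nonneg _)]
  set e₂ := (2 * b * |h| + |h| ^ 2) / (2 * σ ^ 2) with he₂
  have hsplit : V + laplaceError n M κ b σ t = (V + e₁) + e₂ := by
    rw [laplaceError, ← hhabs, ← he₂, ← he₁]; ring
  rw [lintegral_exp_score_eq hWm hG, hsplit, Real.exp_add, ENNReal.ofReal_mul (Real.exp_pos _).le]
  calc _ ≤ (evidence PW σ W γ o)⁻¹ * (ENNReal.ofReal (Real.exp (V + e₁)) *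
        ∫⁻ z, G.indicator (fun z => ENNReal.ofReal
        (likelihood (condMean (adjusted γ (W z.1) (z.2 - h))) o)) z ∂(wlPrior PW σ)) := by
        gcongr
        rw [← lintegral_const_mul']
        swap; · exact ENNReal.ofReal_ne_top
        refine lintegral_mono fun z => ?_
        by_cases hz : z ∈ G
        · rw [Set.indicator_of_mem hz, Set.indicator_of_mem hz, likelihood_eq_exp,
            ← ENNReal.ofReal_mul (Real.exp_pos _).le, ← Real.exp_add]
          refine ENNReal.ofReal_le_ofReal (Real.exp_le_exp.2 ?_)
          have := (abs_le.1 (abs_score_add_logLik_sub_le hγ hm₀ hn t hz)).2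
          simp only [hV, he₁, information, hh]
          linarith
        · rw [Set.indicator_of_notMem hz]; exact zero_le
    _ ≤ (evidence PW σ W γ o)⁻¹ * (ENNReal.ofReal (Real.exp (V + e₁)) *
        (ENNReal.ofReal (Real.exp e₂) * evidence PW σ W γ o)) := by
        rw [lintegral_shifted_likelihood hσ hWm hG]
        gcongr
        rw [evidence, ← lintegral_const_mul']
        swap; · exact ENNReal.ofReal_ne_top
        refine lintegral_mono fun z => ?_
        by_cases hz : z ∈ {z : Θ × ℝ | (z.1, z.2 + h) ∈ G}
        · rw [Set.indicator_of_mem hz, mul_comm]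
          gcongr
          have hz' : |z.2 + h| ≤ b := hz.1
          exact (abs_le.1 (abs_tilt_le hσ hz')).2
        · rw [Set.indicator_of_notMem hz]; exact zero_le
    _ = _ := by
        rw [← mul_assoc (ENNReal.ofReal _), mul_comm _ (evidence PW σ W γ o), ← mul_assoc,
          ENNReal.inv_mul_cancel (evidence_ne_zero hWm) evidence_ne_top, one_mul]

end Posterior

/-! ### Disintegration of the law of an observation -/

section Mixture

variable {T : Type*} [MeasurableSpace T]

/-- The law of `(B, V)` when `V ∼ ν` and `B` is a Bernoulli variable with success probability
`g V` given `V`. -/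
def mixture (ν : Measure T) (g : T → ℝ) : Measure (Bool × T) :=
  ((ν.withDensity fun x => ENNReal.ofReal (g x)).map fun x => (true, x))
    + ((ν.withDensity fun x => ENNReal.ofReal (1 - g x)).map fun x => (false, x))

lemma measurable_mk_left (b : Bool) : Measurable fun x : T => (b, x) := measurable_prodMk_left

lemma lintegral_mixture {ν : Measure T} {g : T → ℝ} (hg : Measurable g) {f : Bool × T → ENNReal}
    (hf : Measurable f) :
    ∫⁻ q, f q ∂(mixture ν g) = ∫⁻ x, (ENNReal.ofReal (g x) * f (true, x)
      + ENNReal.ofReal (1 - g x) * f (false, x)) ∂ν := by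
  rw [mixture, lintegral_add_measure, lintegral_map hf (measurable_mk_left _),
    lintegral_map hf (measurable_mk_left _), lintegral_withDensity_eq_lintegral_mul _
    (by fun_prop) (by fun_prop), lintegral_withDensity_eq_lintegral_mul _ (by fun_prop)
    (by fun_prop), ← lintegral_add_left (by fun_prop)]
  rfl

lemma integral_mixture {ν : Measure T} {g : T → ℝ} (hg : Measurable g)
    (hg1 : ∀ᵐ x ∂ν, 0 ≤ g x ∧ g x ≤ 1) {f : Bool × T → ℝ} (hf : Integrable f (mixture ν g)) :
    ∫ q, f q ∂(mixture ν g) = ∫ x, (g x * f (true, x) + (1 - g x) * f (false, x)) ∂ν := by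
  have h1 := hf.left_of_add_measure
  have h2 := hf.right_of_add_measure
  have hm1 : Measurable fun x => ENNReal.ofReal (g x) := by fun_prop
  have hm2 : Measurable fun x => ENNReal.ofReal (1 - g x) := by fun_prop
  have ht : ∀ h : T → ℝ, ∀ᵐ x ∂ν, ENNReal.ofReal (h x) < ⊤ := fun h =>
    Eventually.of_forall fun _ => ENNReal.ofReal_lt_top
  rw [integrable_map_measure h1.1 (measurable_mk_left _).aemeasurable,
    integrable_withDensity_iff_integrable_smul' hm1 (ht _)] at h1
  rw [integrable_map_measure h2.1 (measurable_mk_left _).aemeasurable,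
    integrable_withDensity_iff_integrable_smul' hm2 (ht _)] at h2
  rw [mixture, integral_add_measure hf.left_of_add_measure hf.right_of_add_measure,
    integral_map (measurable_mk_left _).aemeasurable hf.left_of_add_measure.1,
    integral_map (measurable_mk_left _).aemeasurable hf.right_of_add_measure.1,
    integral_withDensity_eq_integral_toReal_smul hm1 (ht _),
    integral_withDensity_eq_integral_toReal_smul hm2 (ht _)]
  refine (integral_add h1 h2).symm.trans ?_
  refine integral_congr_ae ?_
  filter_upwards [hg1] with x hx
  rw [ENNReal.toReal_ofReal hx.1, ENNReal.toReal_ofReal (by linarith [hx.2])]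
  rfl

variable {Ω : Type*} [mΩ : MeasurableSpace Ω] {P : Measure Ω}

lemma ae_nonneg_of_eq_condExp {V : Ω → T} {E : Set Ω} {g : T → ℝ}
    (h : (fun ω => g (V ω)) =ᵐ[P] P⟦E | MeasurableSpace.comap V inferInstance⟧) :
    ∀ᵐ ω ∂P, 0 ≤ g (V ω) := by
  have := condExp_nonneg (μ := P) (m := MeasurableSpace.comap V inferInstance)
    (f := E.indicator fun _ => (1 : ℝ)) (Eventually.of_forall fun ω =>
      Set.indicator_nonneg (fun _ _ => zero_le_one) ω)
  filter_upwards [this, h] with ω h1 h2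
  rw [h2]; exact h1

variable [IsProbabilityMeasure P]

/-- The law of `V` on the event `E` has the conditional probability of `E` as its density. -/
lemma restrict_map_eq_withDensity {V : Ω → T} (hV : Measurable V) {E : Set Ω}
    (hE : MeasurableSet E) {g : T → ℝ} (hg : Measurable g)
    (h : (fun ω => g (V ω)) =ᵐ[P] P⟦E | MeasurableSpace.comap V inferInstance⟧) :
    (P.restrict E).map V = (P.map V).withDensity fun x => ENNReal.ofReal (g x) := by
  have hle : MeasurableSpace.comap V inferInstance ≤ mΩ := hV.comap_le
  have hnn := ae_nonneg_of_eq_condExp h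
  have hint : Integrable (fun ω => g (V ω)) P := integrable_condExp.congr h.symm
  ext B hB
  rw [Measure.map_apply hV hB, Measure.restrict_apply (hV hB), withDensity_apply _ hB,
    setLIntegral_map hB (by fun_prop) hV, ← ofReal_integral_eq_lintegral_ofReal
    hint.integrableOn (ae_restrict_of_ae hnn)]
  have h1 : ∫ ω in V ⁻¹' B, g (V ω) ∂P = ∫ ω in V ⁻¹' B, E.indicator (fun _ => (1 : ℝ)) ω ∂P := by
    rw [setIntegral_congr_ae (hV hB) (h.mono fun ω hω _ => hω)]
    exact setIntegral_condExp hle ((integrable_const 1).indicator hE) ⟨B, hB, rfl⟩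
  rw [h1, setIntegral_indicator hE]
  simp [Measure.real]

/-- Disintegration of the law of `(B, V)` over `V`, for a binary variable `B`. -/
lemma map_eq_mixture {V : Ω → T} (hV : Measurable V) {B : Ω → Bool} (hB : Measurable B)
    {g : T → ℝ} (hg : Measurable g)
    (h : (fun ω => g (V ω)) =ᵐ[P] P⟦{ω | B ω = true} | MeasurableSpace.comap V inferInstance⟧) :
    P.map (fun ω => (B ω, V ω)) = mixture (P.map V) g := by
  have hE : MeasurableSet {ω | B ω = true} := hB (measurableSet_singleton true)
  have hle : MeasurableSpace.comap V inferInstance ≤ mΩ := hV.comap_le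
  have h' : (fun ω => 1 - g (V ω)) =ᵐ[P]
      P⟦{ω | B ω = true}ᶜ | MeasurableSpace.comap V inferInstance⟧ := by
    have e : ({ω | B ω = true}ᶜ.indicator fun _ => (1 : ℝ))
        = (fun _ => (1 : ℝ)) - {ω | B ω = true}.indicator fun _ => (1 : ℝ) := by
      rw [Set.indicator_compl]
    rw [e]
    have h1 := condExp_sub (μ := P) (integrable_const (1 : ℝ))
      ((integrable_const (1 : ℝ)).indicator hE) (MeasurableSpace.comap V inferInstance)
    filter_upwards [h, h1] with ω h2 h3
    rw [h3, Pi.sub_apply, condExp_const hle, h2]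
  have e1 := restrict_map_eq_withDensity hV hE hg h
  have e2 := restrict_map_eq_withDensity hV hE.compl (hg.const_sub 1) h'
  refine Measure.ext_of_lintegral _ fun f hf => ?_
  rw [mixture, ← e1, ← e2, lintegral_map hf (hB.prodMk hV), lintegral_add_measure,
    lintegral_map hf (measurable_mk_left _), lintegral_map hf (measurable_mk_left _),
    lintegral_map (by fun_prop) hV, lintegral_map (by fun_prop) hV, ← lintegral_add_compl _ hE]
  congr 1
  · exact setLIntegral_congr_fun hE fun ω hω => by
      rw [show B ω = true from hω]
  · refine setLIntegral_congr_fun hE.compl fun ω hω => ?_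
    have : B ω = false := by simpa using hω
    rw [this]

end Mixture

/-! ### Identification of the average treatment effect -/

/-- Under unconfoundedness and positivity, the mean of a potential outcome is the mean of the
observed regression function on the corresponding arm. Here `B` is the indicator of the arm. -/
lemma integral_potential_outcome {Ω S : Type*} [mΩ : MeasurableSpace Ω] [StandardBorelSpace Ω]
    [MeasurableSpace S] {P : Measure Ω} [IsProbabilityMeasure P] {U B : Ω → Bool} {X : Ω → S}
    (hU : Measurable U) (hB : Measurable B) (hX : Measurable X) {q m : S → ℝ}
    (hmm : Measurable m) (hm1 : ∀ x, |m x| ≤ 1)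
    (hq : (fun ω => q (X ω)) =ᵐ[P] P⟦{ω | B ω = true} | MeasurableSpace.comap X inferInstance⟧)
    (hq0 : ∀ᵐ ω ∂P, q (X ω) ≠ 0)
    (hind : CondIndepFun (MeasurableSpace.comap X inferInstance) hX.comap_le U B P)
    (hm : ∀ s, MeasurableSet s → ∫ ω in X ⁻¹' s ∩ {ω | B ω = true}, bit (U ω) ∂P
      = ∫ ω in X ⁻¹' s ∩ {ω | B ω = true}, m (X ω) ∂P) :
    ∫ ω, bit (U ω) ∂P = ∫ ω, m (X ω) ∂P := by
  have hle : MeasurableSpace.comap X inferInstance ≤ mΩ := hX.comap_le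
  have hEB : MeasurableSet {ω | B ω = true} := hB (measurableSet_singleton true)
  have hEU : MeasurableSet {ω | U ω = true} := hU (measurableSet_singleton true)
  have hbit : (fun ω => bit (U ω)) = {ω | U ω = true}.indicator fun _ => (1 : ℝ) := by
    ext ω; simp [bit, Set.indicator_apply]
  have hci := (condIndepFun_iff_condExp_inter_preimage_eq_mul hU hB).1 hind {true} {true}
    (measurableSet_singleton _) (measurableSet_singleton _)
  have hset : U ⁻¹' {true} ∩ B ⁻¹' {true} = {ω | U ω = true} ∩ {ω | B ω = true} := rfl
  rw [hset] at hci
  -- `P(U = 1, B = 1 | X) = E(m(X) 1_{B = 1} | X)`, so that `P(U = 1 | X) q(X) = m(X) q(X)`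
  have hmB : Integrable (fun ω => m (X ω) * {ω | B ω = true}.indicator (fun _ => (1 : ℝ)) ω) P := by
    refine Integrable.of_bound (C := 1) ?_ (Eventually.of_forall fun ω => ?_)
    · exact ((hmm.comp hX).mul (measurable_const.indicator hEB)).aestronglyMeasurable
    · rw [norm_mul, Real.norm_eq_abs, Real.norm_eq_abs]
      have h2 : |{ω | B ω = true}.indicator (fun _ => (1 : ℝ)) ω| ≤ 1 := by
        by_cases h : B ω = true <;> simp [h]
      nlinarith [hm1 (X ω), abs_nonneg (m (X ω)),
        abs_nonneg ({ω | B ω = true}.indicator (fun _ => (1 : ℝ)) ω)]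
  have hce : P[({ω | U ω = true} ∩ {ω | B ω = true}).indicator (fun _ => (1 : ℝ)) |
        MeasurableSpace.comap X inferInstance]
      =ᵐ[P] P[fun ω => m (X ω) * {ω | B ω = true}.indicator (fun _ => (1 : ℝ)) ω |
        MeasurableSpace.comap X inferInstance] := by
    refine ae_eq_condExp_of_forall_setIntegral_eq hle hmB
      (fun s _ _ => integrable_condExp.integrableOn) ?_
      stronglyMeasurable_condExp.aestronglyMeasurable
    rintro _ ⟨s, hs, rfl⟩ _
    rw [setIntegral_condExp hle ((integrable_const (1 : ℝ)).indicator (hEU.inter hEB))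
      ⟨s, hs, rfl⟩]
    have h1 := hm s hs
    rw [← setIntegral_indicator hEB, ← setIntegral_indicator hEB] at h1
    refine Eq.trans ?_ (h1.trans ?_)
    · refine integral_congr_ae (Eventually.of_forall fun ω => ?_)
      by_cases hb : B ω = true <;> by_cases hu : U ω = true <;>
        simp [hb, hu, bit]
    · refine integral_congr_ae (Eventually.of_forall fun ω => ?_)
      by_cases hb : B ω = true <;> simp [hb]
  have hpull : P[fun ω => m (X ω) * {ω | B ω = true}.indicator (fun _ => (1 : ℝ)) ω |
        MeasurableSpace.comap X inferInstance]
      =ᵐ[P] fun ω => m (X ω) * (P⟦{ω | B ω = true} | MeasurableSpace.comap X inferInstance⟧) ω :=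
    condExp_mul_of_stronglyMeasurable_left
      (hmm.comp (comap_measurable X)).stronglyMeasurable hmB ((integrable_const 1).indicator hEB)
  have hfin : P⟦{ω | U ω = true} | MeasurableSpace.comap X inferInstance⟧
      =ᵐ[P] fun ω => m (X ω) := by
    filter_upwards [hci, hce, hpull, hq, hq0] with ω h1 h2 h3 h4 h5
    have h6 : (P⟦{ω | U ω = true} | MeasurableSpace.comap X inferInstance⟧) ω
          * (P⟦{ω | B ω = true} | MeasurableSpace.comap X inferInstance⟧) ω
        = m (X ω) * (P⟦{ω | B ω = true} | MeasurableSpace.comap X inferInstance⟧) ω := by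
      rw [← h3, ← h2, h1]; rfl
    rw [← h4] at h6
    exact mul_right_cancel₀ h5 h6
  rw [hbit, ← integral_condExp hle]
  exact integral_congr_ae hfin

/-! ### Square integrable functions -/

lemma memLp_of_eLpNorm_le {S : Type*} [MeasurableSpace S] {F : Measure S} {f : S → ℝ}
    (hf : Measurable f) {r : ℝ} (h : eLpNorm f 2 F ≤ ENNReal.ofReal r) :
    MemLp f 2 F ∧ ∫ x, f x ^ 2 ∂F ≤ r ^ 2 := by
  have hm : MemLp f 2 F := ⟨hf.aestronglyMeasurable, h.trans_lt ENNReal.ofReal_lt_top⟩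
  refine ⟨hm, ?_⟩
  rw [hm.eLpNorm_eq_integral_rpow_norm two_ne_zero ENNReal.ofNat_ne_top] at h
  have e : ∫ a, ‖f a‖ ^ (2 : ENNReal).toReal ∂F = ∫ a, f a ^ 2 ∂F := by
    refine integral_congr_ae (Eventually.of_forall fun x => ?_)
    simp
  have hI : 0 ≤ ∫ a, f a ^ 2 ∂F := integral_nonneg fun x => sq_nonneg _
  have e2 : (∫ a, f a ^ 2 ∂F) ^ ((2 : ENNReal).toReal⁻¹) = √(∫ a, f a ^ 2 ∂F) := by
    rw [Real.sqrt_eq_rpow]; norm_num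
  rw [e, e2] at h
  have h' : √(∫ a, f a ^ 2 ∂F) ≤ |r| := by
    rcases le_total 0 r with hr | hr
    · rw [abs_of_nonneg hr]; exact (ENNReal.ofReal_le_ofReal_iff hr).1 h
    · rw [ENNReal.ofReal_of_nonpos hr, nonpos_iff_eq_zero, ENNReal.ofReal_eq_zero] at h
      exact h.trans (abs_nonneg _)
  calc _ = √(∫ a, f a ^ 2 ∂F) ^ 2 := (Real.sq_sqrt hI).symm
    _ ≤ |r| ^ 2 := by gcongr
    _ = r ^ 2 := sq_abs r

/-- The Cauchy–Schwarz inequality in terms of bounds of the second moments. -/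
lemma integral_abs_mul_abs_le {S : Type*} [MeasurableSpace S] {F : Measure S} {f g : S → ℝ}
    (hf : MemLp f 2 F) (hg : MemLp g 2 F) {a b : ℝ} (ha : ∫ x, f x ^ 2 ∂F ≤ a ^ 2)
    (hb : ∫ x, g x ^ 2 ∂F ≤ b ^ 2) :
    Integrable (fun x => |f x| * |g x|) F ∧ ∫ x, |f x| * |g x| ∂F ≤ |a| * |b| := by
  refine ⟨hf.abs.integrable_mul hg.abs, ?_⟩
  have h := integral_mul_le_Lp_mul_Lq_of_nonneg (μ := F) Real.HolderConjugate.two_two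
    (f := fun x => |f x|) (g := fun x => |g x|) (Eventually.of_forall fun x => abs_nonneg _)
    (Eventually.of_forall fun x => abs_nonneg _) (by rw [ENNReal.ofReal_ofNat]; exact hf.abs)
    (by rw [ENNReal.ofReal_ofNat]; exact hg.abs)
  refine h.trans ?_
  simp only [Real.rpow_two, sq_abs]
  rw [← Real.sqrt_eq_rpow, ← Real.sqrt_eq_rpow, ← Real.sqrt_sq_eq_abs, ← Real.sqrt_sq_eq_abs]
  gcongr

/-! ### Moments in the observation model -/

/-- The law `P₀` of an observation `(y, d, x)` with covariate law `F₀`, propensity score `π₀`,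
bounded away from zero and one by `c`, and conditional mean `m₀`. -/
structure ObsModel {S : Type*} [MeasurableSpace S] (P₀ : Measure (Obs S)) (F₀ : Measure S)
    (π₀ : S → ℝ) (m₀ : Bool → S → ℝ) (c : ℝ) : Prop where
  prob_obs : IsProbabilityMeasure P₀
  prob_cov : IsProbabilityMeasure F₀
  measurable_prop : Measurable π₀
  measurable_mean : ∀ d, Measurable (m₀ d)
  mean_mem : ∀ d x, 0 < m₀ d x ∧ m₀ d x < 1
  pos : 0 < c
  overlap : ∀ᵐ x ∂F₀, c < π₀ x ∧ π₀ x < 1 - c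
  law_eq : P₀ = mixture (mixture F₀ π₀) fun q => m₀ q.1 q.2
  map_snd : P₀.map Prod.snd = mixture F₀ π₀
  map_cov : P₀.map (fun o => o.2.2) = F₀

lemma riesz_true {S : Type*} (π : S → ℝ) (x : S) : riesz π true x = 1 / π x := by
  simp [riesz, bit]

lemma riesz_false {S : Type*} (π : S → ℝ) (x : S) : riesz π false x = -(1 / (1 - π x)) := by
  simp [riesz, bit]

lemma measurable_riesz {S : Type*} [MeasurableSpace S] {π : S → ℝ} (h : Measurable π) (d : Bool) :
    Measurable (riesz π d) := by
  unfold riesz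
  exact (measurable_const.div h).sub (measurable_const.div (h.const_sub 1))

lemma measurable_uncurry_bool {S T : Type*} [MeasurableSpace S] [MeasurableSpace T]
    {f : Bool → S → T} (h : ∀ d, Measurable (f d)) : Measurable fun q : Bool × S => f q.1 q.2 :=
  measurable_from_prod_countable_right h

lemma measurable_chiCorr {S : Type*} [MeasurableSpace S] {π : S → ℝ} {m : Bool → S → ℝ}
    (hπ : Measurable π) (hm : ∀ d, Measurable (m d)) : Measurable (chiCorr π m) := by
  have h1 := measurable_uncurry_bool hm
  have h2 := measurable_uncurry_bool fun d => measurable_riesz hπ d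
  have h3 : Measurable bit := measurable_of_finite _
  have h4 : Measurable (contrast m) := (hm true).sub (hm false)
  unfold chiCorr
  exact (h4.comp (measurable_snd.comp measurable_snd)).add ((h2.comp measurable_snd).mul
    ((h3.comp measurable_fst).sub (h1.comp measurable_snd)))

namespace ObsModel

variable {S : Type*} [MeasurableSpace S] {P₀ : Measure (Obs S)} {F₀ : Measure S} {π₀ : S → ℝ}
  {m₀ : Bool → S → ℝ} {c : ℝ}

lemma ae_cov (h : ObsModel P₀ F₀ π₀ m₀ c) {p : S → Prop} (hp : ∀ᵐ x ∂F₀, p x) :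
    ∀ᵐ o ∂P₀, p o.2.2 := by
  rw [← h.map_cov] at hp
  exact ae_of_ae_map (measurable_snd.comp measurable_snd).aemeasurable hp

lemma lintegral_cov (h : ObsModel P₀ F₀ π₀ m₀ c) {f : S → ENNReal} (hf : Measurable f) :
    ∫⁻ o, f o.2.2 ∂P₀ = ∫⁻ x, f x ∂F₀ := by
  have hm : Measurable fun o : Obs S => o.2.2 := measurable_snd.comp measurable_snd
  rw [← h.map_cov, lintegral_map hf hm]

lemma integral_cov (h : ObsModel P₀ F₀ π₀ m₀ c) {f : S → ℝ} (hf : Measurable f) :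
    ∫ o, f o.2.2 ∂P₀ = ∫ x, f x ∂F₀ := by
  have hm : Measurable fun o : Obs S => o.2.2 := measurable_snd.comp measurable_snd
  conv_rhs => rw [← h.map_cov]
  rw [integral_map hm.aemeasurable hf.aestronglyMeasurable]

lemma integrable_cov (h : ObsModel P₀ F₀ π₀ m₀ c) {f : S → ℝ} (hf : Integrable f F₀) :
    Integrable (fun o : Obs S => f o.2.2) P₀ := by
  rw [← h.map_cov] at hf
  exact hf.comp_measurable (measurable_snd.comp measurable_snd)

/-- Integration over the binary outcome. -/
lemma integral_eq_of_outcome (h : ObsModel P₀ F₀ π₀ m₀ c) {f : Obs S → ℝ} (hf : Integrable f P₀)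
    {k : Bool × S → ℝ} (hk : Measurable k)
    (hfk : ∀ q : Bool × S, m₀ q.1 q.2 * f (true, q) + (1 - m₀ q.1 q.2) * f (false, q) = k q) :
    ∫ o, f o ∂P₀ = ∫ o, k o.2 ∂P₀ := by
  have h1 : ∫ o, k o.2 ∂P₀ = ∫ q, k q ∂(mixture F₀ π₀) := by
    rw [← h.map_snd, integral_map measurable_snd.aemeasurable hk.aestronglyMeasurable]
  rw [h1, h.law_eq, integral_mixture (measurable_uncurry_bool h.measurable_mean)
    (Eventually.of_forall fun q => ⟨(h.mean_mem _ _).1.le, (h.mean_mem _ _).2.le⟩)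
    (by rw [← h.law_eq]; exact hf)]
  exact integral_congr_ae (Eventually.of_forall hfk)

/-- Integration over the treatment. -/
lemma integral_eq_of_treatment (h : ObsModel P₀ F₀ π₀ m₀ c) {k : Bool × S → ℝ} (hk : Measurable k)
    (hki : Integrable (fun o : Obs S => k o.2) P₀) :
    ∫ o, k o.2 ∂P₀ = ∫ x, (π₀ x * k (true, x) + (1 - π₀ x) * k (false, x)) ∂F₀ := by
  have hki' : Integrable k (mixture F₀ π₀) := by
    rw [← h.map_snd, integrable_map_measure hk.aestronglyMeasurable measurable_snd.aemeasurable]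
    exact hki
  rw [← integral_mixture h.measurable_prop _ hki', ← h.map_snd,
    integral_map measurable_snd.aemeasurable hk.aestronglyMeasurable]
  filter_upwards [h.overlap] with x hx
  have := h.pos
  constructor <;> linarith

lemma abs_riesz_le (h : ObsModel P₀ F₀ π₀ m₀ c) :
    ∀ᵐ x ∂F₀, ∀ d, |riesz π₀ d x| ≤ 1 / c := by
  filter_upwards [h.overlap] with x hx d
  have hc := h.pos
  cases d
  · rw [riesz_false, abs_neg, abs_of_pos (by apply one_div_pos.2; linarith)]
    exact one_div_le_one_div_of_le hc (by linarith)
  · rw [riesz_true, abs_of_pos (by apply one_div_pos.2; linarith)]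
    exact one_div_le_one_div_of_le hc (by linarith)

lemma abs_bit_sub_le (h : ObsModel P₀ F₀ π₀ m₀ c) (y d : Bool) (x : S) :
    |bit y - m₀ d x| ≤ 1 := by
  have := h.mean_mem d x
  cases y <;> simp [bit, abs_le] <;> constructor <;> linarith

/-- The variance of the efficient influence function is the sum of the information term and the
variance of the regression contrast. -/
lemma integral_eif_sq (h : ObsModel P₀ F₀ π₀ m₀ c) {χ : ℝ} (hχ : χ = ∫ x, contrast m₀ x ∂F₀) :
    ∫ o, eif π₀ m₀ χ o ^ 2 ∂P₀
      = ∫ o, riesz π₀ o.2.1 o.2.2 ^ 2 * (m₀ o.2.1 o.2.2 * (1 - m₀ o.2.1 o.2.2)) ∂P₀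
        + (∫ x, contrast m₀ x ^ 2 ∂F₀ - (∫ x, contrast m₀ x ∂F₀) ^ 2) := by
  have := h.prob_obs
  have := h.prob_cov
  have hm := measurable_uncurry_bool h.measurable_mean
  have hr := measurable_uncurry_bool fun d => measurable_riesz h.measurable_prop d
  have hcm : Measurable (contrast m₀) := (h.measurable_mean true).sub (h.measurable_mean false)
  have hcb : ∀ x, |contrast m₀ x| ≤ 1 := fun x => by
    have h1 := h.mean_mem true x
    have h2 := h.mean_mem false x
    rw [contrast, abs_le]; constructor <;> linarith
  have hrb := h.ae_cov h.abs_riesz_le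
  have hc : 0 < 1 / c := one_div_pos.2 h.pos
  have hei : Integrable (fun o => eif π₀ m₀ χ o ^ 2) P₀ := by
    refine Integrable.of_bound (C := (1 + 1 / c + |χ|) ^ 2) ?_ ?_
    · exact (((measurable_chiCorr h.measurable_prop h.measurable_mean).sub_const χ).pow_const
        2).aestronglyMeasurable
    · filter_upwards [hrb] with o ho
      rw [norm_pow, Real.norm_eq_abs]
      gcongr
      unfold eif chiCorr
      refine (abs_sub _ _).trans (add_le_add ((abs_add_le _ _).trans (add_le_add (hcb _) ?_))
        le_rfl)
      rw [abs_mul, ← mul_one (1 / c)]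
      exact mul_le_mul (ho _) (h.abs_bit_sub_le _ _ _) (abs_nonneg _) hc.le
  have hk1 : Measurable fun q : Bool × S => (contrast m₀ q.2 - χ) ^ 2
      + riesz π₀ q.1 q.2 ^ 2 * (m₀ q.1 q.2 * (1 - m₀ q.1 q.2)) :=
    (((hcm.comp measurable_snd).sub_const χ).pow_const 2).add
      ((hr.pow_const 2).mul (hm.mul (hm.const_sub 1)))
  rw [h.integral_eq_of_outcome hei hk1 fun q => by simp only [eif, chiCorr, bit]; simp; ring]
  have hi1 : Integrable (fun o : Obs S => (contrast m₀ o.2.2 - χ) ^ 2) P₀ := by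
    refine Integrable.of_bound (C := (1 + |χ|) ^ 2) ?_ (Eventually.of_forall fun o => ?_)
    · exact (((hcm.comp measurable_snd).sub_const χ).pow_const 2 |>.comp
        measurable_snd).aestronglyMeasurable
    · rw [norm_pow, Real.norm_eq_abs]
      gcongr
      exact (abs_sub _ _).trans (add_le_add (hcb _) le_rfl)
  have hi2 : Integrable (fun o : Obs S => riesz π₀ o.2.1 o.2.2 ^ 2 *
      (m₀ o.2.1 o.2.2 * (1 - m₀ o.2.1 o.2.2))) P₀ := by
    refine Integrable.of_bound (C := (1 / c) ^ 2 * (1 * 1)) ?_ ?_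
    · exact (((hr.pow_const 2).mul (hm.mul (hm.const_sub 1))).comp
        measurable_snd).aestronglyMeasurable
    · filter_upwards [hrb] with o ho
      have h1 := h.mean_mem o.2.1 o.2.2
      rw [norm_mul, norm_pow, norm_mul, Real.norm_eq_abs, Real.norm_eq_abs, Real.norm_eq_abs,
        abs_of_pos h1.1, abs_of_pos (by linarith : 0 < 1 - m₀ o.2.1 o.2.2)]
      have h2 : (0 : ℝ) ≤ 1 - m₀ o.2.1 o.2.2 := by linarith
      have h3 := h1.1.le
      gcongr
      · exact ho _
      · exact h1.2.le
      · linarith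
  rw [integral_add hi1 hi2, add_comm]
  congr 1
  have hci : Integrable (contrast m₀) F₀ :=
    Integrable.of_bound hcm.aestronglyMeasurable 1 (Eventually.of_forall hcb)
  have hci2 : Integrable (fun x => contrast m₀ x ^ 2) F₀ := by
    refine Integrable.of_bound (C := 1 ^ 2) (hcm.pow_const 2).aestronglyMeasurable
      (Eventually.of_forall fun x => ?_)
    rw [norm_pow]
    exact pow_le_pow_left₀ (norm_nonneg _) (hcb x) 2
  rw [h.integral_cov (f := fun x => (contrast m₀ x - χ) ^ 2) ((hcm.sub_const χ).pow_const 2)]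
  have e : ∀ x, (contrast m₀ x - χ) ^ 2 = contrast m₀ x ^ 2 - 2 * χ * contrast m₀ x + χ ^ 2 :=
    fun x => by ring
  simp_rw [e]
  have hci3 : Integrable (fun x => contrast m₀ x ^ 2 - 2 * χ * contrast m₀ x) F₀ :=
    hci2.sub (hci.const_mul _)
  rw [integral_add hci3 (integrable_const _),
    integral_sub hci2 (hci.const_mul _), integral_const_mul, ← hχ]
  simp
  ring

end ObsModel

/-! ### The bias and variance of the pilot correction -/

/-- Measurable pilot estimators `(π, m)` within `r` and `ε` of the truth in `L²`, with Riesz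
representor bounded by `M`. -/
structure GoodPilot {S : Type*} [MeasurableSpace S] (F₀ : Measure S) (π₀ : S → ℝ)
    (m₀ : Bool → S → ℝ) (π : S → ℝ) (m : Bool → S → ℝ) (M r ε : ℝ) : Prop where
  measurable_prop : Measurable π
  measurable_mean : ∀ d, Measurable (m d)
  prop_mem : ∀ x, 0 < π x ∧ π x < 1
  riesz_le : ∀ᵐ x ∂F₀, ∀ d, |riesz π d x| ≤ M
  prop_rate : eLpNorm (fun x => π x - π₀ x) 2 F₀ ≤ ENNReal.ofReal r
  mean_rate : ∀ d, eLpNorm (fun x => m d x - m₀ d x) 2 F₀ ≤ ENNReal.ofReal ε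

namespace GoodPilot

variable {S : Type*} [MeasurableSpace S] {P₀ : Measure (Obs S)} {F₀ : Measure S} {π₀ : S → ℝ}
  {m₀ : Bool → S → ℝ} {c : ℝ} {π : S → ℝ} {m : Bool → S → ℝ} {M r ε : ℝ}

lemma memLp_prop (h₀ : ObsModel P₀ F₀ π₀ m₀ c) (h : GoodPilot F₀ π₀ m₀ π m M r ε) :
    MemLp (fun x => π x - π₀ x) 2 F₀ ∧ ∫ x, (π x - π₀ x) ^ 2 ∂F₀ ≤ r ^ 2 :=
  memLp_of_eLpNorm_le (h.measurable_prop.sub h₀.measurable_prop) h.prop_rate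

lemma memLp_mean (h₀ : ObsModel P₀ F₀ π₀ m₀ c) (h : GoodPilot F₀ π₀ m₀ π m M r ε) (d : Bool) :
    MemLp (fun x => m d x - m₀ d x) 2 F₀ ∧ ∫ x, (m d x - m₀ d x) ^ 2 ∂F₀ ≤ ε ^ 2 :=
  memLp_of_eLpNorm_le ((h.measurable_mean d).sub (h₀.measurable_mean d)) (h.mean_rate d)

lemma bound_nonneg (h₀ : ObsModel P₀ F₀ π₀ m₀ c) (h : GoodPilot F₀ π₀ m₀ π m M r ε) : 0 ≤ M := by
  have := h₀.prob_cov
  obtain ⟨x, hx⟩ := h.riesz_le.exists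
  exact (abs_nonneg _).trans (hx true)

lemma inv_le (h : GoodPilot F₀ π₀ m₀ π m M r ε) :
    ∀ᵐ x ∂F₀, 1 / π x ≤ M ∧ 1 / (1 - π x) ≤ M := by
  filter_upwards [h.riesz_le] with x hx
  have hp := h.prop_mem x
  have h1 := hx true
  have h2 := hx false
  rw [riesz_true, abs_of_pos (one_div_pos.2 hp.1)] at h1
  rw [riesz_false, abs_neg, abs_of_pos (one_div_pos.2 (by linarith))] at h2
  exact ⟨h1, h2⟩

lemma abs_riesz_sub_le (h₀ : ObsModel P₀ F₀ π₀ m₀ c) (h : GoodPilot F₀ π₀ m₀ π m M r ε) :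
    ∀ᵐ x ∂F₀, ∀ d, |riesz π d x - riesz π₀ d x| ≤ M / c * |π x - π₀ x| := by
  have hM := h.bound_nonneg h₀
  filter_upwards [h.inv_le, h₀.overlap] with x hx ho d
  have hp := h.prop_mem x
  have hc := h₀.pos
  have key : ∀ p q : ℝ, 0 < p → c ≤ q → 1 / p ≤ M → |1 / p - 1 / q| ≤ M / c * |p - q| := by
    intro p q hp0 hq0 hpM
    have hq1 : 0 < q := by linarith
    have e : 1 / p - 1 / q = (1 / p) * (1 / q) * (q - p) := by field_simp
    rw [e, abs_mul, abs_of_pos (by positivity), abs_sub_comm q p, div_eq_mul_one_div M c]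
    gcongr
  cases d
  · rw [riesz_false, riesz_false, show -(1 / (1 - π x)) - -(1 / (1 - π₀ x))
      = -(1 / (1 - π x) - 1 / (1 - π₀ x)) by ring, abs_neg]
    refine (key _ _ (by linarith) (by linarith) hx.2).trans (le_of_eq ?_)
    rw [show 1 - π x - (1 - π₀ x) = -(π x - π₀ x) by ring, abs_neg]
  · rw [riesz_true, riesz_true]
    exact key _ _ hp.1 ho.1.le hx.1

/-- The discrepancy between the corrections with the pilots and with the truth. -/
lemma abs_chiCorr_sub_le (h₀ : ObsModel P₀ F₀ π₀ m₀ c) (h : GoodPilot F₀ π₀ m₀ π m M r ε) :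
    ∀ᵐ o ∂P₀, |chiCorr π m o - chiCorr π₀ m₀ o|
      ≤ (1 + M) * discrepancy m m₀ o.2.2 + M / c * |π o.2.2 - π₀ o.2.2| := by
  have hM := h.bound_nonneg h₀
  filter_upwards [h₀.ae_cov h.riesz_le, h₀.ae_cov (h.abs_riesz_sub_le h₀)] with o h1 h2
  have e : chiCorr π m o - chiCorr π₀ m₀ o = (contrast m o.2.2 - contrast m₀ o.2.2)
      - riesz π o.2.1 o.2.2 * (m o.2.1 o.2.2 - m₀ o.2.1 o.2.2)
      + (riesz π o.2.1 o.2.2 - riesz π₀ o.2.1 o.2.2) * (bit o.1 - m₀ o.2.1 o.2.2) := by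
    unfold chiCorr; ring
  rw [e]
  refine (abs_add_le _ _).trans (add_le_add ((abs_sub _ _).trans ?_) ?_)
  · rw [add_mul, one_mul, abs_mul]
    refine add_le_add (abs_contrast_sub_le _ _ _) ?_
    exact mul_le_mul (h1 _) (abs_sub_le_discrepancy _ _ _ _) (abs_nonneg _) hM
  · rw [abs_mul, ← mul_one (M / c * _)]
    exact mul_le_mul (h2 _) (h₀.abs_bit_sub_le _ _ _) (abs_nonneg _)
      ((abs_nonneg _).trans (h2 o.2.1))

/-- The pilot correction is consistent in `L²`; with the bound of its bias this makes its empirical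
mean asymptotically equivalent to the one of the efficient correction. -/
lemma integral_chiCorr_sub_sq_le (h₀ : ObsModel P₀ F₀ π₀ m₀ c)
    (h : GoodPilot F₀ π₀ m₀ π m M r ε) :
    MemLp (fun o => chiCorr π m o - chiCorr π₀ m₀ o) 2 P₀ ∧
      ∫ o, (chiCorr π m o - chiCorr π₀ m₀ o) ^ 2 ∂P₀
        ≤ 8 * (1 + M) ^ 2 * ε ^ 2 + 2 * (M / c) ^ 2 * r ^ 2 := by
  have hmeas : Measurable fun o => chiCorr π m o - chiCorr π₀ m₀ o :=
    (measurable_chiCorr h.measurable_prop h.measurable_mean).sub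
      (measurable_chiCorr h₀.measurable_prop h₀.measurable_mean)
  let B : S → ℝ := fun x => 4 * (1 + M) ^ 2 * ((m true x - m₀ true x) ^ 2
    + (m false x - m₀ false x) ^ 2) + 2 * (M / c) ^ 2 * (π x - π₀ x) ^ 2
  have hp := h.memLp_prop h₀
  have ht := h.memLp_mean h₀ true
  have hf := h.memLp_mean h₀ false
  have i1 := ht.1.integrable_sq
  have i2 := hf.1.integrable_sq
  have i3 := hp.1.integrable_sq
  have hB : Integrable B F₀ := ((i1.add i2).const_mul _).add (i3.const_mul _)
  have hle : ∀ᵐ o ∂P₀, (chiCorr π m o - chiCorr π₀ m₀ o) ^ 2 ≤ B o.2.2 := by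
    filter_upwards [h.abs_chiCorr_sub_le h₀] with o ho
    rw [← sq_abs]
    refine (pow_le_pow_left₀ (abs_nonneg _) ho 2).trans ?_
    have e1 : ∀ u v : ℝ, (u + v) ^ 2 ≤ 2 * u ^ 2 + 2 * v ^ 2 := fun u v => by
      nlinarith [sq_nonneg (u - v)]
    refine (e1 _ _).trans ?_
    have e2 : discrepancy m m₀ o.2.2 ^ 2 ≤ 2 * ((m true o.2.2 - m₀ true o.2.2) ^ 2
        + (m false o.2.2 - m₀ false o.2.2) ^ 2) := by
      unfold discrepancy
      refine (e1 _ _).trans (le_of_eq ?_)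
      rw [sq_abs, sq_abs]; ring
    simp only [B, mul_pow, sq_abs]
    have := mul_le_mul_of_nonneg_left e2 (by positivity : 0 ≤ 2 * (1 + M) ^ 2)
    linarith
  have hi : Integrable (fun o => (chiCorr π m o - chiCorr π₀ m₀ o) ^ 2) P₀ := by
    refine (h₀.integrable_cov hB).mono' (hmeas.pow_const 2).aestronglyMeasurable ?_
    filter_upwards [hle] with o ho
    rwa [Real.norm_eq_abs, abs_of_nonneg (sq_nonneg _)]
  refine ⟨(memLp_two_iff_integrable_sq hmeas.aestronglyMeasurable).2 hi, ?_⟩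
  have hBm : Measurable B := by
    have a1 := (h.measurable_mean true).sub (h₀.measurable_mean true)
    have a2 := (h.measurable_mean false).sub (h₀.measurable_mean false)
    have a3 := h.measurable_prop.sub h₀.measurable_prop
    exact (((a1.pow_const 2).add (a2.pow_const 2)).const_mul _).add ((a3.pow_const 2).const_mul _)
  refine (integral_mono_ae hi (h₀.integrable_cov hB) hle).trans ?_
  rw [h₀.integral_cov hBm]
  simp only [B]
  have i4 : Integrable (fun x => 4 * (1 + M) ^ 2 * ((m true x - m₀ true x) ^ 2
      + (m false x - m₀ false x) ^ 2)) F₀ := (i1.add i2).const_mul _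
  rw [integral_add i4 (i3.const_mul _), integral_const_mul,
    integral_const_mul, integral_add i1 i2]
  have := mul_le_mul_of_nonneg_left (add_le_add ht.2 hf.2)
    (by positivity : 0 ≤ 4 * (1 + M) ^ 2)
  have := mul_le_mul_of_nonneg_left hp.2 (by positivity : 0 ≤ 2 * (M / c) ^ 2)
  linarith

/-- Double robustness: the bias of the pilot correction is a product of two errors. -/
lemma abs_integral_chiCorr_sub_le (h₀ : ObsModel P₀ F₀ π₀ m₀ c)
    (h : GoodPilot F₀ π₀ m₀ π m M r ε) :
    |∫ o, (chiCorr π m o - chiCorr π₀ m₀ o) ∂P₀| ≤ 2 * M * (|r| * |ε|) := by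
  have := h₀.prob_obs
  have hM := h.bound_nonneg h₀
  have hp := h.memLp_prop h₀
  have ht := h.memLp_mean h₀ true
  have hf := h.memLp_mean h₀ false
  have hi := (h.integral_chiCorr_sub_sq_le h₀).1.integrable one_le_two
  have hm := measurable_uncurry_bool h.measurable_mean
  have hm₀ := measurable_uncurry_bool h₀.measurable_mean
  have hr := measurable_uncurry_bool fun d => measurable_riesz h.measurable_prop d
  let k : Bool × S → ℝ := fun q => contrast m q.2 - contrast m₀ q.2
    + riesz π q.1 q.2 * (m₀ q.1 q.2 - m q.1 q.2)
  have hcm : Measurable (contrast m) := (h.measurable_mean true).sub (h.measurable_mean false)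
  have hcm₀ : Measurable (contrast m₀) := (h₀.measurable_mean true).sub (h₀.measurable_mean false)
  have hk : Measurable k := ((hcm.comp measurable_snd).sub (hcm₀.comp measurable_snd)).add
    (hr.mul (hm₀.sub hm))
  have ct := (integral_abs_mul_abs_le hp.1 ht.1 hp.2 ht.2)
  have cf := (integral_abs_mul_abs_le hp.1 hf.1 hp.2 hf.2)
  have hdisc : Integrable (discrepancy m m₀) F₀ := by
    have := h₀.prob_cov
    exact ((ht.1.integrable one_le_two).abs).add ((hf.1.integrable one_le_two).abs)
  have hki : Integrable (fun o : Obs S => k o.2) P₀ := by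
    refine ((h₀.integrable_cov hdisc).const_mul (1 + M)).mono'
      (hk.comp measurable_snd).aestronglyMeasurable ?_
    filter_upwards [h₀.ae_cov h.riesz_le] with o ho
    rw [Real.norm_eq_abs, add_mul, one_mul]
    refine (abs_add_le _ _).trans (add_le_add (abs_contrast_sub_le _ _ _) ?_)
    rw [abs_mul, abs_sub_comm]
    exact mul_le_mul (ho _) (abs_sub_le_discrepancy _ _ _ _) (abs_nonneg _) hM
  rw [h₀.integral_eq_of_outcome hi hk fun q => by simp only [k, chiCorr, bit]; simp; ring,
    h₀.integral_eq_of_treatment hk hki]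
  refine (abs_integral_le_integral_abs).trans ?_
  have hdom : Integrable (fun x => M * (|π x - π₀ x| * |m true x - m₀ true x|
      + |π x - π₀ x| * |m false x - m₀ false x|)) F₀ := (ct.1.add cf.1).const_mul M
  have hpt : ∀ᵐ x ∂F₀, |π₀ x * k (true, x) + (1 - π₀ x) * k (false, x)|
      ≤ M * (|π x - π₀ x| * |m true x - m₀ true x| + |π x - π₀ x| * |m false x - m₀ false x|) := by
    filter_upwards [h.inv_le] with x hx
    have hq := h.prop_mem x
    have hq1 : 0 < 1 - π x := by linarith
    have e : π₀ x * k (true, x) + (1 - π₀ x) * k (false, x)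
        = 1 / π x * ((π x - π₀ x) * (m true x - m₀ true x))
          + 1 / (1 - π x) * ((π x - π₀ x) * (m false x - m₀ false x)) := by
      simp only [k, riesz_true, riesz_false, contrast]
      have := hq.1.ne'
      have := hq1.ne'
      field_simp
      ring
    rw [e, mul_add]
    refine (abs_add_le _ _).trans (add_le_add ?_ ?_)
    · rw [abs_mul, abs_mul, abs_of_pos (one_div_pos.2 hq.1)]
      gcongr
      exact hx.1
    · rw [abs_mul, abs_mul, abs_of_pos (one_div_pos.2 hq1)]
      gcongr
      exact hx.2
  refine (integral_mono_of_nonneg (Eventually.of_forall fun x => abs_nonneg _) hdom hpt).trans ?_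
  rw [integral_const_mul, integral_add ct.1 cf.1]
  have := mul_le_mul_of_nonneg_left (add_le_add ct.2 cf.2) hM
  linarith

/-- The information for the pilot Riesz representor is close to the true one. -/
lemma abs_integral_information_sub_le (h₀ : ObsModel P₀ F₀ π₀ m₀ c)
    (h : GoodPilot F₀ π₀ m₀ π m M r ε) :
    |∫ o, riesz π o.2.1 o.2.2 ^ 2 * (m₀ o.2.1 o.2.2 * (1 - m₀ o.2.1 o.2.2)) ∂P₀
      - ∫ o, riesz π₀ o.2.1 o.2.2 ^ 2 * (m₀ o.2.1 o.2.2 * (1 - m₀ o.2.1 o.2.2)) ∂P₀|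
      ≤ (M + 1 / c) * (M / c) * |r| := by
  have := h₀.prob_obs
  have := h₀.prob_cov
  have hM := h.bound_nonneg h₀
  have hc := one_div_pos.2 h₀.pos
  have hp := h.memLp_prop h₀
  have hm₀ := measurable_uncurry_bool h₀.measurable_mean
  have hw : ∀ d x, 0 ≤ m₀ d x * (1 - m₀ d x) ∧ m₀ d x * (1 - m₀ d x) ≤ 1 := fun d x => by
    have := h₀.mean_mem d x
    constructor <;> nlinarith
  have hint : ∀ p : S → ℝ, Measurable p → ∀ K : ℝ, (∀ᵐ x ∂F₀, ∀ d, |riesz p d x| ≤ K) →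
      Integrable (fun o : Obs S => riesz p o.2.1 o.2.2 ^ 2 *
        (m₀ o.2.1 o.2.2 * (1 - m₀ o.2.1 o.2.2))) P₀ := fun p hpm K hK => by
    have hr := measurable_uncurry_bool fun d => measurable_riesz hpm d
    refine Integrable.of_bound (C := K ^ 2 * 1) ?_ ?_
    · exact (((hr.pow_const 2).mul (hm₀.mul (hm₀.const_sub 1))).comp
        measurable_snd).aestronglyMeasurable
    · filter_upwards [h₀.ae_cov hK] with o ho
      have hwo := hw o.2.1 o.2.2
      have hwo0 := hwo.1
      rw [norm_mul, norm_pow, Real.norm_eq_abs, Real.norm_eq_abs, abs_of_nonneg hwo0]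
      gcongr
      · exact ho _
      · exact hwo.2
  have i1 := hint π h.measurable_prop M h.riesz_le
  have i2 := hint π₀ h₀.measurable_prop (1 / c) h₀.abs_riesz_le
  rw [← integral_sub i1 i2]
  refine abs_integral_le_integral_abs.trans ?_
  have h1 := integral_abs_mul_abs_le hp.1 (memLp_const (1 : ℝ)) hp.2
    (b := 1) (by simp)
  simp only [abs_one, mul_one] at h1
  refine (integral_mono_ae (i1.sub i2).abs ((h₀.integrable_cov h1.1).const_mul
    ((M + 1 / c) * (M / c))) ?_).trans ?_
  · filter_upwards [h₀.ae_cov h.riesz_le, h₀.ae_cov h₀.abs_riesz_le,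
      h₀.ae_cov (h.abs_riesz_sub_le h₀)] with o g1 g2 g3
    have := hw o.2.1 o.2.2
    have hw0 := this.1
    have h3 := (abs_nonneg _).trans (g3 true)
    simp only [Pi.sub_apply]
    rw [← sub_mul, abs_mul, abs_of_nonneg hw0, sq_sub_sq, abs_mul]
    calc _ ≤ (M + 1 / c) * (M / c * |π o.2.2 - π₀ o.2.2|) * 1 := by
          gcongr
          · exact (abs_add_le _ _).trans (add_le_add (g1 _) (g2 _))
          · exact g3 _
          · exact this.2
      _ = _ := by ring
  · rw [integral_const_mul, h₀.integral_cov (f := fun x => |π x - π₀ x|)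
      (h.measurable_prop.sub h₀.measurable_prop).abs]
    have h2 : 0 ≤ M / c := by rw [div_eq_mul_one_div]; positivity
    gcongr
    exact h1.2

end GoodPilot

/-! ### Posterior means by leaving one observation out -/

section LeaveOneOut

variable {Z E : Type*} [MeasurableSpace Z] [MeasurableSpace E]

/-- A posterior mean with likelihood `ℓ` for one observation is bounded by its linearisation at the
reference value `ℓ₀` of the likelihood. -/
lemma posterior_mean_le {κ : Measure Z} [IsFiniteMeasure κ] {ℓ φ : Z → ENNReal} (hℓ : Measurable ℓ)
    (hφ : Measurable φ) (hφ2 : ∀ z, φ z ≤ 2) {ℓ₀ : ENNReal} (h0 : ℓ₀ ≠ 0) (ht : ℓ₀ ≠ ⊤) :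
    (∫⁻ z, ℓ z * φ z ∂κ) / ∫⁻ z, ℓ z ∂κ
      ≤ (κ Set.univ)⁻¹ * ∫⁻ z, (2 * (φ z * (ℓ z / ℓ₀)) + 4 * ((ℓ₀ - ℓ z) / ℓ₀)) ∂κ := by
  rcases eq_or_ne (κ Set.univ) 0 with hκ | hκ
  · rw [Measure.measure_univ_eq_zero] at hκ
    simp [hκ]
  have hKt := measure_ne_top κ Set.univ
  set K := κ Set.univ with hK
  set N := ∫⁻ z, ℓ z * φ z ∂κ with hN
  set I := ∫⁻ z, ℓ z ∂κ with hI
  set J := ∫⁻ z, (ℓ₀ - ℓ z) ∂κ with hJ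
  have hD0 : K * ℓ₀ ≠ 0 := mul_ne_zero hκ h0
  have hDt : K * ℓ₀ ≠ ⊤ := ENNReal.mul_ne_top hKt ht
  have hrhs : K⁻¹ * ∫⁻ z, (2 * (φ z * (ℓ z / ℓ₀)) + 4 * ((ℓ₀ - ℓ z) / ℓ₀)) ∂κ
      = (2 * N + 4 * J) / (K * ℓ₀) := by
    have e : ∀ z, 2 * (φ z * (ℓ z / ℓ₀)) + 4 * ((ℓ₀ - ℓ z) / ℓ₀)
        = (2 * (ℓ z * φ z) + 4 * (ℓ₀ - ℓ z)) * ℓ₀⁻¹ := fun z => by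
      simp only [div_eq_mul_inv]; ring
    simp_rw [e]
    rw [lintegral_mul_const _ (by fun_prop), lintegral_add_left (by fun_prop),
      lintegral_const_mul _ (by fun_prop), lintegral_const_mul _ (by fun_prop), ← hN, ← hJ,
      div_eq_mul_inv, ENNReal.mul_inv (Or.inl hκ) (Or.inl hKt)]
    ring
  rw [hrhs]
  have hsum : K * ℓ₀ ≤ I + J := by
    calc K * ℓ₀ = ∫⁻ _, ℓ₀ ∂κ := by rw [lintegral_const, mul_comm]
      _ ≤ ∫⁻ z, (ℓ z + (ℓ₀ - ℓ z)) ∂κ := lintegral_mono fun z => le_add_tsub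
      _ = I + J := lintegral_add_left hℓ _
  rcases le_or_gt (K * ℓ₀ / 2) I with h | h
  · calc N / I ≤ N / (K * ℓ₀ / 2) := ENNReal.div_le_div_left h _
      _ = 2 * N / (K * ℓ₀) := by
        rw [div_eq_mul_inv, ENNReal.inv_div (Or.inl (by simp)) (Or.inl (by simp)), mul_div,
          mul_comm]
      _ ≤ _ := by gcongr; exact le_self_add
  · have hNI : N ≤ 2 * I := by
      rw [← lintegral_const_mul _ hℓ]
      refine lintegral_mono fun z => ?_
      rw [mul_comm]
      gcongr
      exact hφ2 z
    have hhalf : K * ℓ₀ / 2 ≤ J := by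
      by_contra! hJ'
      have := ENNReal.add_lt_add h hJ'
      rw [ENNReal.add_halves] at this
      exact absurd hsum (not_le.2 this)
    calc N / I ≤ 2 := ENNReal.div_le_of_le_mul hNI
      _ ≤ (2 * N + 4 * J) / (K * ℓ₀) := by
        rw [ENNReal.le_div_iff_mul_le (Or.inl hD0) (Or.inl hDt)]
        calc 2 * (K * ℓ₀) = 4 * (K * ℓ₀ / 2) := by
              rw [show (4 : ENNReal) = 2 * 2 by norm_num, mul_assoc,
                ENNReal.mul_div_cancel two_ne_zero ENNReal.ofNat_ne_top]
          _ ≤ 4 * J := by gcongr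
          _ ≤ _ := le_add_self

/-- One observation with law `P`: if the likelihood ratio `L / L₀` is close to one in mean and `φ`
is small under the tilted law, uniformly in the parameter, then the mean of the posterior mean of
`φ` is small. -/
lemma lintegral_posterior_mean_le {κ : Measure Z} [IsFiniteMeasure κ] {P : Measure E} [SFinite P]
    {L φ : Z → E → ENNReal} {L₀ : E → ENNReal} (hL : Measurable fun q : Z × E => L q.1 q.2)
    (hφ : Measurable fun q : Z × E => φ q.1 q.2) (hL₀ : Measurable L₀) (hφ2 : ∀ z x, φ z x ≤ 2)
    (h0 : ∀ x, L₀ x ≠ 0) (ht : ∀ x, L₀ x ≠ ⊤) {δ : ENNReal}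
    (h1 : ∀ᵐ z ∂κ, ∫⁻ x, φ z x * (L z x / L₀ x) ∂P ≤ δ)
    (h2 : ∀ᵐ z ∂κ, ∫⁻ x, (L₀ x - L z x) / L₀ x ∂P ≤ δ) :
    ∫⁻ x, (∫⁻ z, L z x * φ z x ∂κ) / ∫⁻ z, L z x ∂κ ∂P ≤ 6 * δ := by
  have hLx : ∀ x, Measurable fun z => L z x := fun x => hL.comp measurable_prodMk_right
  have hφx : ∀ x, Measurable fun z => φ z x := fun x => hφ.comp measurable_prodMk_right
  have hLz : ∀ z, Measurable fun x => L z x := fun z => hL.comp measurable_prodMk_left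
  have hφz : ∀ z, Measurable fun x => φ z x := fun z => hφ.comp measurable_prodMk_left
  have hL₀' : Measurable fun q : Z × E => L₀ q.2 := hL₀.comp measurable_snd
  have hint : Measurable fun q : Z × E =>
      2 * (φ q.1 q.2 * (L q.1 q.2 / L₀ q.2)) + 4 * ((L₀ q.2 - L q.1 q.2) / L₀ q.2) := by
    fun_prop
  calc _ ≤ ∫⁻ x, (κ Set.univ)⁻¹ *
        ∫⁻ z, (2 * (φ z x * (L z x / L₀ x)) + 4 * ((L₀ x - L z x) / L₀ x)) ∂κ ∂P :=
        lintegral_mono fun x => posterior_mean_le (hLx x) (hφx x) (fun z => hφ2 z x) (h0 x) (ht x)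
    _ = (κ Set.univ)⁻¹ *
        ∫⁻ z, ∫⁻ x, (2 * (φ z x * (L z x / L₀ x)) + 4 * ((L₀ x - L z x) / L₀ x)) ∂P ∂κ := by
        rw [lintegral_const_mul _ hint.lintegral_prod_left', lintegral_lintegral_swap]
        exact (hint.comp measurable_swap).aemeasurable
    _ ≤ (κ Set.univ)⁻¹ * ∫⁻ _, 6 * δ ∂κ := by
        refine mul_le_mul_right ?_ _
        refine lintegral_mono_ae (μ := κ) ?_
        filter_upwards [h1, h2] with z hz1 hz2
        have := hLz z
        have := hφz z
        rw [lintegral_add_left (by fun_prop), lintegral_const_mul _ (by fun_prop),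
          lintegral_const_mul _ (by fun_prop), show (6 : ENNReal) * δ = 2 * δ + 4 * δ by ring]
        gcongr
    _ ≤ 6 * δ := by
        rw [lintegral_const, mul_comm (6 * δ), ← mul_assoc]
        calc _ ≤ 1 * (6 * δ) := by gcongr; exact ENNReal.inv_mul_le_one _
          _ = _ := one_mul _

/-- The bound of `lintegral_posterior_mean_le` for `φ` evaluated at one of the observations of an
i.i.d. sample: given the others, it is the bound for one observation, when the prior is replaced by
the posterior given the others. -/
lemma lintegral_iid_posterior_mean_le {π : Measure Z} [IsFiniteMeasure π] {P : Measure E}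
    [IsProbabilityMeasure P] {L φ : Z → E → ENNReal} {L₀ : E → ENNReal}
    (hL : Measurable fun q : Z × E => L q.1 q.2) (hL1 : ∀ z x, L z x ≤ 1)
    (hφ : Measurable fun q : Z × E => φ q.1 q.2) (hL₀ : Measurable L₀) (hφ2 : ∀ z x, φ z x ≤ 2)
    (h0 : ∀ x, L₀ x ≠ 0) (ht : ∀ x, L₀ x ≠ ⊤) {δ : ENNReal}
    (h1 : ∀ᵐ z ∂π, ∫⁻ x, φ z x * (L z x / L₀ x) ∂P ≤ δ)
    (h2 : ∀ᵐ z ∂π, ∫⁻ x, (L₀ x - L z x) / L₀ x ∂P ≤ δ) {n : ℕ} (i : Fin n) :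
    ∫⁻ o, (∫⁻ z, (∏ j, L z (o j)) * φ z (o i) ∂π) / ∫⁻ z, ∏ j, L z (o j) ∂π
      ∂(Measure.pi fun _ : Fin n => P) ≤ 6 * δ := by
  obtain _ | m := n
  · exact i.elim0
  let G : E × (Fin m → E) → ENNReal := fun q =>
    (∫⁻ z, (∏ j, L z (q.2 j)) * (L z q.1 * φ z q.1) ∂π) / ∫⁻ z, (∏ j, L z (q.2 j)) * L z q.1 ∂π
  have hq1 : Measurable fun w : (E × (Fin m → E)) × Z => (w.2, w.1.1) := by fun_prop
  have hqj : ∀ j : Fin m, Measurable fun w : (E × (Fin m → E)) × Z => (w.2, w.1.2 j) := by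
    intro j; fun_prop
  have hp : Measurable fun w : (E × (Fin m → E)) × Z => ∏ j, L w.2 (w.1.2 j) :=
    Finset.measurable_prod _ fun j _ => hL.comp (hqj j)
  have hG : Measurable G :=
    (hp.mul ((hL.comp hq1).mul (hφ.comp hq1))).lintegral_prod_right'.div
      (hp.mul (hL.comp hq1)).lintegral_prod_right'
  have hmp := measurePreserving_piFinSuccAbove (fun _ : Fin (m + 1) => P) i
  calc _ = ∫⁻ o, G (MeasurableEquiv.piFinSuccAbove (fun _ => E) i o)
        ∂(Measure.pi fun _ : Fin (m + 1) => P) := by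
        refine lintegral_congr fun o => ?_
        have e : ∀ z, ∏ j, L z (o j) = (∏ j, L z (o (i.succAbove j))) * L z (o i) := fun z => by
          rw [Fin.prod_univ_succAbove _ i, mul_comm]
        simp only [e, mul_assoc]
        rfl
    _ = ∫⁻ q, G q ∂(P.prod (Measure.pi fun _ : Fin m => P)) := hmp.lintegral_comp hG
    _ = ∫⁻ o', ∫⁻ x, G (x, o') ∂P ∂(Measure.pi fun _ : Fin m => P) :=
        lintegral_prod_symm _ hG.aemeasurable
    _ ≤ ∫⁻ _, 6 * δ ∂(Measure.pi fun _ : Fin m => P) := lintegral_mono fun o' => ?_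
    _ = 6 * δ := by simp
  set w : Z → ENNReal := fun z => ∏ j, L z (o' j) with hw
  have hwm : Measurable w :=
    Finset.measurable_prod _ fun j _ => hL.comp measurable_prodMk_right
  have hw1 : ∀ z, w z ≤ 1 := fun z => Finset.prod_le_one' fun j _ => hL1 z _
  have hfin : IsFiniteMeasure (π.withDensity w) :=
    isFiniteMeasure_withDensity (ne_top_of_le_ne_top (measure_ne_top π Set.univ) (by
      calc _ ≤ ∫⁻ _, 1 ∂π := lintegral_mono hw1
        _ = _ := by simp))
  have habs := withDensity_absolutelyContinuous π w
  refine le_trans (le_of_eq ?_) (lintegral_posterior_mean_le (κ := π.withDensity w) hL hφ hL₀ hφ2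
    h0 ht (habs.ae_le h1) (habs.ae_le h2))
  refine lintegral_congr fun x => ?_
  have hLx : Measurable fun z => L z x := hL.comp measurable_prodMk_right
  have hφx : Measurable fun z => φ z x := hφ.comp measurable_prodMk_right
  rw [lintegral_withDensity_eq_lintegral_mul _ hwm (by fun_prop),
    lintegral_withDensity_eq_lintegral_mul _ hwm hLx]
  rfl

/-- The average of `lintegral_iid_posterior_mean_le` over the observations. -/
lemma lintegral_iid_posterior_avg_le {π : Measure Z} [IsFiniteMeasure π] {P : Measure E}
    [IsProbabilityMeasure P] {L φ : Z → E → ENNReal} {L₀ : E → ENNReal}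
    (hL : Measurable fun q : Z × E => L q.1 q.2) (hL1 : ∀ z x, L z x ≤ 1)
    (hφ : Measurable fun q : Z × E => φ q.1 q.2) (hL₀ : Measurable L₀) (hφ2 : ∀ z x, φ z x ≤ 2)
    (h0 : ∀ x, L₀ x ≠ 0) (ht : ∀ x, L₀ x ≠ ⊤) {δ : ENNReal}
    (h1 : ∀ᵐ z ∂π, ∫⁻ x, φ z x * (L z x / L₀ x) ∂P ≤ δ)
    (h2 : ∀ᵐ z ∂π, ∫⁻ x, (L₀ x - L z x) / L₀ x ∂P ≤ δ) {n : ℕ} (hn : 0 < n) :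
    ∫⁻ o, (∫⁻ z, (∏ j, L z (o j)) * ((n : ENNReal)⁻¹ * ∑ i, φ z (o i)) ∂π)
        / ∫⁻ z, ∏ j, L z (o j) ∂π ∂(Measure.pi fun _ : Fin n => P) ≤ 6 * δ := by
  have hn0 : (n : ENNReal) ≠ 0 := by exact_mod_cast hn.ne'
  have hLo : Measurable fun w : (Fin n → E) × Z => ∏ j, L w.2 (w.1 j) :=
    Finset.measurable_prod _ fun j _ => hL.comp (by fun_prop :
      Measurable fun w : (Fin n → E) × Z => (w.2, w.1 j))
  have hφo : ∀ i, Measurable fun w : (Fin n → E) × Z => φ w.2 (w.1 i) := fun i =>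
    hφ.comp (by fun_prop : Measurable fun w : (Fin n → E) × Z => (w.2, w.1 i))
  have hpt : ∀ o : Fin n → E,
      (∫⁻ z, (∏ j, L z (o j)) * ((n : ENNReal)⁻¹ * ∑ i, φ z (o i)) ∂π) / ∫⁻ z, ∏ j, L z (o j) ∂π
      = (n : ENNReal)⁻¹ *
        ∑ i, (∫⁻ z, (∏ j, L z (o j)) * φ z (o i) ∂π) / ∫⁻ z, ∏ j, L z (o j) ∂π := fun o => by
    have e : ∀ z, (∏ j, L z (o j)) * ((n : ENNReal)⁻¹ * ∑ i, φ z (o i))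
        = (n : ENNReal)⁻¹ * ∑ i, (∏ j, L z (o j)) * φ z (o i) := fun z => by
      rw [← Finset.mul_sum]; ring
    have hLo' : Measurable fun z => ∏ j, L z (o j) := hLo.comp measurable_prodMk_left
    have hφo' : ∀ i, Measurable fun z => φ z (o i) := fun i => (hφo i).comp measurable_prodMk_left
    have hm : ∀ i, Measurable fun z => (∏ j, L z (o j)) * φ z (o i) := fun i => hLo'.mul (hφo' i)
    simp_rw [e]
    rw [lintegral_const_mul _ (Finset.measurable_fun_sum _ fun i _ => hm i),
      lintegral_finsetSum _ fun i _ => hm i, mul_div_assoc]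
    simp only [div_eq_mul_inv, Finset.sum_mul]
  simp_rw [hpt]
  have hmi : ∀ i, Measurable fun o : Fin n → E =>
      (∫⁻ z, (∏ j, L z (o j)) * φ z (o i) ∂π) / ∫⁻ z, ∏ j, L z (o j) ∂π := fun i =>
    (hLo.mul (hφo i)).lintegral_prod_right'.div hLo.lintegral_prod_right'
  rw [lintegral_const_mul _ (Finset.measurable_fun_sum _ fun i _ => hmi i),
    lintegral_finsetSum _ fun i _ => hmi i]
  calc _ ≤ (n : ENNReal)⁻¹ * ∑ _i : Fin n, 6 * δ := by
        gcongr with i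
        exact lintegral_iid_posterior_mean_le hL hL1 hφ hL₀ hφ2 h0 ht h1 h2 i
    _ = 6 * δ := by
        rw [Finset.sum_const, Finset.card_univ, Fintype.card_fin, nsmul_eq_mul, ← mul_assoc,
          ENNReal.inv_mul_cancel hn0 (ENNReal.natCast_ne_top n), one_mul]

end LeaveOneOut

/-! ### Posterior mean of the discrepancy -/

/-- The likelihood of one observation. -/
def likelihoodOne {S : Type*} (m : Bool → S → ℝ) (o : Obs S) : ℝ :=
  if o.1 then m o.2.1 o.2.2 else 1 - m o.2.1 o.2.2

lemma ofReal_likelihood {S : Type*} (η : Bool → S → ℝ) {n : ℕ} (o : Fin n → Obs S) :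
    ENNReal.ofReal (likelihood (condMean η) o)
      = ∏ i, ENNReal.ofReal (likelihoodOne (condMean η) (o i)) := by
  refine ENNReal.ofReal_prod_of_nonneg fun i _ => ?_
  have := condMean_mem η (o i).2.1 (o i).2.2
  split_ifs <;> linarith

lemma measurable_likelihoodOne {Z S : Type*} [MeasurableSpace Z] [MeasurableSpace S]
    {m : Z → Bool → S → ℝ} (hm : ∀ d, Measurable fun q : Z × S => m q.1 d q.2) :
    Measurable fun q : Z × Obs S => likelihoodOne (m q.1) q.2 := by
  have h : Measurable fun q : Z × Obs S => m q.1 q.2.2.1 q.2.2.2 := by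
    have h1 : Measurable fun w : Bool × (Z × S) => m w.2.1 w.1 w.2.2 :=
      measurable_from_prod_countable_right hm
    exact h1.comp (g := fun w => _) (by fun_prop :
      Measurable fun q : Z × Obs S => (q.2.2.1, (q.1, q.2.2.2)))
  unfold likelihoodOne
  exact Measurable.ite ((measurable_fst.comp measurable_snd) (measurableSet_singleton true)) h
    (h.const_sub 1)

lemma measurable_likelihoodOne_left {S : Type*} [MeasurableSpace S] {m : Bool → S → ℝ}
    (hm : ∀ d, Measurable (m d)) : Measurable (likelihoodOne m) :=
  (measurable_likelihoodOne (Z := Unit) (m := fun _ => m)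
    fun d => (hm d).comp measurable_snd).comp (measurable_prodMk_left (x := ()))

lemma measurable_discrepancy_prod {Z S : Type*} [MeasurableSpace Z] [MeasurableSpace S]
    {m : Z → Bool → S → ℝ} {m₀ : Bool → S → ℝ} (hm : ∀ d, Measurable fun q : Z × S => m q.1 d q.2)
    (hm₀ : ∀ d, Measurable (m₀ d)) : Measurable fun q : Z × S => discrepancy (m q.1) m₀ q.2 := by
  unfold discrepancy
  exact ((hm true).sub ((hm₀ true).comp measurable_snd)).abs.add
    ((hm false).sub ((hm₀ false).comp measurable_snd)).abs

namespace ObsModel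

variable {S : Type*} [MeasurableSpace S] {P₀ : Measure (Obs S)} {F₀ : Measure S} {π₀ : S → ℝ}
  {m₀ : Bool → S → ℝ} {c : ℝ}

/-- Integration over the binary outcome. -/
lemma lintegral_eq_of_outcome (h : ObsModel P₀ F₀ π₀ m₀ c) {f : Obs S → ENNReal}
    (hf : Measurable f) :
    ∫⁻ o, f o ∂P₀ = ∫⁻ o, (ENNReal.ofReal (m₀ o.2.1 o.2.2) * f (true, o.2)
      + ENNReal.ofReal (1 - m₀ o.2.1 o.2.2) * f (false, o.2)) ∂P₀ := by
  have hm := measurable_uncurry_bool h.measurable_mean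
  conv_lhs => rw [h.law_eq, lintegral_mixture hm hf, ← h.map_snd]
  rw [lintegral_map ?_ measurable_snd]
  have h1 : Measurable fun q : Bool × S => f (true, q) := hf.comp measurable_prodMk_left
  have h2 : Measurable fun q : Bool × S => f (false, q) := hf.comp measurable_prodMk_left
  fun_prop

/-- Given the covariates, the likelihood ratio has mean one, so that it does not change the mean of
a function of the covariates alone. -/
lemma lintegral_discrepancy_mul_ratio (h : ObsModel P₀ F₀ π₀ m₀ c) {η : Bool → S → ℝ}
    (hη : ∀ d, Measurable (condMean η d)) :
    ∫⁻ o, ENNReal.ofReal (discrepancy (condMean η) m₀ o.2.2)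
        * (ENNReal.ofReal (likelihoodOne (condMean η) o) / ENNReal.ofReal (likelihoodOne m₀ o)) ∂P₀
      = ∫⁻ x, ENNReal.ofReal (discrepancy (condMean η) m₀ x) ∂F₀ := by
  have hd : Measurable (discrepancy (condMean η) m₀) :=
    ((hη true).sub (h.measurable_mean true)).abs.add ((hη false).sub (h.measurable_mean false)).abs
  have hl := measurable_likelihoodOne_left hη
  have hl₀ := measurable_likelihoodOne_left h.measurable_mean
  rw [h.lintegral_eq_of_outcome (by fun_prop), ← h.lintegral_cov hd.ennreal_ofReal]
  refine lintegral_congr fun o => ?_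
  have a := h.mean_mem o.2.1 o.2.2
  have b := condMean_mem η o.2.1 o.2.2
  have key : ∀ u v D : ENNReal, u ≠ 0 → u ≠ ⊤ → u * (D * (v / u)) = D * v := fun u v D h0 ht => by
    rw [mul_left_comm, ENNReal.mul_div_cancel h0 ht]
  simp only [likelihoodOne, if_true, Bool.false_eq_true, if_false]
  rw [key _ _ _ (by simpa using a.1) (by simp), key _ _ _ (by simpa using a.2) (by simp), ← mul_add,
    ← ENNReal.ofReal_add b.1.le (by linarith), add_sub_cancel, ENNReal.ofReal_one, mul_one]

/-- Given the treatment and the covariates, the mean of the negative part of the likelihood ratio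
minus one is the total variation distance of two Bernoulli laws. -/
lemma lintegral_sub_likelihood_div_le (h : ObsModel P₀ F₀ π₀ m₀ c) {η : Bool → S → ℝ}
    (hη : ∀ d, Measurable (condMean η d)) :
    ∫⁻ o, (ENNReal.ofReal (likelihoodOne m₀ o) - ENNReal.ofReal (likelihoodOne (condMean η) o))
        / ENNReal.ofReal (likelihoodOne m₀ o) ∂P₀
      ≤ ∫⁻ x, ENNReal.ofReal (discrepancy (condMean η) m₀ x) ∂F₀ := by
  have hd : Measurable (discrepancy (condMean η) m₀) :=
    ((hη true).sub (h.measurable_mean true)).abs.add ((hη false).sub (h.measurable_mean false)).abs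
  have hl := measurable_likelihoodOne_left hη
  have hl₀ := measurable_likelihoodOne_left h.measurable_mean
  rw [h.lintegral_eq_of_outcome (by fun_prop), ← h.lintegral_cov hd.ennreal_ofReal]
  refine lintegral_mono fun o => ?_
  have a := h.mean_mem o.2.1 o.2.2
  have b := condMean_mem η o.2.1 o.2.2
  simp only [likelihoodOne, if_true, Bool.false_eq_true, if_false]
  rw [ENNReal.mul_div_cancel (by simpa using a.1) (by simp),
    ENNReal.mul_div_cancel (by simpa using a.2) (by simp), ← ENNReal.ofReal_sub _ b.1.le,
    ← ENNReal.ofReal_sub _ (by linarith)]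
  have hD := abs_sub_le_discrepancy (condMean η) m₀ o.2.1 o.2.2
  -- one of the two differences vanishes after truncation
  rcases le_total (condMean η o.2.1 o.2.2) (m₀ o.2.1 o.2.2) with g | g
  · rw [ENNReal.ofReal_of_nonpos (by linarith : 1 - m₀ o.2.1 o.2.2 - (1 - _) ≤ 0), add_zero]
    exact ENNReal.ofReal_le_ofReal (by linarith [neg_le_of_abs_le hD])
  · rw [ENNReal.ofReal_of_nonpos (by linarith : m₀ o.2.1 o.2.2 - _ ≤ 0), zero_add]
    exact ENNReal.ofReal_le_ofReal (by linarith [le_of_abs_le hD])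

/-- The posterior mean of the empirical discrepancy is small in mean, when the prior is supported by
parameters of small discrepancy in the population. -/
theorem lintegral_posterior_discrepancy_le (h : ObsModel P₀ F₀ π₀ m₀ c) {Z : Type*}
    [MeasurableSpace Z] {π : Measure Z} [IsFiniteMeasure π] {η : Z → Bool → S → ℝ}
    (hη : ∀ d, Measurable fun q : Z × S => condMean (η q.1) d q.2) {δ : ENNReal}
    (hδ : ∀ᵐ z ∂π, ∫⁻ x, ENNReal.ofReal (discrepancy (condMean (η z)) m₀ x) ∂F₀ ≤ δ)
    {n : ℕ} (hn : 0 < n) :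
    ∫⁻ o, (∫⁻ z, ENNReal.ofReal (likelihood (condMean (η z)) o)
          * ENNReal.ofReal (avg fun i => discrepancy (condMean (η z)) m₀ (o i).2.2) ∂π)
        / ∫⁻ z, ENNReal.ofReal (likelihood (condMean (η z)) o) ∂π
      ∂(Measure.pi fun _ : Fin n => P₀) ≤ 6 * δ := by
  have := h.prob_obs
  have hηz : ∀ z d, Measurable (condMean (η z) d) := fun z d => (hη d).comp measurable_prodMk_left
  have hL := (measurable_likelihoodOne (m := fun z => condMean (η z)) hη).ennreal_ofReal
  have hφ := ((measurable_discrepancy_prod (m := fun z => condMean (η z)) hη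
    h.measurable_mean).comp (by fun_prop :
      Measurable fun q : Z × Obs S => (q.1, q.2.2.2))).ennreal_ofReal
  have hl₀ := measurable_likelihoodOne_left h.measurable_mean
  have hL1 : ∀ z o, ENNReal.ofReal (likelihoodOne (condMean (η z)) o) ≤ 1 := fun z o => by
    have := condMean_mem (η z) o.2.1 o.2.2
    rw [ENNReal.ofReal_le_one]
    unfold likelihoodOne
    split_ifs <;> linarith
  have hL0 : ∀ o : Obs S, 0 < likelihoodOne m₀ o := fun o => by
    have := h.mean_mem o.2.1 o.2.2
    unfold likelihoodOne
    split_ifs <;> linarith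
  have hm1 : ∀ z (x : S), ENNReal.ofReal (discrepancy (condMean (η z)) m₀ x) ≤ 2 := fun z x => by
    have e : ∀ d, |condMean (η z) d x - m₀ d x| ≤ 1 := fun d => by
      have h1 := condMean_mem (η z) d x
      have h2 := h.mean_mem d x
      rw [abs_le]; constructor <;> linarith
    rw [← ENNReal.ofReal_ofNat]
    refine ENNReal.ofReal_le_ofReal ?_
    unfold discrepancy
    linarith [e true, e false]
  have havg := lintegral_iid_posterior_avg_le (π := π) (P := P₀)
    (L := fun z o => ENNReal.ofReal (likelihoodOne (condMean (η z)) o))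
    (φ := fun z o => ENNReal.ofReal (discrepancy (condMean (η z)) m₀ o.2.2))
    (L₀ := fun o => ENNReal.ofReal (likelihoodOne m₀ o)) hL hL1 hφ hl₀.ennreal_ofReal
    (fun z o => hm1 z o.2.2) (fun o => by simpa using hL0 o) (fun o => by simp) (δ := δ)
    (hδ.mono fun z hz => (h.lintegral_discrepancy_mul_ratio (hηz z)).le.trans hz)
    (hδ.mono fun z hz => (h.lintegral_sub_likelihood_div_le (hηz z)).trans hz) hn
  have hn' : (0 : ℝ) < n := by exact_mod_cast hn
  refine le_trans (le_of_eq (lintegral_congr fun o => ?_)) havg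
  have e : ∀ z, ENNReal.ofReal (avg fun i => discrepancy (condMean (η z)) m₀ (o i).2.2)
      = (n : ENNReal)⁻¹ * ∑ i, ENNReal.ofReal (discrepancy (condMean (η z)) m₀ (o i).2.2) :=
    fun z => by
      rw [avg, ENNReal.ofReal_div_of_pos hn', ENNReal.ofReal_natCast,
        ENNReal.ofReal_sum_of_nonneg fun i _ => discrepancy_nonneg _ _ _, div_eq_mul_inv, mul_comm]
  simp only [ofReal_likelihood, e]

end ObsModel

/-! ### The limit of the recentred posterior along a sequence of samples -/

section Limit

/-- The recentred draw is the normalised score, up to sign, plus the bootstrap fluctuation of the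
regression contrast and a term that does not depend on the parameter. -/
lemma sqrt_mul_recentered_eq {S : Type*} (π : S → ℝ) (m : Bool → S → ℝ) (χ : ℝ) {n : ℕ}
    (o : Fin n → Obs S) (η : Bool → S → ℝ) (w : Fin n → ℝ) :
    √(n : ℝ) * ((∑ i, w i * contrast (condMean η) (o i).2.2) - χ
        - recentering π m (condMean η) o)
      = -score (riesz π) o η + √(n : ℝ) * (empMean o (chiCorr π m) - χ)
        + √(n : ℝ) * (∑ i, w i * contrast (condMean η) (o i).2.2
          - avg fun i => contrast (condMean η) (o i).2.2) := by
  have e1 : recentering π m (condMean η) o = (avg fun i => contrast (condMean η) (o i).2.2)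
      + (avg fun i => riesz π (o i).2.1 (o i).2.2
        * (bit (o i).1 - condMean η (o i).2.1 (o i).2.2)) - empMean o (chiCorr π m) := by
    simp only [recentering, empMean, avg, chiCorr, Finset.sum_sub_distrib, Finset.sum_add_distrib]
    ring
  have e2 : score (riesz π) o η = √(n : ℝ) * avg fun i => riesz π (o i).2.1 (o i).2.2
        * (bit (o i).1 - condMean η (o i).2.1 (o i).2.2) := by
    rw [score, avg, mul_div_assoc', mul_div_right_comm, Real.sqrt_div_self', Finset.mul_sum]
    exact Finset.sum_congr rfl fun i _ => by ring
  rw [e1, e2]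
  ring

variable {S : Type*} {n : ℕ → ℕ} {Θ : ℕ → Type*} [∀ k, MeasurableSpace (Θ k)]

/-- The radius of `λ` is enlarged by `σ`, so that translations by `t / √n` stay within it; the tilt
is still negligible since `n σ² → ∞`. -/
lemma tendsto_laplaceError (hn : Tendsto n atTop atTop) {σ : ℕ → ℝ} (hσ : ∀ k, 0 < σ k)
    (hσn : Tendsto (fun k => (n k : ℝ) * σ k ^ 2) atTop atTop) {u κ : ℕ → ℝ}
    (hu : Tendsto u atTop (𝓝 0)) (hκ : Tendsto κ atTop (𝓝 0)) (M t : ℝ) :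
    Tendsto (fun k => laplaceError (n k) M (κ k) (u k * σ k ^ 2 * √(n k : ℝ) + σ k) (σ k) t) atTop
      (𝓝 0) := by
  have hsq : Tendsto (fun k => (√(n k : ℝ))⁻¹) atTop (𝓝 0) :=
    (Real.tendsto_sqrt_atTop.comp (tendsto_natCast_atTop_atTop.comp hn)).inv_tendsto_atTop
  have h3 : Tendsto (fun k => (√((n k : ℝ) * σ k ^ 2))⁻¹) atTop (𝓝 0) :=
    (Real.tendsto_sqrt_atTop.comp hσn).inv_tendsto_atTop
  have hlim : Tendsto (fun k => M ^ 2 * κ k * t ^ 2 / 2 + |t| ^ 3 * M ^ 3 * (√(n k : ℝ))⁻¹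
      + (|t| * (u k + (√((n k : ℝ) * σ k ^ 2))⁻¹)
        + |t| ^ 2 / 2 * (√((n k : ℝ) * σ k ^ 2))⁻¹ ^ 2)) atTop (𝓝 0) := by
    have h := ((((hκ.const_mul (M ^ 2)).mul_const (t ^ 2)).div_const 2).add
      (hsq.const_mul (|t| ^ 3 * M ^ 3))).add
        (((hu.add h3).const_mul |t|).add ((h3.pow 2).const_mul (|t| ^ 2 / 2)))
    simpa using h
  refine hlim.congr' ?_
  filter_upwards [hn.eventually_gt_atTop 0] with k hk
  have hk' : (0 : ℝ) < n k := by exact_mod_cast hk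
  have hs := hσ k
  have hq : 0 < √(n k : ℝ) := Real.sqrt_pos.2 hk'
  rw [laplaceError, Real.sqrt_mul hk'.le, Real.sqrt_sq hs.le]
  congr 1
  field_simp

/-- The posterior concentrates on the neighbourhoods even after they are shrunk by the effect of a
translation by `t / √n`, by Markov's inequality for the mean discrepancy. -/
lemma tendsto_wlPosterior_neighbourhood_compl (hn : Tendsto n atTop atTop)
    {PW : ∀ k, Measure (Θ k)} [∀ k, IsProbabilityMeasure (PW k)] {W : ∀ k, Θ k → Bool → S → ℝ}
    (hWm : ∀ k d x, Measurable fun θ => W k θ d x) {σ : ℕ → ℝ} (hσ : ∀ k, 0 < σ k)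
    (hσn : Tendsto (fun k => (n k : ℝ) * σ k ^ 2) atTop atTop) {γ : ℕ → Bool → S → ℝ}
    {o : ∀ k, Fin (n k) → Obs S} {m₀ : Bool → S → ℝ} {u : ℕ → ℝ}
    (hlam : Tendsto (fun k => (wlPosterior (PW k) (σ k) (W k) (γ k) (o k)).real
      {z | |z.2| ≤ u k * σ k ^ 2 * √(n k : ℝ)}) atTop (𝓝 1))
    {d : ℕ → ℝ} (hd : Tendsto d atTop (𝓝 0)) (hd0 : ∀ k, 0 ≤ d k)
    (hdisc : ∀ k, ∫⁻ z, ENNReal.ofReal (avg fun i =>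
        discrepancy (condMean (adjusted (γ k) (W k z.1) z.2)) m₀ (o k i).2.2)
        ∂(wlPosterior (PW k) (σ k) (W k) (γ k) (o k)) ≤ ENNReal.ofReal (d k)) (M t : ℝ) :
    Tendsto (fun k => wlPosterior (PW k) (σ k) (W k) (γ k) (o k)
      (neighbourhood (W k) (γ k) (o k) m₀ (u k * σ k ^ 2 * √(n k : ℝ) + σ k - |t| / √(n k : ℝ))
        (√(d k + 1 / (n k : ℝ)) + (√√(n k : ℝ))⁻¹ - 2 * M * (|t| / √(n k : ℝ))))ᶜ)
      atTop (𝓝 0) := by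
  have hninf : Tendsto (fun k => (n k : ℝ)) atTop atTop := tendsto_natCast_atTop_atTop.comp hn
  have hsinf := Real.tendsto_sqrt_atTop.comp hninf
  have hprob : ∀ k, IsProbabilityMeasure (wlPosterior (PW k) (σ k) (W k) (γ k) (o k)) :=
    fun k => isProbabilityMeasure_wlPosterior (hWm k)
  have hninv : Tendsto (fun k => 1 / (n k : ℝ)) atTop (𝓝 0) := by
    simp only [one_div]; exact hninf.inv_tendsto_atTop
  have hsqd : Tendsto (fun k => √(d k + 1 / (n k : ℝ))) atTop (𝓝 0) := by
    have := (hd.add hninv).sqrt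
    simpa using this
  have hlim : Tendsto (fun k => ENNReal.ofReal (1 -
      (wlPosterior (PW k) (σ k) (W k) (γ k) (o k)).real
        {z | |z.2| ≤ u k * σ k ^ 2 * √(n k : ℝ)})
      + ENNReal.ofReal (√(d k + 1 / (n k : ℝ)))) atTop (𝓝 0) := by
    have h1 := ENNReal.tendsto_ofReal (hlam.const_sub 1)
    have h2 := h1.add (ENNReal.tendsto_ofReal hsqd)
    simpa using h2
  refine tendsto_of_tendsto_of_tendsto_of_le_of_le' tendsto_const_nhds hlim
    (Eventually.of_forall fun _ => zero_le) ?_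
  -- the margins `σ` and `n^{-1/4}` exceed the shifts `|t| / √n` and `2 M |t| / √n` for large `n`;
  -- adding `1 / n` under the root makes the radius in the Markov inequality positive
  have hm1 : ∀ᶠ k in atTop, |t| / √(n k : ℝ) ≤ σ k := by
    filter_upwards [(Real.tendsto_sqrt_atTop.comp hσn).eventually_ge_atTop |t|,
      hn.eventually_gt_atTop 0] with k hk hnk
    have hk' : (0 : ℝ) < n k := by exact_mod_cast hnk
    have : √((n k : ℝ) * σ k ^ 2) = σ k * √(n k : ℝ) := by
      rw [Real.sqrt_mul hk'.le, Real.sqrt_sq (hσ k).le, mul_comm]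
    rw [div_le_iff₀ (Real.sqrt_pos.2 hk'), ← this]
    exact hk
  have hm2 : ∀ᶠ k in atTop, 2 * M * (|t| / √(n k : ℝ)) ≤ (√√(n k : ℝ))⁻¹ := by
    filter_upwards [(Real.tendsto_sqrt_atTop.comp hsinf).eventually_ge_atTop (2 * M * |t|),
      hn.eventually_gt_atTop 0] with k hk hnk
    have hk' : (0 : ℝ) < n k := by exact_mod_cast hnk
    have hq : 0 < √(n k : ℝ) := Real.sqrt_pos.2 hk'
    have hqq : 0 < √√(n k : ℝ) := Real.sqrt_pos.2 hq
    rw [← mul_div_assoc, div_le_iff₀ hq]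
    have e : (√√(n k : ℝ))⁻¹ * √(n k : ℝ) = √√(n k : ℝ) := by
      conv_lhs => rw [← Real.sq_sqrt hq.le]
      rw [sq, Real.sqrt_mul_self hqq.le]
      field_simp
    rw [e]
    exact hk
  filter_upwards [hm1, hm2, hn.eventually_gt_atTop 0] with k h1 h2 hnk
  have hk' : (0 : ℝ) < n k := by exact_mod_cast hnk
  have hq : 0 < d k + 1 / (n k : ℝ) := add_pos_of_nonneg_of_pos (hd0 k) (by positivity)
  set μ := wlPosterior (PW k) (σ k) (W k) (γ k) (o k) with hμ
  set q := √(d k + 1 / (n k : ℝ)) with hqdef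
  have hq0 : 0 < q := Real.sqrt_pos.2 hq
  set L : Set (Θ k × ℝ) := {z | |z.2| ≤ u k * σ k ^ 2 * √(n k : ℝ)} with hL
  have hLm : MeasurableSet L := measurableSet_le measurable_snd.abs measurable_const
  have hsub : (neighbourhood (W k) (γ k) (o k) m₀
      (u k * σ k ^ 2 * √(n k : ℝ) + σ k - |t| / √(n k : ℝ))
      (q + (√√(n k : ℝ))⁻¹ - 2 * M * (|t| / √(n k : ℝ))))ᶜ
      ⊆ Lᶜ ∪ {z | ENNReal.ofReal q ≤ ENNReal.ofReal (avg fun i =>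
        discrepancy (condMean (adjusted (γ k) (W k z.1) z.2)) m₀ (o k i).2.2)} := by
    intro z hz
    by_contra hcon
    rw [Set.mem_union, not_or] at hcon
    obtain ⟨c1, c2⟩ := hcon
    refine hz ⟨?_, ?_⟩
    · have : |z.2| ≤ u k * σ k ^ 2 * √(n k : ℝ) := not_not.1 c1
      linarith
    · have c3 : (avg fun i =>
          discrepancy (condMean (adjusted (γ k) (W k z.1) z.2)) m₀ (o k i).2.2) < q := by
        by_contra! h
        exact c2 (ENNReal.ofReal_le_ofReal h)
      linarith
  refine (measure_mono hsub).trans ((measure_union_le _ _).trans (add_le_add ?_ ?_))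
  · rw [← probReal_compl_eq_one_sub hLm, measureReal_def,
      ENNReal.ofReal_toReal (measure_ne_top _ _)]
  · refine (meas_ge_le_lintegral_div (measurable_avg_discrepancy (hWm k)
      m₀).ennreal_ofReal.aemeasurable (by simpa using hq0) ENNReal.ofReal_ne_top).trans ?_
    refine ENNReal.div_le_of_le_mul ?_
    rw [← ENNReal.ofReal_mul hq0.le, Real.mul_self_sqrt hq.le]
    exact (hdisc k).trans (ENNReal.ofReal_le_ofReal (by
      have : 0 ≤ 1 / (n k : ℝ) := by positivity
      linarith))

/-- The semiparametric Bernstein–von Mises theorem along a sequence of auxiliary and observed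
samples for which the finitely many random quantities that govern the limit converge. -/
theorem tendsto_blDist_recenteredPosterior (hn : Tendsto n atTop atTop)
    {PW : ∀ k, Measure (Θ k)} [∀ k, IsProbabilityMeasure (PW k)] {W : ∀ k, Θ k → Bool → S → ℝ}
    (hWm : ∀ k d x, Measurable fun θ => W k θ d x) {σ : ℕ → ℝ} (hσ : ∀ k, 0 < σ k)
    (hσn : Tendsto (fun k => (n k : ℝ) * σ k ^ 2) atTop atTop) {π : ℕ → S → ℝ}
    {m : ℕ → Bool → S → ℝ} {χ : ℕ → ℝ} {o : ∀ k, Fin (n k) → Obs S} {M : ℝ}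
    (hM : ∀ k i d, |riesz (π k) d (o k i).2.2| ≤ M) {m₀ : Bool → S → ℝ}
    (hm₀ : ∀ d x, 0 ≤ m₀ d x ∧ m₀ d x ≤ 1) {u : ℕ → ℝ} (hu : Tendsto u atTop (𝓝 0))
    (hlam : Tendsto (fun k => (wlPosterior (PW k) (σ k) (W k) (riesz (π k)) (o k)).real
      {z | |z.2| ≤ u k * σ k ^ 2 * √(n k : ℝ)}) atTop (𝓝 1))
    {d : ℕ → ℝ} (hd : Tendsto d atTop (𝓝 0)) (hd0 : ∀ k, 0 ≤ d k)
    (hdisc : ∀ k, ∫⁻ z, ENNReal.ofReal (avg fun i =>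
        discrepancy (condMean (adjusted (riesz (π k)) (W k z.1) z.2)) m₀ (o k i).2.2)
        ∂(wlPosterior (PW k) (σ k) (W k) (riesz (π k)) (o k)) ≤ ENNReal.ofReal (d k))
    {v₁ v₂ : ℝ} (hv₁ : 0 ≤ v₁)
    (hinfo : Tendsto (fun k => information (riesz (π k)) (o k) m₀) atTop (𝓝 v₁))
    (hv₂ : Tendsto (fun k => avg (fun i => contrast m₀ (o k i).2.2 ^ 2)
      - avg (fun i => contrast m₀ (o k i).2.2) ^ 2) atTop (𝓝 v₂))
    (hρ : Tendsto (fun k => √(n k : ℝ) * (empMean (o k) (chiCorr (π k) (m k)) - χ k)) atTop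
      (𝓝 0)) :
    Tendsto (fun k => blDist
        (recenteredPosterior (PW k) (σ k) (W k) (π k) (m k) (χ k) (o k))
        (gaussianReal 0 (v₁ + v₂).toNNReal)) atTop (𝓝 0) := by
  have hninf : Tendsto (fun k => (n k : ℝ)) atTop atTop := tendsto_natCast_atTop_atTop.comp hn
  have hsinf := Real.tendsto_sqrt_atTop.comp hninf
  let μ : ∀ k, Measure (Θ k × ℝ) := fun k => wlPosterior (PW k) (σ k) (W k) (riesz (π k)) (o k)
  have hprob : ∀ k, IsProbabilityMeasure (μ k) := fun k => isProbabilityMeasure_wlPosterior (hWm k)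
  let κ : ℕ → ℝ := fun k => √(d k + 1 / (n k : ℝ)) + (√√(n k : ℝ))⁻¹
  let b : ℕ → ℝ := fun k => u k * σ k ^ 2 * √(n k : ℝ) + σ k
  let G : ∀ k, Set (Θ k × ℝ) := fun k => neighbourhood (W k) (riesz (π k)) (o k) m₀ (b k) (κ k)
  have hκ : Tendsto κ atTop (𝓝 0) := by
    have h1 : Tendsto (fun k => 1 / (n k : ℝ)) atTop (𝓝 0) := by
      simp only [one_div]; exact hninf.inv_tendsto_atTop
    have h2 := (hd.add h1).sqrt.add (Real.tendsto_sqrt_atTop.comp hsinf).inv_tendsto_atTop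
    rw [add_zero, add_zero, Real.sqrt_zero] at h2
    exact h2
  have hcompl := tendsto_wlPosterior_neighbourhood_compl hn hWm hσ hσn hlam hd hd0 hdisc M
  have hG1 : Tendsto (fun k => μ k (G k)ᶜ) atTop (𝓝 0) := by
    simpa only [abs_zero, zero_div, mul_zero, sub_zero] using hcompl 0
  have hlap : ∀ t : ℝ, Tendsto (fun k => ∫⁻ z in G k, ENNReal.ofReal (Real.exp
      (t * (-score (riesz (π k)) (o k) (adjusted (riesz (π k)) (W k z.1) z.2)))) ∂(μ k))
      atTop (𝓝 (ENNReal.ofReal (Real.exp (v₁ * t ^ 2 / 2)))) := fun t => by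
    have herr := tendsto_laplaceError hn hσ hσn hu hκ M t
    have hI := (hinfo.mul_const (t ^ 2)).div_const 2
    have hup := ENNReal.tendsto_ofReal ((Real.continuous_exp.tendsto _).comp (hI.add herr))
    have hlo := ENNReal.tendsto_ofReal ((Real.continuous_exp.tendsto _).comp (hI.sub herr))
    rw [add_zero] at hup
    rw [sub_zero] at hlo
    have hmass : Tendsto (fun k => μ k (neighbourhood (W k) (riesz (π k)) (o k) m₀
        (b k - |t| / √(n k : ℝ)) (κ k - 2 * M * (|t| / √(n k : ℝ))))) atTop (𝓝 1) := by
      have := ENNReal.Tendsto.sub (tendsto_const_nhds (x := (1 : ENNReal))) (hcompl t)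
        (Or.inl ENNReal.one_ne_top)
      rw [tsub_zero] at this
      refine this.congr fun k => ?_
      rw [← prob_compl_eq_one_sub (measurableSet_neighbourhood (hWm k) m₀ _ _).compl, compl_compl]
    have hlo' := ENNReal.Tendsto.mul hlo (Or.inr ENNReal.one_ne_top) hmass
      (Or.inr ENNReal.ofReal_ne_top)
    rw [mul_one] at hlo'
    refine tendsto_of_tendsto_of_tendsto_of_le_of_le' hlo' hup ?_ ?_
    · filter_upwards [hn.eventually_gt_atTop 0] with k hk
      exact le_lintegral_exp_score (hσ k) (hWm k) (hM k) hm₀ hk t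
    · filter_upwards [hn.eventually_gt_atTop 0] with k hk
      exact lintegral_exp_score_le (hσ k) (hWm k) (hM k) hm₀ hk t
  have hcb : ∀ m : Bool → S → ℝ, (∀ d x, 0 ≤ m d x ∧ m d x ≤ 1) → ∀ x, |contrast m x| ≤ 1 :=
    fun m hm x => by
      have h1 := hm true x
      have h2 := hm false x
      rw [contrast, abs_le]; constructor <;> linarith
  have hmain := tendsto_blDist_bootstrap hn μ
    (S := fun k z => -score (riesz (π k)) (o k) (adjusted (riesz (π k)) (W k z.1) z.2))
    (fun k => (measurable_score (hWm k)).neg)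
    (c := fun k z i => contrast (condMean (adjusted (riesz (π k)) (W k z.1) z.2)) (o k i).2.2)
    (fun k i => (measurable_condMean_adjusted (hWm k) _ _).sub
      (measurable_condMean_adjusted (hWm k) _ _))
    (fun k z i => hcb _ (fun d x => ⟨(condMean_mem _ d x).1.le, (condMean_mem _ d x).2.le⟩) _)
    (f := fun k i => contrast m₀ (o k i).2.2) (fun k i => hcb _ hm₀ _) hv₂ hρ
    (fun k => measurableSet_neighbourhood (hWm k) m₀ (b k) (κ k)) hG1 hκ
    (fun k z hz => (avg_le_avg fun i => abs_contrast_sub_le _ _ _).trans hz.2) hv₁ hlap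
  refine hmain.congr fun k => ?_
  congr 2
  funext q
  exact (sqrt_mul_recentered_eq (π k) (m k) (χ k) (o k) _ q.2).symm

end Limit

/-! ### Convergence in probability -/

section InProbability

variable {T : ℕ → Type*} [∀ n, MeasurableSpace (T n)] {P : ∀ n, Measure (T n)}

lemma Vanishing.mono {B B' : ∀ n, Set (T n)} (h : Vanishing P B') (hB : ∀ n, B n ⊆ B' n) :
    Vanishing P B :=
  tendsto_of_tendsto_of_tendsto_of_le_of_le tendsto_const_nhds h (fun _ => zero_le)
    fun n => measure_mono (hB n)

lemma Vanishing.union {B B' : ∀ n, Set (T n)} (h : Vanishing P B) (h' : Vanishing P B') :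
    Vanishing P fun n => B n ∪ B' n := by
  have := Tendsto.add h h'
  rw [add_zero] at this
  exact tendsto_of_tendsto_of_tendsto_of_le_of_le tendsto_const_nhds this (fun _ => zero_le)
    fun n => measure_union_le _ _

lemma TendstoInProb.abs_add_abs {f g : ∀ n, T n → ℝ} {c d : ℝ} (hf : TendstoInProb P f c)
    (hg : TendstoInProb P g d) : TendstoInProb P (fun n s => |f n s - c| + |g n s - d|) 0 := by
  intro δ hδ
  refine ((hf (δ / 2) (by positivity)).union (hg (δ / 2) (by positivity))).mono fun n s hs => ?_
  have hs' : δ ≤ |f n s - c| + |g n s - d| := by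
    have : δ ≤ |(|f n s - c| + |g n s - d|) - 0| := hs
    rwa [sub_zero, abs_of_nonneg (by positivity)] at this
  by_contra hcon
  rw [Set.mem_union, not_or] at hcon
  have h1 : ¬ δ / 2 ≤ |f n s - c| := hcon.1
  have h2 : ¬ δ / 2 ≤ |g n s - d| := hcon.2
  linarith

lemma exists_ofReal_le_half {τ : ENNReal} (hτ : 0 < τ) :
    ∃ τ' : ℝ, 0 < τ' ∧ ENNReal.ofReal τ' ≤ τ / 2 := by
  rcases eq_or_ne τ ⊤ with rfl | ht
  · exact ⟨1, one_pos, by simp [ENNReal.top_div_of_ne_top]⟩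
  · refine ⟨(τ / 2).toReal, ENNReal.toReal_pos ?_ ?_, ENNReal.ofReal_toReal_le⟩
    · exact (ENNReal.half_pos hτ.ne').ne'
    · exact ENNReal.div_ne_top ht two_ne_zero

/-- Selection principle: convergence in probability of `f` follows if `f` converges along all
sequences of points at which `g` converges and a tight quantity stays bounded. -/
lemma tendstoInProb_of_selection {f g : ∀ n, T n → ℝ} {bdd : ∀ n, T n → ℝ → Prop}
    (hg : TendstoInProb P g 0) (hb : BoundedInProb P bdd)
    (h : ∀ (M : ℝ) (n : ℕ → ℕ) (s : ∀ k, T (n k)), Tendsto n atTop atTop →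
      Tendsto (fun k => g (n k) (s k)) atTop (𝓝 0) → (∀ k, bdd (n k) (s k) M) →
      Tendsto (fun k => f (n k) (s k)) atTop (𝓝 0)) : TendstoInProb P f 0 := by
  intro δ hδ
  refine ENNReal.tendsto_nhds_zero.2 fun τ hτ => ?_
  obtain ⟨τ', hτ'0, hτ'⟩ := exists_ofReal_le_half hτ
  obtain ⟨M, hM⟩ := hb τ' hτ'0
  have key : ∃ η : ℝ, 0 < η ∧ ∃ N, ∀ n ≥ N, ∀ s, |g n s| < η → bdd n s M → |f n s| < δ := by
    by_contra! hcon
    choose n hn s hs hbs hfs using fun k : ℕ => hcon (1 / ((k : ℝ) + 1)) (by positivity) k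
    have h1 : Tendsto n atTop atTop := tendsto_atTop_mono hn tendsto_id
    have h2 : Tendsto (fun k => g (n k) (s k)) atTop (𝓝 0) :=
      squeeze_zero_norm (fun k => (hs k).le) tendsto_one_div_add_atTop_nhds_zero_nat
    have h3 := (h M n s h1 h2 hbs).abs
    rw [abs_zero] at h3
    obtain ⟨k, hk⟩ := (h3.eventually_lt_const hδ).exists
    exact absurd (hfs k) (not_le.2 hk)
  obtain ⟨η, hη, N, hN⟩ := key
  have hg' := ENNReal.tendsto_nhds_zero.1 (hg η hη) (τ / 2) (ENNReal.half_pos hτ.ne')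
  filter_upwards [hM, hg', eventually_ge_atTop N] with n h1 h2 h3
  calc P n {s | δ ≤ |f n s - 0|}
      ≤ P n ({s | η ≤ |g n s - 0|} ∪ {s | ¬ bdd n s M}) := measure_mono fun s hs => by
        by_contra hcon
        rw [Set.mem_union, not_or] at hcon
        obtain ⟨c1, c2⟩ := hcon
        have c1' : ¬ η ≤ |g n s - 0| := c1
        have c2' : bdd n s M := not_not.1 c2
        rw [sub_zero] at c1'
        have hs' : δ ≤ |f n s - 0| := hs
        rw [sub_zero] at hs'
        exact absurd (hN n h3 s (not_le.1 c1') c2') (not_lt.2 hs')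
    _ ≤ _ := measure_union_le _ _
    _ ≤ τ / 2 + τ / 2 := add_le_add h2 (h1.trans hτ')
    _ = τ := ENNReal.add_halves τ

end InProbability

/-! ### Events that depend on the auxiliary and the observed sample -/

section Sampling

variable {A : ℕ → Type*} [∀ n, MeasurableSpace (A n)] {Q : ∀ n, Measure (A n)}
  {E : Type*} [MeasurableSpace E] {P₀ : Measure E} [IsProbabilityMeasure P₀]

lemma vanishing_sampling_of_fst {N : ∀ n, Set (A n)} (h : Vanishing Q N) :
    Vanishing (sampling Q P₀) fun n => {s | s.1 ∈ N n} := by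
  refine Tendsto.congr (fun n => ?_) h
  have e : {s : A n × (Fin n → E) | s.1 ∈ N n} = N n ×ˢ Set.univ := by ext; simp
  simp only [sampling, e, Measure.prod_prod, measure_univ, mul_one]

variable [∀ n, IsProbabilityMeasure (Q n)]

/-- A bound of the conditional probability given the auxiliary sample, outside an event of small
outer probability. -/
lemma sampling_le {n : ℕ} {B : Set (A n × (Fin n → E))} (hB : MeasurableSet B) (N : Set (A n))
    {b : ENNReal} (h : ∀ a ∉ N, (Measure.pi fun _ : Fin n => P₀) {o | (a, o) ∈ B} ≤ b) :
    sampling Q P₀ n B ≤ Q n N + b := by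
  rw [sampling, Measure.prod_apply hB]
  calc _ ≤ ∫⁻ a, ((toMeasurable (Q n) N).indicator (fun _ => 1) a + b) ∂(Q n) := by
        refine lintegral_mono fun a => ?_
        by_cases ha : a ∈ toMeasurable (Q n) N
        · rw [Set.indicator_of_mem ha]
          exact prob_le_one.trans le_self_add
        · rw [Set.indicator_of_notMem ha, zero_add]
          exact h a fun h' => ha (subset_toMeasurable _ _ h')
    _ = Q n N + b := by
        rw [lintegral_add_right _ measurable_const, lintegral_indicator
          (measurableSet_toMeasurable _ _)]
        simp

/-- Reduction to auxiliary samples that are good with a fixed constant `M`. -/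
lemma vanishing_sampling_of_bounded {good : ∀ n, A n → ℝ → Prop} (hgood : BoundedInProb Q good)
    {B : ∀ n, Set (A n × (Fin n → E))} (hB : ∀ n, MeasurableSet (B n))
    (h : ∀ M : ℝ, ∃ b : ℕ → ℝ, Tendsto b atTop (𝓝 0) ∧ ∀ᶠ n in atTop, ∀ a, good n a M →
      (Measure.pi fun _ : Fin n => P₀) {o | (a, o) ∈ B n} ≤ ENNReal.ofReal (b n)) :
    Vanishing (sampling Q P₀) B := by
  refine ENNReal.tendsto_nhds_zero.2 fun τ hτ => ?_
  obtain ⟨τ', hτ'0, hτ'⟩ := exists_ofReal_le_half hτ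
  obtain ⟨M, hM⟩ := hgood τ' hτ'0
  obtain ⟨b, hb, hbn⟩ := h M
  filter_upwards [hM, hbn, hb.eventually_lt_const hτ'0] with n h1 h2 h3
  calc _ ≤ Q n {a | ¬ good n a M} + ENNReal.ofReal (b n) :=
        sampling_le (hB n) _ fun a ha => h2 a (not_not.1 ha)
    _ ≤ τ / 2 + τ / 2 :=
        add_le_add (h1.trans hτ') ((ENNReal.ofReal_le_ofReal h3.le).trans hτ')
    _ = τ := ENNReal.add_halves τ

/-- Chebyshev's inequality for the empirical process. -/
lemma measure_empProcess_ge_le {n : ℕ} (hn : 0 < n) {h : E → ℝ} (hh : MemLp h 2 P₀) {K τ : ℝ}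
    (hK : ∫ x, h x ^ 2 ∂P₀ ≤ K) (hτ : 0 < τ) :
    (Measure.pi fun _ : Fin n => P₀) {o | τ ≤ |(empProcess P₀ o h)|}
      ≤ ENNReal.ofReal (K / τ ^ 2) := by
  have hn' : (0 : ℝ) < n := by exact_mod_cast hn
  have hs := integral_sq_weighted_sum P₀ hh (fun _ : Fin n => (√(n : ℝ))⁻¹)
  have e : ∀ o : Fin n → E, ∑ i, (h (o i) - ∫ x, h x ∂P₀) * (√(n : ℝ))⁻¹ = empProcess P₀ o h := by
    intro o
    rw [← Finset.sum_mul, Finset.sum_sub_distrib, empProcess, empMean]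
    have hq : √(n : ℝ) ≠ 0 := (Real.sqrt_pos.2 hn').ne'
    have hqq : (n : ℝ) = √(n : ℝ) * √(n : ℝ) := (Real.mul_self_sqrt hn'.le).symm
    simp only [Finset.sum_const, Finset.card_univ, Fintype.card_fin, nsmul_eq_mul]
    rw [mul_sub, sub_mul, mul_div_assoc', mul_div_right_comm, Real.sqrt_div_self']
    congr 1
    · rw [one_div, mul_comm]
    · field_simp
      rw [Real.sq_sqrt hn'.le, mul_comm]
  simp only [e] at hs
  refine measure_abs_ge_le _ hτ hs.1 (hs.2.le.trans ?_)
  have hsum : ∑ _i : Fin n, (√(n : ℝ))⁻¹ ^ 2 = 1 := by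
    simp [Real.sq_sqrt hn'.le, hn'.ne']
  rw [hsum, mul_one, variance_eq_sub hh]
  have : 0 ≤ (P₀[h]) ^ 2 := sq_nonneg _
  have e2 : P₀[h ^ 2] = ∫ x, h x ^ 2 ∂P₀ := rfl
  linarith

/-- The weak law of large numbers with a rate, by Chebyshev's inequality. -/
lemma measure_empMean_sub_ge_le {n : ℕ} (hn : 0 < n) {h : E → ℝ} (hh : MemLp h 2 P₀) {K τ : ℝ}
    (hK : ∫ x, h x ^ 2 ∂P₀ ≤ K) (hτ : 0 < τ) :
    (Measure.pi fun _ : Fin n => P₀) {o | τ ≤ |empMean o h - ∫ x, h x ∂P₀|}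
      ≤ ENNReal.ofReal (K / τ ^ 2 * (n : ℝ)⁻¹) := by
  have hn' : (0 : ℝ) < n := by exact_mod_cast hn
  have hq := Real.sqrt_pos.2 hn'
  refine le_trans (measure_mono fun o ho => ?_)
    ((measure_empProcess_ge_le hn hh hK (mul_pos hq hτ)).trans (le_of_eq ?_))
  · change _ ≤ |(empProcess P₀ o h)|
    rw [empProcess, abs_mul, abs_of_pos hq]
    exact mul_le_mul_of_nonneg_left ho hq.le
  · rw [mul_pow, Real.sq_sqrt hn'.le]
    congr 1
    field_simp

end Sampling

/-! ### Joint measurability in the samples and the parameter -/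

section Measurability

variable {T S : Type*} [MeasurableSpace T] [MeasurableSpace S]

lemma measurable_apply_obs {f : T → Bool → S → ℝ}
    (hf : ∀ d, Measurable fun q : T × S => f q.1 d q.2) :
    Measurable fun q : T × Obs S => f q.1 q.2.2.1 q.2.2.2 := by
  have h : Measurable fun w : Bool × (T × S) => f w.2.1 w.1 w.2.2 :=
    measurable_from_prod_countable_right hf
  exact h.comp (by fun_prop : Measurable fun q : T × Obs S => (q.2.2.1, (q.1, q.2.2.2)))

lemma measurable_riesz_prod {π : T → S → ℝ} (h : Measurable fun q : T × S => π q.1 q.2) (d : Bool) :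
    Measurable fun q : T × S => riesz (π q.1) d q.2 := by
  unfold riesz
  exact (measurable_const.div h).sub (measurable_const.div (h.const_sub 1))

lemma measurable_chiCorr_prod {π : T → S → ℝ} {m : T → Bool → S → ℝ}
    (hπ : Measurable fun q : T × S => π q.1 q.2)
    (hm : ∀ d, Measurable fun q : T × S => m q.1 d q.2) :
    Measurable fun q : T × Obs S => chiCorr (π q.1) (m q.1) q.2 := by
  have h1 := measurable_apply_obs hm
  have h2 := measurable_apply_obs (f := fun t => riesz (π t)) (measurable_riesz_prod hπ)
  have h3 : Measurable bit := measurable_of_finite _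
  have h4 : Measurable fun q : T × S => contrast (m q.1) q.2 := (hm true).sub (hm false)
  unfold chiCorr
  exact (h4.comp (by fun_prop : Measurable fun q : T × Obs S => (q.1, q.2.2.2))).add
    (h2.mul ((h3.comp (by fun_prop : Measurable fun q : T × Obs S => q.2.1)).sub h1))

lemma measurable_avg_apply {E : Type*} [MeasurableSpace E] {f : T → E → ℝ}
    (hf : Measurable fun q : T × E => f q.1 q.2) (n : ℕ) :
    Measurable fun q : T × (Fin n → E) => avg fun i => f q.1 (q.2 i) := by
  refine measurable_avg.comp (measurable_pi_lambda _ fun i => ?_)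
  exact hf.comp (by fun_prop : Measurable fun q : T × (Fin n → E) => (q.1, q.2 i))

lemma measurable_likelihood_prod {m : T → Bool → S → ℝ}
    (hm : ∀ d, Measurable fun q : T × S => m q.1 d q.2) (n : ℕ) :
    Measurable fun q : T × (Fin n → Obs S) => likelihood (m q.1) q.2 := by
  refine Finset.measurable_fun_prod _ fun i _ => ?_
  exact (measurable_likelihoodOne hm).comp
    (by fun_prop : Measurable fun q : T × (Fin n → Obs S) => (q.1, q.2 i))

lemma measurable_information_prod {π : T → S → ℝ} {m₀ : Bool → S → ℝ}
    (hπ : Measurable fun q : T × S => π q.1 q.2) (hm₀ : ∀ d, Measurable (m₀ d)) (n : ℕ) :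
    Measurable fun s : T × (Fin n → Obs S) => information (riesz (π s.1)) s.2 m₀ := by
  have h3 : Measurable fun q : T × Obs S => m₀ q.2.2.1 q.2.2.2 :=
    (measurable_uncurry_bool hm₀).comp (measurable_snd.comp measurable_snd)
  have h4 := measurable_apply_obs (f := fun a => riesz (π a)) (measurable_riesz_prod hπ)
  have h1 : Measurable fun q : T × Obs S => riesz (π q.1) q.2.2.1 q.2.2.2 ^ 2
      * (m₀ q.2.2.1 q.2.2.2 * (1 - m₀ q.2.2.1 q.2.2.2)) :=
    (h4.pow_const 2).mul (h3.mul (h3.const_sub 1))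
  exact measurable_avg_apply (f := fun a (o : Obs S) =>
    riesz (π a) o.2.1 o.2.2 ^ 2 * (m₀ o.2.1 o.2.2 * (1 - m₀ o.2.1 o.2.2))) h1 n

end Measurability

/-! ### The random quantities that govern the limit -/

lemma memLp_two_of_bound {E : Type*} [MeasurableSpace E] {P₀ : Measure E} [IsProbabilityMeasure P₀]
    {h : E → ℝ} (hm : Measurable h) {K : ℝ} (hK : ∀ᵐ x ∂P₀, |h x| ≤ K) :
    MemLp h 2 P₀ ∧ ∫ x, h x ^ 2 ∂P₀ ≤ K ^ 2 := by
  refine ⟨MemLp.of_bound hm.aestronglyMeasurable K hK, ?_⟩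
  calc _ ≤ ∫ _, K ^ 2 ∂P₀ := by
        refine integral_mono_of_nonneg (Eventually.of_forall fun x => sq_nonneg _)
          (integrable_const _) ?_
        filter_upwards [hK] with x hx
        rw [← sq_abs (h x)]
        exact pow_le_pow_left₀ (abs_nonneg _) hx 2
    _ = K ^ 2 := by simp

section RandomQuantities

variable {S : Type*} [MeasurableSpace S] {P₀ : Measure (Obs S)} {F₀ : Measure S} {π₀ : S → ℝ}
  {m₀ : Bool → S → ℝ} {c : ℝ} {A : ℕ → Type*} [∀ n, MeasurableSpace (A n)] {Q : ∀ n, Measure (A n)}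
  {π : ∀ n, A n → S → ℝ} {m : ∀ n, A n → Bool → S → ℝ} {r ε : ℕ → ℝ}

/-- The rates and the bound of the Riesz representor hold simultaneously, with a constant that is
bounded in probability. -/
lemma boundedInProb_goodPilot (hπm : ∀ n, Measurable fun q : A n × S => π n q.1 q.2)
    (hπ : ∀ n a x, 0 < π n a x ∧ π n a x < 1)
    (hmm : ∀ n d, Measurable fun q : A n × S => m n q.1 d q.2)
    (hπr : Vanishing Q fun n =>
      {a | ¬ eLpNorm (fun x => π n a x - π₀ x) 2 F₀ ≤ ENNReal.ofReal (r n)})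
    (hmr : Vanishing Q fun n =>
      {a | ¬ ∀ d, eLpNorm (fun x => m n a d x - m₀ d x) 2 F₀ ≤ ENNReal.ofReal (ε n)})
    (hb : BoundedInProb Q fun n a M => ∀ d, ∀ᵐ x ∂F₀, |riesz (π n a) d x| ≤ M) :
    BoundedInProb Q fun n a M => GoodPilot F₀ π₀ m₀ (π n a) (m n a) M (r n) (ε n) := by
  intro τ hτ
  obtain ⟨M, hM⟩ := hb (τ / 2) (by positivity)
  refine ⟨M, ?_⟩
  have hu := ENNReal.tendsto_nhds_zero.1 (hπr.union hmr) (ENNReal.ofReal (τ / 2))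
    (by simpa using hτ)
  filter_upwards [hM, hu] with n h1 h2
  calc _ ≤ Q n ({a | ¬ ∀ d, ∀ᵐ x ∂F₀, |riesz (π n a) d x| ≤ M} ∪
        ({a | ¬ eLpNorm (fun x => π n a x - π₀ x) 2 F₀ ≤ ENNReal.ofReal (r n)} ∪
        {a | ¬ ∀ d, eLpNorm (fun x => m n a d x - m₀ d x) 2 F₀ ≤ ENNReal.ofReal (ε n)})) := by
        refine measure_mono fun a ha => ?_
        by_contra hcon
        simp only [Set.mem_union, Set.mem_ofPred_eq, not_or, not_not] at hcon
        exact ha ⟨(hπm n).comp measurable_prodMk_left,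
          fun d => (hmm n d).comp measurable_prodMk_left, hπ n a, ae_all_iff.2 hcon.1, hcon.2.1,
          hcon.2.2⟩
    _ ≤ _ := measure_union_le _ _
    _ ≤ ENNReal.ofReal (τ / 2) + ENNReal.ofReal (τ / 2) := add_le_add h1 h2
    _ = ENNReal.ofReal τ := by
        rw [← ENNReal.ofReal_add (by positivity) (by positivity), add_halves]

variable [∀ n, IsProbabilityMeasure (Q n)]

/-- The law of large numbers for a bounded function of the covariates. -/
lemma tendstoInProb_avg_cov (h₀ : ObsModel P₀ F₀ π₀ m₀ c) {h : S → ℝ} (hm : Measurable h)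
    (h1 : ∀ x, |h x| ≤ 1) :
    TendstoInProb (sampling Q P₀) (fun _ s => avg fun i => h (s.2 i).2.2) (∫ x, h x ∂F₀) := by
  have := h₀.prob_obs
  intro δ hδ
  have hm' : Measurable fun o : Obs S => h o.2.2 := by fun_prop
  have hl := memLp_two_of_bound (P₀ := P₀) hm' (Eventually.of_forall fun o => h1 o.2.2)
  have htriv : BoundedInProb Q fun _ _ _ => True := fun τ _ => ⟨0, by simp⟩
  refine vanishing_sampling_of_bounded htriv (fun n => ?_) fun M =>
    ⟨fun n => 1 ^ 2 / δ ^ 2 * (n : ℝ)⁻¹, ?_, ?_⟩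
  · have : Measurable fun s : A n × (Fin n → Obs S) => avg fun i => h (s.2 i).2.2 :=
      measurable_avg_apply (f := fun _ (o : Obs S) => h o.2.2) (by fun_prop) n
    exact measurableSet_le measurable_const (this.sub_const _).abs
  · have := (tendsto_inv_atTop_nhds_zero_nat (𝕜 := ℝ)).const_mul (1 ^ 2 / δ ^ 2)
    rwa [mul_zero] at this
  · filter_upwards [eventually_gt_atTop 0] with n hn a _
    rw [← h₀.integral_cov hm]
    exact measure_empMean_sub_ge_le hn hl.1 hl.2 hδ

/-- The empirical information converges to the information term of the efficient variance. -/
lemma tendstoInProb_information (h₀ : ObsModel P₀ F₀ π₀ m₀ c)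
    (hgood : BoundedInProb Q fun n a M => GoodPilot F₀ π₀ m₀ (π n a) (m n a) M (r n) (ε n))
    (hπm : ∀ n, Measurable fun q : A n × S => π n q.1 q.2) (hr : Tendsto r atTop (𝓝 0)) :
    TendstoInProb (sampling Q P₀) (fun n s => information (riesz (π n s.1)) s.2 m₀)
      (∫ o, riesz π₀ o.2.1 o.2.2 ^ 2 * (m₀ o.2.1 o.2.2 * (1 - m₀ o.2.1 o.2.2)) ∂P₀) := by
  have := h₀.prob_obs
  intro δ hδ
  have hm₀ : Measurable fun o : Obs S => m₀ o.2.1 o.2.2 :=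
    (measurable_uncurry_bool h₀.measurable_mean).comp measurable_snd
  refine vanishing_sampling_of_bounded hgood (fun n => ?_) fun M =>
    ⟨fun n => (M ^ 2) ^ 2 / (δ / 2) ^ 2 * (n : ℝ)⁻¹, ?_, ?_⟩
  · have h2 := measurable_information_prod (hπm n) h₀.measurable_mean n
    exact measurableSet_le measurable_const (h2.sub_const _).abs
  · have := (tendsto_inv_atTop_nhds_zero_nat (𝕜 := ℝ)).const_mul ((M ^ 2) ^ 2 / (δ / 2) ^ 2)
    rwa [mul_zero] at this
  · have hsmall : ∀ᶠ n in atTop, (M + 1 / c) * (M / c) * |r n| < δ / 2 := by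
      have := hr.abs.const_mul ((M + 1 / c) * (M / c))
      rw [abs_zero, mul_zero] at this
      exact this.eventually_lt_const (by positivity)
    filter_upwards [eventually_gt_atTop 0, hsmall] with n hn hs a ha
    have hb := ha.abs_integral_information_sub_le h₀
    set v := ∫ o, riesz π₀ o.2.1 o.2.2 ^ 2 * (m₀ o.2.1 o.2.2 * (1 - m₀ o.2.1 o.2.2)) ∂P₀
    let h : Obs S → ℝ := fun o =>
      riesz (π n a) o.2.1 o.2.2 ^ 2 * (m₀ o.2.1 o.2.2 * (1 - m₀ o.2.1 o.2.2))
    have hh : Measurable h := by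
      have : Measurable fun o : Obs S => riesz (π n a) o.2.1 o.2.2 :=
        (measurable_uncurry_bool fun d => measurable_riesz ha.measurable_prop d).comp measurable_snd
      exact (this.pow_const 2).mul (hm₀.mul (hm₀.const_sub 1))
    have hK : ∀ᵐ o ∂P₀, |h o| ≤ M ^ 2 := by
      filter_upwards [h₀.ae_cov ha.riesz_le] with o ho
      have hw := h₀.mean_mem o.2.1 o.2.2
      have hw0 : 0 ≤ m₀ o.2.1 o.2.2 * (1 - m₀ o.2.1 o.2.2) := by nlinarith
      have hw1 : m₀ o.2.1 o.2.2 * (1 - m₀ o.2.1 o.2.2) ≤ 1 := by nlinarith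
      simp only [h]
      rw [abs_mul, abs_of_nonneg hw0, abs_pow]
      calc _ ≤ M ^ 2 * 1 := by gcongr; exact ho _
        _ = M ^ 2 := mul_one _
    have hl := memLp_two_of_bound hh hK
    refine le_trans (measure_mono fun o ho => ?_)
      (measure_empMean_sub_ge_le hn hl.1 hl.2 (half_pos hδ))
    have ho' : δ ≤ |information (riesz (π n a)) o m₀ - v| := ho
    have e : information (riesz (π n a)) o m₀ = empMean o h := rfl
    have := abs_sub_le (empMean o h) (∫ o, h o ∂P₀) v
    rw [e] at ho'
    change δ / 2 ≤ |empMean o h - ∫ o, h o ∂P₀|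
    linarith

/-- The pilot correction is asymptotically equivalent to the efficient one. -/
lemma tendstoInProb_pilot_correction (h₀ : ObsModel P₀ F₀ π₀ m₀ c)
    (hgood : BoundedInProb Q fun n a M => GoodPilot F₀ π₀ m₀ (π n a) (m n a) M (r n) (ε n))
    (hπm : ∀ n, Measurable fun q : A n × S => π n q.1 q.2)
    (hmm : ∀ n d, Measurable fun q : A n × S => m n q.1 d q.2) (hr : Tendsto r atTop (𝓝 0))
    (hε : Tendsto ε atTop (𝓝 0))
    (hrε : Tendsto (fun n : ℕ => √(n : ℝ) * ε n * r n) atTop (𝓝 0)) :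
    TendstoInProb (sampling Q P₀) (fun n s => √(n : ℝ) *
      empMean s.2 fun o => chiCorr (π n s.1) (m n s.1) o - chiCorr π₀ m₀ o) 0 := by
  have := h₀.prob_obs
  intro δ hδ
  refine vanishing_sampling_of_bounded hgood (fun n => ?_) fun M =>
    ⟨fun n => (8 * (1 + M) ^ 2 * ε n ^ 2 + 2 * (M / c) ^ 2 * r n ^ 2) / (δ / 2) ^ 2, ?_, ?_⟩
  · have h1 : Measurable fun q : A n × Obs S =>
        chiCorr (π n q.1) (m n q.1) q.2 - chiCorr π₀ m₀ q.2 :=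
      (measurable_chiCorr_prod (hπm n) (hmm n)).sub
        ((measurable_chiCorr h₀.measurable_prop h₀.measurable_mean).comp measurable_snd)
    have h2 : Measurable fun s : A n × (Fin n → Obs S) =>
        empMean s.2 fun o => chiCorr (π n s.1) (m n s.1) o - chiCorr π₀ m₀ o :=
      measurable_avg_apply (f := fun a o => chiCorr (π n a) (m n a) o - chiCorr π₀ m₀ o) h1 n
    exact measurableSet_le measurable_const ((h2.const_mul _).sub_const _).abs
  · have := (((hε.pow 2).const_mul (8 * (1 + M) ^ 2)).add
      ((hr.pow 2).const_mul (2 * (M / c) ^ 2))).div_const ((δ / 2) ^ 2)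
    simpa using this
  · have hsmall : ∀ᶠ n : ℕ in atTop, 2 * M * |√(n : ℝ) * ε n * r n| < δ / 2 := by
      have := hrε.abs.const_mul (2 * M)
      rw [abs_zero, mul_zero] at this
      exact this.eventually_lt_const (by positivity)
    filter_upwards [eventually_gt_atTop 0, hsmall] with n hn hs a ha
    have hb := ha.abs_integral_chiCorr_sub_le h₀
    have hl := ha.integral_chiCorr_sub_sq_le h₀
    set h : Obs S → ℝ := fun o => chiCorr (π n a) (m n a) o - chiCorr π₀ m₀ o
    refine le_trans (measure_mono fun o ho => ?_)
      (measure_empProcess_ge_le hn hl.1 hl.2 (half_pos hδ))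
    have ho' : δ ≤ |√(n : ℝ) * empMean o h - 0| := ho
    have e : √(n : ℝ) * empMean o h - 0 = empProcess P₀ o h + √(n : ℝ) * ∫ o, h o ∂P₀ := by
      rw [empProcess]; ring
    rw [e] at ho'
    have h2 : |√(n : ℝ) * ∫ o, h o ∂P₀| ≤ 2 * M * |√(n : ℝ) * ε n * r n| := by
      rw [abs_mul, abs_mul, abs_mul, abs_of_nonneg (Real.sqrt_nonneg _)]
      calc _ ≤ √(n : ℝ) * (2 * M * (|r n| * |ε n|)) := by gcongr
        _ = _ := by ring
    have h3 := abs_add_le (empProcess P₀ o h) (√(n : ℝ) * ∫ o, h o ∂P₀)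
    change δ / 2 ≤ |(empProcess P₀ o h)|
    linarith

/-- The Riesz representor at the sample points is bounded in probability. -/
lemma boundedInProb_riesz_sample (h₀ : ObsModel P₀ F₀ π₀ m₀ c)
    (hgood : BoundedInProb Q fun n a M => GoodPilot F₀ π₀ m₀ (π n a) (m n a) M (r n) (ε n))
    (hπm : ∀ n, Measurable fun q : A n × S => π n q.1 q.2) :
    BoundedInProb (sampling Q P₀)
      fun n s M => ∀ i d, |riesz (π n s.1) d (s.2 i).2.2| ≤ M := by
  have := h₀.prob_obs
  intro τ hτ
  obtain ⟨M, hM⟩ := hgood τ hτ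
  refine ⟨M, ?_⟩
  filter_upwards [hM] with n hn
  have hB : MeasurableSet {s : A n × (Fin n → Obs S) |
      ¬ ∀ i d, |riesz (π n s.1) d (s.2 i).2.2| ≤ M} := by
    have e : {s : A n × (Fin n → Obs S) | ¬ ∀ i d, |riesz (π n s.1) d (s.2 i).2.2| ≤ M}
        = (⋂ i, ⋂ d, {s | |riesz (π n s.1) d (s.2 i).2.2| ≤ M})ᶜ := by
      ext s; simp only [Set.mem_compl_iff, Set.mem_iInter, Set.mem_ofPred_eq]
    rw [e]
    refine (MeasurableSet.iInter fun i => MeasurableSet.iInter fun d => ?_).compl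
    have : Measurable fun s : A n × (Fin n → Obs S) => riesz (π n s.1) d (s.2 i).2.2 :=
      (measurable_riesz_prod (hπm n) d).comp
        (by fun_prop : Measurable fun s : A n × (Fin n → Obs S) => (s.1, (s.2 i).2.2))
    exact measurableSet_le this.abs measurable_const
  refine (sampling_le (b := 0) hB _ fun a ha => ?_).trans ((add_zero _).le.trans hn)
  have hg := h₀.ae_cov (not_not.1 ha).riesz_le
  have hall : ∀ᵐ o ∂(Measure.pi fun _ : Fin n => P₀), ∀ i d, |riesz (π n a) d (o i).2.2| ≤ M :=
    ae_all_iff.2 fun i =>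
      (measurePreserving_eval (fun _ : Fin n => P₀) i).quasiMeasurePreserving.ae hg
  exact (ae_iff.1 hall).le

end RandomQuantities

/-! ### Consistency of the posterior at the sample points -/

section Consistency

/-- The posterior mean of a bounded function, split over a set and its complement. -/
lemma lintegral_wlPosterior_le {Θ S : Type*} [MeasurableSpace Θ] {PW : Measure Θ}
    [IsProbabilityMeasure PW] {σ : ℝ} {W : Θ → Bool → S → ℝ} {γ : Bool → S → ℝ} {n : ℕ}
    {o : Fin n → Obs S} (hWm : ∀ d x, Measurable fun θ => W θ d x) {G : Set (Θ × ℝ)}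
    (hG : MeasurableSet G) {f : Θ × ℝ → ENNReal} (hf : Measurable f) (hf2 : ∀ z, f z ≤ 2) :
    ∫⁻ z, f z ∂(wlPosterior PW σ W γ o)
      ≤ (∫⁻ z in G, ENNReal.ofReal (likelihood (condMean (adjusted γ (W z.1) z.2)) o) * f z
          ∂(wlPrior PW σ))
        / (∫⁻ z in G, ENNReal.ofReal (likelihood (condMean (adjusted γ (W z.1) z.2)) o)
          ∂(wlPrior PW σ))
        + 2 * wlPosterior PW σ W γ o Gᶜ := by
  rw [← lintegral_add_compl f hG]
  refine add_le_add ?_ ?_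
  · rw [← lintegral_indicator hG, lintegral_wlPosterior hWm (hf.indicator hG)]
    have e : ∀ z, ENNReal.ofReal (likelihood (condMean (adjusted γ (W z.1) z.2)) o)
        * G.indicator f z = G.indicator (fun z =>
          ENNReal.ofReal (likelihood (condMean (adjusted γ (W z.1) z.2)) o) * f z) z := fun z => by
      by_cases hz : z ∈ G <;> simp [hz]
    simp_rw [e]
    rw [lintegral_indicator hG, div_eq_mul_inv, mul_comm]
    gcongr
    exact setLIntegral_le_lintegral _ _
  · calc _ ≤ ∫⁻ _ in Gᶜ, 2 ∂(wlPosterior PW σ W γ o) := lintegral_mono hf2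
      _ = _ := setLIntegral_const _ _

/-- The `L²` rates bound the mean discrepancy, since `L¹` norms are at most `L²` norms. -/
lemma lintegral_discrepancy_le_of_eLpNorm_le {S : Type*} [MeasurableSpace S] {F₀ : Measure S}
    [IsProbabilityMeasure F₀] {m m₀ : Bool → S → ℝ} (hm : ∀ d, Measurable (m d))
    (hm₀ : ∀ d, Measurable (m₀ d)) {ε : ℝ}
    (h : ∀ d, eLpNorm (fun x => m d x - m₀ d x) 2 F₀ ≤ ENNReal.ofReal ε) :
    ∫⁻ x, ENNReal.ofReal (discrepancy m m₀ x) ∂F₀ ≤ 2 * ENNReal.ofReal ε := by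
  have h1 : ∀ d, ∫⁻ x, ENNReal.ofReal |m d x - m₀ d x| ∂F₀ ≤ ENNReal.ofReal ε := fun d => by
    refine le_trans (le_of_eq ?_) ((eLpNorm_le_eLpNorm_of_exponent_le one_le_two
      ((hm d).sub (hm₀ d)).aestronglyMeasurable).trans (h d))
    rw [eLpNorm_one_eq_lintegral_enorm]
    simp only [Real.enorm_eq_ofReal_abs, Pi.sub_apply]
  simp only [discrepancy, ENNReal.ofReal_add (abs_nonneg _) (abs_nonneg _)]
  have h2 : Measurable fun x => ENNReal.ofReal |m true x - m₀ true x| :=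
    ((hm true).sub (hm₀ true)).abs.ennreal_ofReal
  rw [lintegral_add_left h2, two_mul]
  exact add_le_add (h1 true) (h1 false)

lemma avg_discrepancy_le_two {S : Type*} {n : ℕ} (η η' : Bool → S → ℝ) (o : Fin n → Obs S) :
    avg (fun i => discrepancy (condMean η) (condMean η') (o i).2.2) ≤ 2 := by
  refine (avg_le_avg fun i => discrepancy_condMean_le_two η η' _).trans ?_
  rw [avg, Finset.sum_const, Finset.card_univ, Fintype.card_fin, nsmul_eq_mul]
  exact div_le_of_le_mul₀ (by positivity) (by norm_num) (mul_comm _ _).le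

lemma lintegral_avg_discrepancy_ne_top {Θ S : Type*} [MeasurableSpace Θ] {PW : Measure Θ}
    [IsProbabilityMeasure PW] {σ : ℝ} {W : Θ → Bool → S → ℝ} {γ η₀ : Bool → S → ℝ} {n : ℕ}
    {o : Fin n → Obs S} (hWm : ∀ d x, Measurable fun θ => W θ d x) :
    ∫⁻ z, ENNReal.ofReal (avg fun i =>
        discrepancy (condMean (adjusted γ (W z.1) z.2)) (condMean η₀) (o i).2.2)
        ∂(wlPosterior PW σ W γ o) ≠ ⊤ := by
  have := isProbabilityMeasure_wlPosterior (PW := PW) (σ := σ) (γ := γ) (o := o) hWm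
  refine ne_top_of_le_ne_top (b := ENNReal.ofReal 2) ENNReal.ofReal_ne_top ?_
  calc _ ≤ ∫⁻ _, ENNReal.ofReal 2 ∂(wlPosterior PW σ W γ o) :=
        lintegral_mono fun z => ENNReal.ofReal_le_ofReal (avg_discrepancy_le_two _ _ _)
    _ = _ := by simp

/-- The parameters whose conditional mean is within `δ` of `m₀` in `L¹` of the covariate law. -/
def closeSet {Z S : Type*} [MeasurableSpace S] (F₀ : Measure S) (η : Z → Bool → S → ℝ)
    (m₀ : Bool → S → ℝ) (δ : ENNReal) : Set Z :=
  {z | ∫⁻ x, ENNReal.ofReal (discrepancy (condMean (η z)) m₀ x) ∂F₀ ≤ δ}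

/-- The posterior mean of the empirical discrepancy, for the prior `π` restricted to `G`. -/
def restrictedMean {Z S : Type*} [MeasurableSpace Z] (π : Measure Z) (η : Z → Bool → S → ℝ)
    (m₀ : Bool → S → ℝ) (G : Set Z) {n : ℕ} (o : Fin n → Obs S) : ENNReal :=
  (∫⁻ z in G, ENNReal.ofReal (likelihood (condMean (η z)) o)
      * ENNReal.ofReal (avg fun i => discrepancy (condMean (η z)) m₀ (o i).2.2) ∂π)
    / ∫⁻ z in G, ENNReal.ofReal (likelihood (condMean (η z)) o) ∂π

section RestrictedMean

variable {S Z A : Type*} [MeasurableSpace S] [MeasurableSpace Z] [MeasurableSpace A]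
  {F₀ : Measure S} [SFinite F₀] {π : Measure Z} [SFinite π] {η : A → Z → Bool → S → ℝ}
  {m₀ : Bool → S → ℝ} {δ : ENNReal}

lemma measurableSet_closeSet (hη : ∀ d, Measurable fun q : (A × Z) × S =>
      condMean (η q.1.1 q.1.2) d q.2) (hm₀ : ∀ d, Measurable (m₀ d)) :
    MeasurableSet {q : A × Z | q.2 ∈ closeSet F₀ (η q.1) m₀ δ} := by
  have h := measurable_discrepancy_prod (m := fun q : A × Z => condMean (η q.1 q.2)) hη hm₀
  exact measurableSet_le h.ennreal_ofReal.lintegral_prod_right' measurable_const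

lemma measurable_setLIntegral_slice {T : Type*} [MeasurableSpace T] {G : Set (T × Z)}
    (hG : MeasurableSet G) {F : T → Z → ENNReal} (hF : Measurable fun q : T × Z => F q.1 q.2) :
    Measurable fun t => ∫⁻ z in {z | (t, z) ∈ G}, F t z ∂π := by
  have h := (hF.indicator hG).lintegral_prod_right' (ν := π)
  refine (congrArg Measurable (funext fun t => ?_)).mp h
  have hGt : MeasurableSet {z | (t, z) ∈ G} := measurable_prodMk_left hG
  rw [← lintegral_indicator hGt]
  rfl

lemma measurable_restrictedMean (hη : ∀ d, Measurable fun q : (A × Z) × S =>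
      condMean (η q.1.1 q.1.2) d q.2) (hm₀ : ∀ d, Measurable (m₀ d)) (n : ℕ) :
    Measurable fun s : A × (Fin n → Obs S) =>
      restrictedMean π (η s.1) m₀ (closeSet F₀ (η s.1) m₀ δ) s.2 := by
  have hpair : Measurable fun w : (A × (Fin n → Obs S)) × Z => ((w.1.1, w.2), w.1.2) := by fun_prop
  have hset : MeasurableSet {w : (A × (Fin n → Obs S)) × Z |
      w.2 ∈ closeSet F₀ (η w.1.1) m₀ δ} :=
    (by fun_prop : Measurable fun w : (A × (Fin n → Obs S)) × Z => (w.1.1, w.2))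
      (measurableSet_closeSet hη hm₀)
  have h1 := (measurable_likelihood_prod (m := fun q : A × Z => condMean (η q.1 q.2)) hη n).comp
    hpair
  have h2 : Measurable fun q : (A × Z) × Obs S =>
      discrepancy (condMean (η q.1.1 q.1.2)) m₀ q.2.2.2 :=
    (measurable_discrepancy_prod (m := fun q : A × Z => condMean (η q.1 q.2)) hη hm₀).comp
      (by fun_prop : Measurable fun q : (A × Z) × Obs S => (q.1, q.2.2.2))
  have h3 := (measurable_avg_apply (f := fun (q : A × Z) (o : Obs S) =>
    discrepancy (condMean (η q.1 q.2)) m₀ o.2.2) h2 n).comp hpair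
  have hlik : Measurable fun w : (A × (Fin n → Obs S)) × Z =>
      ENNReal.ofReal (likelihood (condMean (η w.1.1 w.2)) w.1.2) := h1.ennreal_ofReal
  have hdis : Measurable fun w : (A × (Fin n → Obs S)) × Z => ENNReal.ofReal
      (avg fun i => discrepancy (condMean (η w.1.1 w.2)) m₀ (w.1.2 i).2.2) := h3.ennreal_ofReal
  exact (measurable_setLIntegral_slice hset (F := fun (s : A × (Fin n → Obs S)) z =>
      ENNReal.ofReal (likelihood (condMean (η s.1 z)) s.2) * ENNReal.ofReal
        (avg fun i => discrepancy (condMean (η s.1 z)) m₀ (s.2 i).2.2)) (hlik.mul hdis)).div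
    (measurable_setLIntegral_slice hset (F := fun (s : A × (Fin n → Obs S)) z =>
      ENNReal.ofReal (likelihood (condMean (η s.1 z)) s.2)) hlik)

end RestrictedMean

variable {S : Type*} [MeasurableSpace S] {P₀ : Measure (Obs S)} {F₀ : Measure S} {π₀ : S → ℝ}
  {η₀ : Bool → S → ℝ} {c : ℝ} {A : ℕ → Type*} [∀ n, MeasurableSpace (A n)] {Q : ∀ n, Measure (A n)}
  [∀ n, IsProbabilityMeasure (Q n)] {π : ∀ n, A n → S → ℝ} {ε : ℕ → ℝ} {Θ : ℕ → Type*}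
  [∀ n, MeasurableSpace (Θ n)] {PW : ∀ n, Measure (Θ n)} [∀ n, IsProbabilityMeasure (PW n)]
  {W : ∀ n, Θ n → Bool → S → ℝ} {σ : ℕ → ℝ} {H : ∀ n, A n → Set (Bool → S → ℝ)}

/-- The posterior mean of the discrepancy between the conditional means at the sample points tends
to zero in probability, as the posterior concentrates on parameters of small discrepancy in the
population. -/
theorem tendstoInProb_posterior_discrepancy (h₀ : ObsModel P₀ F₀ π₀ (condMean η₀) c)
    (hπm : ∀ n, Measurable fun q : A n × S => π n q.1 q.2)
    (hWm : ∀ n d x, Measurable fun θ => W n θ d x)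
    (hWj : ∀ n d, Measurable fun q : Θ n × S => W n q.1 d q.2)
    (hHfun : ∀ n a, ∀ η ∈ H n a, ∀ d, Measurable (η d))
    (hHpost : TendstoInProb (sampling Q P₀)
      (fun n s => (wlPosterior (PW n) (σ n) (W n) (riesz (π n s.1)) s.2).real
        {z | adjusted (riesz (π n s.1)) (W n z.1) z.2 ∈ H n s.1}) 1)
    (hε : Tendsto ε atTop (𝓝 0))
    (hHrate : Vanishing Q fun n =>
      {a | ¬ ∀ η ∈ H n a, ∀ d, eLpNorm (fun x => condMean η d x - condMean η₀ d x) 2 F₀ ≤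
        ENNReal.ofReal (ε n)}) :
    TendstoInProb (sampling Q P₀) (fun n s => (∫⁻ z, ENNReal.ofReal (avg fun i =>
        discrepancy (condMean (adjusted (riesz (π n s.1)) (W n z.1) z.2)) (condMean η₀)
          (s.2 i).2.2) ∂(wlPosterior (PW n) (σ n) (W n) (riesz (π n s.1)) s.2)).toReal) 0 := by
  have := h₀.prob_obs
  have := h₀.prob_cov
  intro τ hτ
  have hsig : Measurable Real.sigmoid := continuous_sigmoid.measurable
  let η : ∀ n, A n → Θ n × ℝ → Bool → S → ℝ := fun n a z =>
    adjusted (riesz (π n a)) (W n z.1) z.2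
  have hη : ∀ n d, Measurable fun q : (A n × (Θ n × ℝ)) × S =>
      condMean (η n q.1.1 q.1.2) d q.2 := fun n d => by
    have h1 := (hWj n d).comp (by fun_prop :
      Measurable fun q : (A n × (Θ n × ℝ)) × S => (q.1.2.1, q.2))
    have h2 := (measurable_riesz_prod (hπm n) d).comp (by fun_prop :
      Measurable fun q : (A n × (Θ n × ℝ)) × S => (q.1.1, q.2))
    have h3 : Measurable fun q : (A n × (Θ n × ℝ)) × S => q.1.2.2 := by fun_prop
    exact hsig.comp (h1.add (h3.mul h2))
  let G : ∀ n, A n → Set (Θ n × ℝ) := fun n a =>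
    closeSet F₀ (η n a) (condMean η₀) (2 * ENNReal.ofReal (ε n))
  have hG : ∀ n a, MeasurableSet (G n a) := fun n a =>
    measurable_prodMk_left (measurableSet_closeSet (hη n) h₀.measurable_mean)
  have hprior : ∀ n, IsProbabilityMeasure (wlPrior (PW n) (σ n)) := fun n => by
    unfold wlPrior; infer_instance
  let R : ∀ n, A n × (Fin n → Obs S) → ENNReal := fun n s =>
    restrictedMean (wlPrior (PW n) (σ n)) (η n s.1) (condMean η₀) (G n s.1) s.2
  have hR : ∀ n, Measurable (R n) := fun n =>
    measurable_restrictedMean (hη n) h₀.measurable_mean n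
  have hRmean : ∀ n, 0 < n → ∀ a, ∫⁻ o, R n (a, o) ∂(Measure.pi fun _ : Fin n => P₀)
      ≤ 6 * (2 * ENNReal.ofReal (ε n)) := fun n hn a => by
    refine h₀.lintegral_posterior_discrepancy_le (π := (wlPrior (PW n) (σ n)).restrict (G n a))
      (η := η n a) (fun d => ?_) ?_ hn
    · exact (hη n d).comp (by fun_prop :
        Measurable fun q : (Θ n × ℝ) × S => ((a, q.1), q.2))
    · exact ae_restrict_of_forall_mem (hG n a) fun z hz => hz
  have hRvan : Vanishing (sampling Q P₀) fun n => {s | ENNReal.ofReal (τ / 2) ≤ R n s} := by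
    have hlim : Tendsto (fun n => 6 * (2 * ENNReal.ofReal (ε n)) / ENNReal.ofReal (τ / 2)) atTop
        (𝓝 0) := by
      have h1 := ENNReal.tendsto_ofReal hε
      rw [ENNReal.ofReal_zero] at h1
      have h2 := ENNReal.Tendsto.div_const (ENNReal.Tendsto.const_mul (a := 6)
        (ENNReal.Tendsto.const_mul (a := 2) h1 (Or.inr ENNReal.ofNat_ne_top))
        (Or.inr ENNReal.ofNat_ne_top)) (b := ENNReal.ofReal (τ / 2)) (Or.inr (by simpa using hτ))
      simpa using h2
    refine tendsto_of_tendsto_of_tendsto_of_le_of_le' tendsto_const_nhds hlim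
      (Eventually.of_forall fun _ => zero_le) ?_
    filter_upwards [eventually_gt_atTop 0] with n hn
    refine (sampling_le (measurableSet_le measurable_const (hR n)) ∅ fun a _ => ?_).trans
      (by rw [measure_empty, zero_add])
    refine (meas_ge_le_lintegral_div ((hR n).comp measurable_prodMk_left).aemeasurable
      (by simpa using hτ) ENNReal.ofReal_ne_top).trans ?_
    exact ENNReal.div_le_div_right (hRmean n hn a) _
  refine (hRvan.union ((hHpost (τ / 4) (by positivity)).union
    (vanishing_sampling_of_fst hHrate))).mono fun n s hs => ?_
  by_contra hcon
  simp only [Set.mem_union, Set.mem_ofPred_eq, not_or, not_not, not_le] at hcon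
  obtain ⟨c1, c2, c3⟩ := hcon
  set μ := wlPosterior (PW n) (σ n) (W n) (riesz (π n s.1)) s.2 with hμ
  have hμp : IsProbabilityMeasure μ := isProbabilityMeasure_wlPosterior (hWm n)
  have hsub : {z : Θ n × ℝ | adjusted (riesz (π n s.1)) (W n z.1) z.2 ∈ H n s.1}
      ⊆ G n s.1 := fun z hz =>
    lintegral_discrepancy_le_of_eLpNorm_le
      (fun d => hsig.comp (hHfun n s.1 _ hz d)) h₀.measurable_mean (c3 _ hz)
  have hmass : μ (G n s.1)ᶜ ≤ ENNReal.ofReal (τ / 4) := by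
    rw [← ENNReal.ofReal_toReal (measure_ne_top μ _)]
    refine ENNReal.ofReal_le_ofReal ?_
    rw [← measureReal_def, probReal_compl_eq_one_sub (hG n s.1)]
    have h1 := measureReal_mono (μ := μ) hsub
    have h2 := neg_le_of_abs_le c2.le
    linarith
  have hD := lintegral_wlPosterior_le (PW := PW n) (σ := σ n) (γ := riesz (π n s.1)) (o := s.2)
    (hWm n) (hG n s.1)
    (measurable_avg_discrepancy (γ := riesz (π n s.1)) (o := s.2) (hWm n)
      (condMean η₀)).ennreal_ofReal fun z => by
      rw [← ENNReal.ofReal_ofNat]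
      exact ENNReal.ofReal_le_ofReal (avg_discrepancy_le_two _ _ _)
  set D := ∫⁻ z, ENNReal.ofReal (avg fun i => discrepancy
    (condMean (adjusted (riesz (π n s.1)) (W n z.1) z.2)) (condMean η₀) (s.2 i).2.2) ∂μ
  have hlt : D < ENNReal.ofReal τ := by
    calc _ ≤ R n s + 2 * μ (G n s.1)ᶜ := hD
      _ < ENNReal.ofReal (τ / 2) + ENNReal.ofReal (τ / 2) := by
        refine ENNReal.add_lt_add_of_lt_of_le ?_ c1 ?_
        · exact ENNReal.mul_ne_top ENNReal.ofNat_ne_top (measure_ne_top _ _)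
        · calc _ ≤ 2 * ENNReal.ofReal (τ / 4) := by gcongr
            _ = ENNReal.ofReal (τ / 2) := by
              rw [← ENNReal.ofReal_ofNat, ← ENNReal.ofReal_mul (by norm_num)]
              congr 1; ring
      _ = ENNReal.ofReal τ := by
        rw [← ENNReal.ofReal_add (by positivity) (by positivity), add_halves]
  have hs' : τ ≤ |D.toReal - 0| := hs
  rw [sub_zero, abs_of_nonneg ENNReal.toReal_nonneg] at hs'
  have := (ENNReal.toReal_lt_toReal (hlt.trans ENNReal.ofReal_lt_top).ne
    ENNReal.ofReal_ne_top).2 hlt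
  rw [ENNReal.toReal_ofReal hτ.le] at this
  linarith

end Consistency

/-! ### Identification of the population quantities -/

section Population

variable {Ω S : Type*} [mΩ : MeasurableSpace Ω] [mS : MeasurableSpace S] {P : Measure Ω}
  [IsProbabilityMeasure P] {Y1 Y0 D : Ω → Bool} {X : Ω → S} {π₀ : S → ℝ} {η₀ : Bool → S → ℝ}

lemma measurable_condMean (hη₀m : ∀ d, Measurable (η₀ d)) (d : Bool) :
    Measurable (condMean η₀ d) :=
  (continuous_sigmoid.measurable).comp (hη₀m d)

lemma measurable_observed (hY1 : Measurable Y1) (hY0 : Measurable Y0) (hD : Measurable D)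
    (hX : Measurable X) : Measurable (observed Y1 Y0 D X) :=
  (Measurable.ite (hD (measurableSet_singleton true)) hY1 hY0).prodMk (hD.prodMk hX)

/-- The law of the observed variables as an observation model. -/
lemma obsModel_observed (hY1 : Measurable Y1) (hY0 : Measurable Y0) (hD : Measurable D)
    (hX : Measurable X) (hπ₀m : Measurable π₀)
    (hπ₀ : (fun ω => π₀ (X ω)) =ᵐ[P] P⟦{ω | D ω = true} | MeasurableSpace.comap X mS⟧)
    (hη₀m : ∀ d, Measurable (η₀ d))
    (hη₀ : (fun ω => condMean η₀ (D ω) (X ω)) =ᵐ[P]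
      P⟦{ω | (observed Y1 Y0 D X ω).1 = true} |
        MeasurableSpace.comap (fun ω => (D ω, X ω)) inferInstance⟧)
    {c : ℝ} (hc : 0 < c) (hov : ∀ᵐ x ∂(P.map X), c < π₀ x ∧ π₀ x < 1 - c) :
    ObsModel (P.map (observed Y1 Y0 D X)) (P.map X) π₀ (condMean η₀) c := by
  have hobs := measurable_observed hY1 hY0 hD hX
  have hDX : P.map (fun ω => (D ω, X ω)) = mixture (P.map X) π₀ := map_eq_mixture hX hD hπ₀m hπ₀
  have hm : Measurable fun q : Bool × S => condMean η₀ q.1 q.2 :=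
    measurable_uncurry_bool (measurable_condMean hη₀m)
  have hY : P.map (observed Y1 Y0 D X)
      = mixture (P.map fun ω => (D ω, X ω)) fun q => condMean η₀ q.1 q.2 :=
    map_eq_mixture (hD.prodMk hX) (B := fun ω => (observed Y1 Y0 D X ω).1)
      (measurable_fst.comp hobs) hm hη₀
  exact
    { prob_obs := Measure.isProbabilityMeasure_map hobs.aemeasurable
      prob_cov := Measure.isProbabilityMeasure_map hX.aemeasurable
      measurable_prop := hπ₀m
      measurable_mean := measurable_condMean hη₀m
      mean_mem := condMean_mem η₀
      pos := hc
      overlap := hov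
      law_eq := by rw [hY, hDX]
      map_snd := by
        rw [Measure.map_map measurable_snd hobs, ← hDX]; rfl
      map_cov := by
        have hm2 : Measurable fun o : Obs S => o.2.2 := measurable_snd.comp measurable_snd
        rw [Measure.map_map hm2 hobs]; rfl }

/-- On the arm `D = d`, the observed outcome has the regression function `condMean η₀ d`. -/
lemma setIntegral_bit_eq (hY1 : Measurable Y1) (hY0 : Measurable Y0) (hD : Measurable D)
    (hX : Measurable X)
    (hη₀ : (fun ω => condMean η₀ (D ω) (X ω)) =ᵐ[P]
      P⟦{ω | (observed Y1 Y0 D X ω).1 = true} |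
        MeasurableSpace.comap (fun ω => (D ω, X ω)) inferInstance⟧)
    {U : Ω → Bool} {d : Bool} (hU : ∀ ω, D ω = d → (observed Y1 Y0 D X ω).1 = U ω) {s : Set S}
    (hs : MeasurableSet s) :
    ∫ ω in X ⁻¹' s ∩ {ω | D ω = d}, bit (U ω) ∂P
      = ∫ ω in X ⁻¹' s ∩ {ω | D ω = d}, condMean η₀ d (X ω) ∂P := by
  have hobs := measurable_observed hY1 hY0 hD hX
  have hDX : Measurable fun ω => (D ω, X ω) := hD.prodMk hX
  have hE : MeasurableSet {ω | (observed Y1 Y0 D X ω).1 = true} :=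
    (measurable_fst.comp hobs) (measurableSet_singleton true)
  have hset : X ⁻¹' s ∩ {ω | D ω = d} = (fun ω => (D ω, X ω)) ⁻¹' ({d} ×ˢ s) := by
    ext ω; simp [and_comm]
  have hms : MeasurableSet (X ⁻¹' s ∩ {ω | D ω = d}) :=
    (hX hs).inter (hD (measurableSet_singleton d))
  have h1 : ∫ ω in X ⁻¹' s ∩ {ω | D ω = d}, bit (U ω) ∂P
      = ∫ ω in X ⁻¹' s ∩ {ω | D ω = d},
        {ω | (observed Y1 Y0 D X ω).1 = true}.indicator (fun _ => (1 : ℝ)) ω ∂P := by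
    refine setIntegral_congr_fun hms fun ω hω => ?_
    have := hU ω hω.2
    simp [Set.indicator_apply, bit, this]
  have h2 : ∫ ω in X ⁻¹' s ∩ {ω | D ω = d}, condMean η₀ d (X ω) ∂P
      = ∫ ω in X ⁻¹' s ∩ {ω | D ω = d}, (P⟦{ω | (observed Y1 Y0 D X ω).1 = true} |
        MeasurableSpace.comap (fun ω => (D ω, X ω)) inferInstance⟧) ω ∂P := by
    refine setIntegral_congr_ae hms ?_
    filter_upwards [hη₀] with ω hω hmem
    rw [← hω, hmem.2]
  rw [h1, h2, setIntegral_condExp hDX.comap_le ((integrable_const (1 : ℝ)).indicator hE)]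
  rw [hset]
  exact ⟨_, (measurableSet_singleton d).prod hs, rfl⟩

/-- Identification of the average treatment effect by the regression contrast. -/
lemma ate_eq_integral_contrast [StandardBorelSpace Ω] (hY1 : Measurable Y1) (hY0 : Measurable Y0)
    (hD : Measurable D) (hX : Measurable X)
    (hπ₀ : (fun ω => π₀ (X ω)) =ᵐ[P] P⟦{ω | D ω = true} | MeasurableSpace.comap X mS⟧)
    (hη₀m : ∀ d, Measurable (η₀ d))
    (hη₀ : (fun ω => condMean η₀ (D ω) (X ω)) =ᵐ[P]
      P⟦{ω | (observed Y1 Y0 D X ω).1 = true} |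
        MeasurableSpace.comap (fun ω => (D ω, X ω)) inferInstance⟧)
    (hunconf : CondIndepFun (MeasurableSpace.comap X mS) hX.comap_le
      (fun ω => (Y0 ω, Y1 ω)) D P)
    {c : ℝ} (hc : 0 < c) (hov : ∀ᵐ x ∂(P.map X), c < π₀ x ∧ π₀ x < 1 - c) :
    ∫ ω, (bit (Y1 ω) - bit (Y0 ω)) ∂P = ∫ x, contrast (condMean η₀) x ∂(P.map X) := by
  have hmm := measurable_condMean hη₀m
  have hm1 : ∀ d x, |condMean η₀ d x| ≤ 1 := fun d x => by
    have := condMean_mem η₀ d x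
    rw [abs_le]; constructor <;> linarith
  have hov' := ae_of_ae_map hX.aemeasurable hov
  have hbit : ∀ U : Ω → Bool, Measurable U → Integrable (fun ω => bit (U ω)) P := fun U hU => by
    refine Integrable.of_bound (C := 1) ((measurable_of_finite bit).comp hU).aestronglyMeasurable
      (Eventually.of_forall fun ω => ?_)
    cases U ω <;> simp [bit]
  have h1 : ∫ ω, bit (Y1 ω) ∂P = ∫ ω, condMean η₀ true (X ω) ∂P := by
    refine integral_potential_outcome hY1 hD hX (hmm true) (hm1 true) hπ₀ ?_
      (hunconf.comp measurable_snd measurable_id)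
      fun s hs => setIntegral_bit_eq hY1 hY0 hD hX hη₀ (fun ω h => by simp [observed, h]) hs
    filter_upwards [hov'] with ω h
    linarith
  have hE : MeasurableSet {ω | D ω = true} := hD (measurableSet_singleton true)
  have hset : {ω | (!D ω) = true} = {ω | D ω = true}ᶜ := by ext ω; simp
  have hset' : {ω | (!D ω) = true} = {ω | D ω = false} := by ext ω; simp
  have hq : (fun ω => 1 - π₀ (X ω)) =ᵐ[P]
      P⟦{ω | (!D ω) = true} | MeasurableSpace.comap X mS⟧ := by
    have e : ({ω | D ω = true}ᶜ.indicator fun _ => (1 : ℝ))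
        = (fun _ => (1 : ℝ)) - {ω | D ω = true}.indicator fun _ => (1 : ℝ) := by
      ext ω
      by_cases h : D ω = true <;> simp [h]
    rw [hset, e]
    have h2 := condExp_sub (μ := P) (integrable_const (1 : ℝ))
      ((integrable_const (1 : ℝ)).indicator hE) (MeasurableSpace.comap X mS)
    rw [condExp_const hX.comap_le] at h2
    filter_upwards [h2, hπ₀] with ω g1 g2
    rw [g1, Pi.sub_apply, ← g2]
  have h0 : ∫ ω, bit (Y0 ω) ∂P = ∫ ω, condMean η₀ false (X ω) ∂P := by
    refine integral_potential_outcome (B := fun ω => !D ω) hY0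
      ((measurable_of_finite not).comp hD) hX (hmm false) (hm1 false)
      (q := fun x => 1 - π₀ x) hq ?_
      (hunconf.comp measurable_fst (measurable_of_finite not)) fun s hs => ?_
    · filter_upwards [hov'] with ω h
      linarith
    · rw [hset']
      exact setIntegral_bit_eq hY1 hY0 hD hX hη₀ (fun ω h => by simp [observed, h]) hs
  have hint : ∀ d, Integrable (fun ω => condMean η₀ d (X ω)) P := fun d =>
    Integrable.of_bound ((hmm d).comp hX).aestronglyMeasurable 1
      (Eventually.of_forall fun ω => hm1 d _)
  have hcm : Measurable (contrast (condMean η₀)) := (hmm true).sub (hmm false)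
  rw [integral_sub (hbit _ hY1) (hbit _ hY0), h1, h0, ← integral_sub (hint true) (hint false),
    integral_map hX.aemeasurable hcm.aestronglyMeasurable]
  rfl

end Population

/-! ### The recentred posterior -/

/-- Convergence of two sequences from the form in which `TendstoInProb.abs_add_abs` combines them.
-/
lemma tendsto_of_abs_add_abs {a b : ℕ → ℝ} {c d : ℝ}
    (h : Tendsto (fun k => |a k - c| + |b k - d|) atTop (𝓝 0)) :
    Tendsto a atTop (𝓝 c) ∧ Tendsto b atTop (𝓝 d) := by
  constructor <;> refine tendsto_iff_dist_tendsto_zero.2 (squeeze_zero (fun _ => dist_nonneg)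
    (fun k => ?_) h)
  · exact le_add_of_nonneg_right (abs_nonneg _)
  · exact le_add_of_nonneg_left (abs_nonneg _)

end RobustATE

end

theorem theorem2
    -- the population: potential outcomes, treatment, covariates in a subset of `ℝ^p`
    {p : ℕ} {𝒳 : Set (EuclideanSpace ℝ (Fin p))}
    {Ω : Type*} [MeasurableSpace Ω] [StandardBorelSpace Ω]
    (P : Measure Ω) [IsProbabilityMeasure P]
    (Y1 Y0 D : Ω → Bool) (X : Ω → 𝒳)
    (hY1 : Measurable Y1) (hY0 : Measurable Y0) (hD : Measurable D) (hX : Measurable X)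
    -- law of the observation, law of the covariates, average treatment effect
    (P₀ : Measure (Obs 𝒳)) (hP₀ : P₀ = P.map (observed Y1 Y0 D X))
    (F₀ : Measure 𝒳) (hF₀ : F₀ = P.map X)
    (χ₀ : ℝ) (hχ₀ : χ₀ = ∫ ω, (bit (Y1 ω) - bit (Y0 ω)) ∂P)
    -- propensity score and conditional mean, the latter with values in `(0, 1)`
    (π₀ : 𝒳 → ℝ) (hπ₀m : Measurable π₀)
    (hπ₀ : (fun ω => π₀ (X ω)) =ᵐ[P]
      P⟦{ω | D ω = true} | MeasurableSpace.comap X inferInstance⟧)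
    (η₀ : Bool → 𝒳 → ℝ) (hη₀m : ∀ d, Measurable (η₀ d))
    (hη₀ : (fun ω => condMean η₀ (D ω) (X ω)) =ᵐ[P]
      P⟦{ω | (observed Y1 Y0 D X ω).1 = true} |
        MeasurableSpace.comap (fun ω => (D ω, X ω)) inferInstance⟧)
    -- unconfoundedness and overlap
    (hunconf : CondIndepFun (MeasurableSpace.comap X inferInstance) hX.comap_le
      (fun ω => (Y0 ω, Y1 ω)) D P)
    (hoverlap : ∃ c : ℝ, 0 < c ∧ ∀ᵐ x ∂F₀, c < π₀ x ∧ π₀ x < 1 - c)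
    -- auxiliary sample and the pilot estimators computed from it
    {A : ℕ → Type*} [∀ n, MeasurableSpace (A n)]
    (Q : ∀ n, Measure (A n)) [∀ n, IsProbabilityMeasure (Q n)]
    (πhat : ∀ n, A n → 𝒳 → ℝ)
    (hπhatm : ∀ n, Measurable fun q : A n × 𝒳 => πhat n q.1 q.2)
    (hπhat : ∀ n a x, 0 < πhat n a x ∧ πhat n a x < 1)
    (mhat : ∀ n, A n → Bool → 𝒳 → ℝ)
    (hmhatm : ∀ n d, Measurable fun q : A n × 𝒳 => mhat n q.1 d q.2)
    -- prior: continuous stochastic processes `W n` and Gaussian scale parameters `σ n`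
    {Θ : ℕ → Type*} [∀ n, MeasurableSpace (Θ n)]
    (PW : ∀ n, Measure (Θ n)) [∀ n, IsProbabilityMeasure (PW n)]
    (W : ∀ n, Θ n → Bool → 𝒳 → ℝ)
    (hWm : ∀ n d x, Measurable fun θ => W n θ d x)
    (hWc : ∀ n θ d, Continuous (W n θ d))
    (σ : ℕ → ℝ) (hσ : ∀ n, 0 < σ n)
    (hσn : Tendsto (fun n : ℕ => (n : ℝ) * σ n ^ 2) atTop atTop)
    -- measurable sets of functions that receive posterior mass tending to one
    (H : ∀ n, A n → Set (Bool → 𝒳 → ℝ))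
    (hHfun : ∀ n a, ∀ η ∈ H n a, ∀ d, Measurable (η d))
    (hHm : ∀ n a, MeasurableSet
      {z : Θ n × ℝ | adjusted (riesz (πhat n a)) (W n z.1) z.2 ∈ H n a})
    (hHpost : TendstoInProb (sampling Q P₀)
      (fun n s => (wlPosterior (PW n) (σ n) (W n) (riesz (πhat n s.1)) s.2).real
        {z | adjusted (riesz (πhat n s.1)) (W n z.1) z.2 ∈ H n s.1}) 1)
    -- rates of convergence
    (r ε : ℕ → ℝ) (hr : Tendsto r atTop (𝓝 0)) (hε : Tendsto ε atTop (𝓝 0))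
    (hrε : Tendsto (fun n : ℕ => √(n : ℝ) * ε n * r n) atTop (𝓝 0))
    (hπrate : Vanishing Q fun n =>
      {a | ¬ eLpNorm (fun x => πhat n a x - π₀ x) 2 F₀ ≤ ENNReal.ofReal (r n)})
    (hmrate : Vanishing Q fun n =>
      {a | ¬ ∀ d, eLpNorm (fun x => mhat n a d x - condMean η₀ d x) 2 F₀ ≤
        ENNReal.ofReal (ε n)})
    (hHrate : Vanishing Q fun n =>
      {a | ¬ ∀ η ∈ H n a, ∀ d, eLpNorm (fun x => condMean η d x - condMean η₀ d x) 2 F₀ ≤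
        ENNReal.ofReal (ε n)})
    (hγbdd : BoundedInProb Q fun n a M => ∀ d, ∀ᵐ x ∂F₀, |riesz (πhat n a) d x| ≤ M)
    -- complexity
    (hGC : UnifNegligible (sampling Q P₀) (fun n s => H n s.1) fun n s η =>
      empMean s.2 (fun o => contrast (condMean η) o.2.2) -
        ∫ o, contrast (condMean η) o.2.2 ∂P₀)
    (hSE : UnifNegligible (sampling Q P₀) (fun n s => H n s.1) fun n s η =>
      empProcess P₀ s.2 fun o => (riesz (πhat n s.1) o.2.1 o.2.2 - riesz π₀ o.2.1 o.2.2) *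
        (condMean η o.2.1 o.2.2 - condMean η₀ o.2.1 o.2.2))
    -- prior stability
    (hlam : ∃ u : ℕ → ℝ, Tendsto u atTop (𝓝 0) ∧
      TendstoInProb (sampling Q P₀)
        (fun n s => (wlPosterior (PW n) (σ n) (W n) (riesz (πhat n s.1)) s.2).real
          {z | |z.2| ≤ u n * σ n ^ 2 * √(n : ℝ)}) 1)
    (hshift : ∀ t : ℝ, TendstoInProb (sampling Q P₀)
      (fun n s => (wlPosterior (PW n) (σ n) (W n) (riesz (πhat n s.1)) s.2).real
        {z | adjusted (riesz (πhat n s.1)) (W n z.1) (z.2 + t / √(n : ℝ)) ∈ H n s.1}) 1)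
    -- an asymptotically efficient estimator
    (χhat : ∀ n, A n × (Fin n → Obs 𝒳) → ℝ)
    (hχhat : TendstoInProb (sampling Q P₀)
      (fun n s => √(n : ℝ) * (χhat n s - χ₀ - empMean s.2 (eif π₀ (condMean η₀) χ₀))) 0) :
    TendstoInProb (sampling Q P₀)
      (fun n s => blDist
        (recenteredPosterior (PW n) (σ n) (W n) (πhat n s.1) (mhat n s.1) (χhat n s) s.2)
        (gaussianReal 0 (∫ o, eif π₀ (condMean η₀) χ₀ o ^ 2 ∂P₀).toNNReal)) 0 := by
  classical
  obtain ⟨c, hc, hov⟩ := hoverlap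
  have hΨ := condMean_mem η₀
  have h₀ : ObsModel P₀ F₀ π₀ (condMean η₀) c := by
    rw [hP₀, hF₀]
    rw [hF₀] at hov
    exact obsModel_observed hY1 hY0 hD hX hπ₀m hπ₀ hη₀m hη₀ hc hov
  have hχ : χ₀ = ∫ x, contrast (condMean η₀) x ∂F₀ := by
    rw [hF₀] at hov
    rw [hχ₀, hF₀]
    exact ate_eq_integral_contrast hY1 hY0 hD hX hπ₀ hη₀m hη₀ hunconf hc hov
  have hgood := boundedInProb_goodPilot hπhatm hπhat hmhatm hπrate hmrate hγbdd
  have hWj : ∀ n d, Measurable fun q : Θ n × 𝒳 => W n q.1 d q.2 := fun n d =>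
    (measurable_uncurry_of_continuous_of_measurable (u := fun (x : 𝒳) θ => W n θ d x)
      (fun θ => hWc n θ d) (hWm n d)).comp measurable_swap
  obtain ⟨u, hu, hlamu⟩ := hlam
  have hcm : Measurable (contrast (condMean η₀)) :=
    (h₀.measurable_mean true).sub (h₀.measurable_mean false)
  have hcb : ∀ x, |contrast (condMean η₀) x| ≤ 1 := fun x => by
    have h1 := hΨ true x
    have h2 := hΨ false x
    rw [contrast, abs_le]; constructor <;> linarith
  have hcb2 : ∀ x, |contrast (condMean η₀) x ^ 2| ≤ 1 := fun x => by
    rw [abs_pow]; exact pow_le_one₀ (abs_nonneg _) (hcb x)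
  -- the random quantities that determine the limit
  have q1 := tendstoInProb_information h₀ hgood hπhatm hr
  have q2 := tendstoInProb_avg_cov (Q := Q) h₀ (hcm.pow_const 2) hcb2
  have q3 := tendstoInProb_avg_cov (Q := Q) h₀ hcm hcb
  have q4 := tendstoInProb_pilot_correction h₀ hgood hπhatm hmhatm hr hε hrε
  have q5 := tendstoInProb_posterior_discrepancy (PW := PW) (σ := σ) h₀ hπhatm hWm hWj hHfun
    hHpost hε hHrate
  rw [h₀.integral_eif_sq hχ]
  refine tendstoInProb_of_selection
    (((((q1.abs_add_abs q2).abs_add_abs q3).abs_add_abs q4).abs_add_abs q5).abs_add_abs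
      hlamu |>.abs_add_abs hχhat) (boundedInProb_riesz_sample h₀ hgood hπhatm)
    fun M n s hn hlim hM => ?_
  obtain ⟨l6, l7⟩ := tendsto_of_abs_add_abs hlim
  obtain ⟨l5, hL⟩ := tendsto_of_abs_add_abs l6
  obtain ⟨l4, hD⟩ := tendsto_of_abs_add_abs l5
  obtain ⟨l3, hρ⟩ := tendsto_of_abs_add_abs l4
  obtain ⟨l2, hf⟩ := tendsto_of_abs_add_abs l3
  obtain ⟨hI, hf2⟩ := tendsto_of_abs_add_abs l2
  have hm₀ : ∀ d x, 0 ≤ condMean η₀ d x ∧ condMean η₀ d x ≤ 1 := fun d x =>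
    ⟨(hΨ d x).1.le, (hΨ d x).2.le⟩
  refine tendsto_blDist_recenteredPosterior hn (PW := fun k => PW (n k)) (W := fun k => W (n k))
    (fun k => hWm (n k)) (σ := fun k => σ (n k)) (fun k => hσ (n k)) (hσn.comp hn)
    (π := fun k => πhat (n k) (s k).1) (m := fun k => mhat (n k) (s k).1)
    (χ := fun k => χhat (n k) (s k)) (o := fun k => (s k).2) hM hm₀ (hu.comp hn) hL hD
    (fun k => ENNReal.toReal_nonneg)
    (fun k => (ENNReal.ofReal_toReal (lintegral_avg_discrepancy_ne_top (hWm (n k)))).ge)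
    (integral_nonneg fun o => ?_) hI (hf2.sub (hf.pow 2)) ?_
  · have := hm₀ o.2.1 o.2.2
    exact mul_nonneg (sq_nonneg _) (mul_nonneg this.1 (by linarith))
  · have h := hρ.sub l7
    rw [sub_zero] at h
    refine h.congr' ?_
    filter_upwards [hn.eventually_gt_atTop 0] with k hk
    have hk' : (n k : ℝ) ≠ 0 := by exact_mod_cast hk.ne'
    have e1 : empMean (s k).2 (eif π₀ (condMean η₀) χ₀)
        = empMean (s k).2 (chiCorr π₀ (condMean η₀)) - χ₀ := by
      simp only [empMean, eif, Finset.sum_sub_distrib, Finset.sum_const, Finset.card_univ,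
        Fintype.card_fin, nsmul_eq_mul]
      field_simp
    have e2 : (empMean (s k).2 fun o => chiCorr (πhat (n k) (s k).1) (mhat (n k) (s k).1) o
          - chiCorr π₀ (condMean η₀) o)
        = empMean (s k).2 (chiCorr (πhat (n k) (s k).1) (mhat (n k) (s k).1))
          - empMean (s k).2 (chiCorr π₀ (condMean η₀)) := by
      simp only [empMean, Finset.sum_sub_distrib, sub_div]
    rw [e1, e2]
    ring
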